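/- **Model.** Ground base stations (BSs) at height $h_g$ have horizontal positions forming a homogeneous Poisson point process $\{X_i\}$ on $\mathbb R^2$ of density $\lambda_g>0$; a reference UAV hovers at height $h_u$ above the origin; $\Delta_h=|h_u-h_g|$ and $s_i=\|X_i\|$. Each BS is independently backhaul-enabled with probability $\delta_b\in(0,1]$; $\lambda_b=\delta_b\lambda_g$. Independently, given the positions, the link of BS $i$ is line-of-sight ($l$) with probability $\kappa_l(s_i)$, where $\kappa_l(r)=-c\,e^{-d\arctan(\Delta_h/r)}+e\in[0,1]$ for $r>0$, and otherwise non-line-of-sight ($n$), with $\kappa_n=1-\kappa_l$. A link in state $\xi\in\{l,n\}$ of horizontal length $s$ has path gain $C_\xi(s^2+\Delta_h^2)^{-\eta_\xi/2}$ with $C_\xi,\eta_\xi>0$, and an independent fading gain with the Gamma law of integer shape $m_\xi\ge1$ and mean $1$. Write $\bar l=n$, $\bar n=l$. Interfering links have independent directivity gains: the BS and UAV antenna gains are independent, equal to $G_s^{\max}$ with probability $c_s=\theta_s/2\pi$ and to $G_s^{\min}$ otherwise ($s\in\{g,u\}$, $G_s^{\max},G_s^{\min}>0$, $0\le\theta_s\le2\pi$).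 Hence the link gain takes the values $G_1=G_g^{\max}G_u^{\max}$, $G_2=G_g^{\max}G_u^{\min}$, $G_3=G_g^{\min}G_u^{\max}$, $G_4=G_g^{\min}G_u^{\min}$ with probabilities $p_1=c_gc_u$, $p_2=c_g(1-c_u)$, $p_3=(1-c_g)c_u$, $p_4=(1-c_g)(1-c_u)$. All marks are independent across BSs. The UAV is served by the enabled BS of largest path gain. All other enabled BSs interfere; the transmit power is $P_b>0$ and the noise power $\sigma_b^2>0$. With desired-link gain $g>0$ and threshold $\tau_b>0$, let $S(\tau_b,g)=\mathbb P[\mathrm{SINR}\ge\tau_b]$ and let $S_\xi(\tau_b,g)$ be the conditional probability of the same event given that the serving link is in state $\xi$ (read as $0$ if that event is null). **Notation.** Let $H(m,x)=1-(1+x)^{-m}$, $\gamma_\xi=m_\xi(m_\xi!)^{-1/m_\xi}$, $$E_\xi(x)=\sqrt{\max\Big(0,\big(\tfrac{C_{\bar\xi}}{C_\xi}\big)^{2/\eta_{\bar\xi}}(x^2+\Delta_h^2)^{\eta_\xi/\eta_{\bar\xi}}-\Delta_h^2\Big)},\qquad f_{s_\xi}(x)=2\pi\lambda_bx\kappa_\xi(x)e^{-2\pi\lambda_b\int_0^x\kappa_\xi(r)r\,dr},$$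 $$A_\xi=\int_0^\infty e^{-2\pi\lambda_b\int_0^{E_\xi(x)}\kappa_{\bar\xi}(t)t\,dt}f_{s_\xi}(x)\,dx,\qquad f_{X_\xi}(x)=\frac{f_{s_\xi}(x)}{A_\xi}e^{-2\pi\lambda_b\int_0^{E_\xi(x)}\kappa_{\bar\xi}(t)t\,dt}$$ ($f_{X_\xi}=0$ if $A_\xi=0$). For $a>0$ put $$F_\xi(a)=\sum_{q=1}^{m_\xi}(-1)^{q+1}\binom{m_\xi}{q}\int_0^\infty \exp\Big(-\frac{q\,a\,(x^2+\Delta_h^2)^{\eta_\xi/2}\tau_b\sigma_b^2}{P_bC_\xi g}-Q_\xi(q,x)-V_\xi(q,x)\Big)f_{X_\xi}(x)\,dx,$$ $$Q_\xi(q,x)=2\pi\lambda_b\sum_{k=1}^4p_k\int_x^\infty H\Big(m_\xi,\frac{q\,a\,\frac{G_k}{g}\tau_b(x^2+\Delta_h^2)^{\eta_\xi/2}}{m_\xi(t^2+\Delta_h^2)^{\eta_\xi/2}}\Big)\kappa_\xi(t)\,t\,dt,$$ $$V_\xi(q,x)=2\pi\lambda_b\sum_{k=1}^4p_k\int_{E_\xi(x)}^\infty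 H\Big(m_{\bar\xi},\frac{q\,C_{\bar\xi}\,a\,\frac{G_k}{g}\tau_b(x^2+\Delta_h^2)^{\eta_\xi/2}}{m_{\bar\xi}C_\xi(t^2+\Delta_h^2)^{\eta_{\bar\xi}/2}}\Big)\kappa_{\bar\xi}(t)\,t\,dt,$$ where divergent integrals are $+\infty$ and $e^{-\infty}=0$. **Theorem (Backhaul Probability).** 1. The serving link is in state $\xi$ with probability $A_\xi$, and $S(\tau_b,g)=A_lS_l(\tau_b,g)+A_nS_n(\tau_b,g)$ for every $g>0$. 2. For every $g>0$ and $\xi\in\{l,n\}$, $S_\xi(\tau_b,g)\approx F_\xi(\gamma_\xi)$ in the following sense. Let $T\in[0,\infty]$ be the smallest fading gain of the serving link for which $\mathrm{SINR}\ge\tau_b$, and let $h$ be a unit-mean Gamma variable of shape $m_\xi$. Then $S_\xi(\tau_b,g)$ is the conditional expectation, given that the serving link is in state $\xi$, of the tail $\mathbb P(h\ge t)$ evaluated at $t=T$. The value $F_\xi(\gamma_\xi)$ is exactly the conditional expectation obtained when this tail is replaced by the Alzer expression $1-(1-e^{-\gamma_\xi t})^{m_\xi}$. Moreover $$F_\xi(m_\xi)\le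 S_\xi(\tau_b,g)\le F_\xi(\gamma_\xi),$$ and $S_\xi(\tau_b,g)=F_\xi(\gamma_\xi)$ if $m_\xi=1$. 3. Let $\varepsilon_g,\varepsilon_u$ be real random steering errors, independent of each other and jointly independent of the network. Let the desired-link gain be $G_{b,0}=G_{g,0}G_{u,0}$ with $G_{s,0}=G_s^{\max}$ if $|\varepsilon_s|\le\theta_s/2$ and $G_s^{\min}$ otherwise. With $F_s=\mathbb P(|\varepsilon_s|\le\theta_s/2)$ and $\bar F_s=1-F_s$, the backhaul probability $\mathbb P[\mathrm{SINR}\ge\tau_b]$ with this random gain is $$\mathbb E[S(\tau_b,G_{b,0})]=F_gF_uS(\tau_b,G_g^{\max}G_u^{\max})+F_g\bar F_uS(\tau_b,G_g^{\max}G_u^{\min})+\bar F_gF_uS(\tau_b,G_g^{\min}G_u^{\max})+\bar F_g\bar F_uS(\tau_b,G_g^{\min}G_u^{\min}).$$ -/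

import Mathlib

open MeasureTheory ProbabilityTheory
open scoped ENNReal

noncomputable section

namespace Backhaul

/-! ### Poisson point processes on the plane -/

/-- The plane of horizontal positions; the reference UAV projects to the origin. -/
abbrev Plane : Type := EuclideanSpace ℝ (Fin 2)

/-- Number of points of the enumerated configuration `X` that lie in `B`. -/
def pointCount {Ω E : Type*} (X : ℕ → Ω → E) (B : Set E) (ω : Ω) : ℕ∞ :=
  Set.encard {i : ℕ | X i ω ∈ B}

/-- `X 0, X 1, …` enumerates a Poisson point process with intensity measure `Λ`: counts in sets of
finite intensity are Poisson, counts in disjoint sets are independent. -/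
structure IsPoissonProcess {Ω E : Type*} [MeasurableSpace Ω] [MeasurableSpace E]
    (X : ℕ → Ω → E) (Λ : Measure E) (P : Measure Ω) : Prop where
  measurable : ∀ i, Measurable (X i)
  law : ∀ B : Set E, MeasurableSet B → Λ B < ∞ →
    P.map (pointCount X B) = (poissonMeasure (Λ B).toNNReal).map (fun n : ℕ => (n : ℕ∞))
  indep : ∀ (n : ℕ) (B : Fin n → Set E), (∀ k, MeasurableSet (B k)) → (∀ k, Λ (B k) < ∞) →
    Pairwise (fun j k => Disjoint (B j) (B k)) →
    iIndepFun (fun k => pointCount X (B k)) P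

/-! ### Parameters -/

/-- State of a link: line of sight or non line of sight. -/
inductive LinkType : Type
  | los
  | nlos

/-- The opposite state. -/
def LinkType.other : LinkType → LinkType
  | .los => .nlos
  | .nlos => .los

/-- Numerical parameters of the backhaul network (all in linear scale). -/
structure Params where
  /-- density of ground base stations -/
  lamG : ℝ
  /-- fraction of base stations that are backhaul-enabled -/
  deltaB : ℝ
  /-- height of the UAVs -/
  hU : ℝ
  /-- height of the base stations -/
  hG : ℝ
  /-- parameters of the line-of-sight probability -/
  c : ℝ
  d : ℝ
  e : ℝ
  /-- backhaul transmit power -/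
  Pb : ℝ
  /-- noise power -/
  sigmaSq : ℝ
  /-- main-lobe and side-lobe gains and beamwidths of base stations (`g`) and UAVs (`u`) -/
  GgMax : ℝ
  GgMin : ℝ
  GuMax : ℝ
  GuMin : ℝ
  thG : ℝ
  thU : ℝ
  /-- path-loss intercepts -/
  C : LinkType → ℝ
  /-- path-loss exponents -/
  eta : LinkType → ℝ
  /-- (integer) Nakagami fading parameters -/
  m : LinkType → ℕ

namespace Params

variable (p : Params)

/-- Density of backhaul-enabled base stations. -/
def lamB : ℝ := p.deltaB * p.lamG

/-- Height difference between base stations and UAVs. -/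
def dh : ℝ := |p.hU - p.hG|

/-- Probability that a backhaul link of horizontal length `r` is in the given state. -/
def kappa : LinkType → ℝ → ℝ
  | .los, r => -p.c * Real.exp (-p.d * Real.arctan (p.dh / r)) + p.e
  | .nlos, r => 1 - (-p.c * Real.exp (-p.d * Real.arctan (p.dh / r)) + p.e)

/-- Natural ranges of the parameters. -/
structure Valid : Prop where
  lamG_pos : 0 < p.lamG
  deltaB_pos : 0 < p.deltaB
  deltaB_le_one : p.deltaB ≤ 1
  Pb_pos : 0 < p.Pb
  sigmaSq_pos : 0 < p.sigmaSq
  GgMax_pos : 0 < p.GgMax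
  GgMin_pos : 0 < p.GgMin
  GuMax_pos : 0 < p.GuMax
  GuMin_pos : 0 < p.GuMin
  thG_nonneg : 0 ≤ p.thG
  thG_le : p.thG ≤ 2 * Real.pi
  thU_nonneg : 0 ≤ p.thU
  thU_le : p.thU ≤ 2 * Real.pi
  C_pos : ∀ ξ, 0 < p.C ξ
  eta_pos : ∀ ξ, 0 < p.eta ξ
  m_pos : ∀ ξ, 1 ≤ p.m ξ
  /-- the line-of-sight probability is a probability -/
  kappa_nonneg : ∀ r : ℝ, 0 < r → 0 ≤ p.kappa .los r
  kappa_le_one : ∀ r : ℝ, 0 < r → p.kappa .los r ≤ 1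

/-- Average path gain of a link in state `ξ` of horizontal length `s`. -/
def pathGain (ξ : LinkType) (s : ℝ) : ℝ := p.C ξ * (s ^ 2 + p.dh ^ 2) ^ (-(p.eta ξ) / 2)

/-! ### Analytic expressions -/

/-- Exclusion radius for links of the opposite state; it is `0` if the radicand is negative. -/
def E (ξ : LinkType) (x : ℝ) : ℝ :=
  Real.sqrt ((p.C ξ.other / p.C ξ) ^ (2 / p.eta ξ.other)
    * (x ^ 2 + p.dh ^ 2) ^ (p.eta ξ / p.eta ξ.other) - p.dh ^ 2)

/-- Density of the distance to the nearest backhaul-enabled base station in state `ξ`. -/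
def fNearest (ξ : LinkType) (x : ℝ) : ℝ :=
  2 * Real.pi * p.lamB * x * p.kappa ξ x
    * Real.exp (-(2 * Real.pi * p.lamB * ∫ r in (0 : ℝ)..x, p.kappa ξ r * r))

/-- Probability that no base station in the opposite state is within the exclusion radius. -/
def voidProb (ξ : LinkType) (x : ℝ) : ℝ :=
  Real.exp (-(2 * Real.pi * p.lamB * ∫ t in (0 : ℝ)..(p.E ξ x), p.kappa ξ.other t * t))

/-- Association probability with a base station in state `ξ`, as an integral. -/
def A (ξ : LinkType) : ℝ := ∫ x in Set.Ioi (0 : ℝ), p.voidProb ξ x * p.fNearest ξ x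

/-- Density of the distance to the serving base station, given that its link is in state `ξ`. -/
def fX (ξ : LinkType) (x : ℝ) : ℝ := p.fNearest ξ x / p.A ξ * p.voidProb ξ x

/-- The four possible gains of a link. -/
def G : Fin 4 → ℝ :=
  ![p.GgMax * p.GuMax, p.GgMax * p.GuMin, p.GgMin * p.GuMax, p.GgMin * p.GuMin]

/-- Probability that the beam of a randomly oriented antenna hits the link. -/
def cG : ℝ := p.thG / (2 * Real.pi)

def cU : ℝ := p.thU / (2 * Real.pi)

/-- The probabilities of the four gains of an interfering link. -/
def prob : Fin 4 → ℝ :=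
  ![p.cG * p.cU, p.cG * (1 - p.cU), (1 - p.cG) * p.cU, (1 - p.cG) * (1 - p.cU)]

end Params

/-- `H(m, x) = 1 - 1 / (1 + x) ^ m`. -/
def H (m : ℕ) (x : ℝ) : ℝ := 1 - 1 / (1 + x) ^ m

/-- `exp (-a)` for `a ∈ [0, ∞]`, with `exp (-∞) = 0`. -/
def expNeg (a : ℝ≥0∞) : ℝ := if a = ∞ then 0 else Real.exp (-a.toReal)

/-- The constant `m (m!) ^ (-1/m)`. -/
def alzerRate (m : ℕ) : ℝ := m * (Nat.factorial m : ℝ) ^ (-1 / (m : ℝ))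

namespace Params

variable (p : Params)

/-- Exponent of the interferers in the same state as the serving link. In all the following
expressions `a` is the rate constant, `τ` the threshold and `g` the gain of the desired link. The
value is `∞` if the integral diverges. -/
def Q (ξ : LinkType) (a τ g : ℝ) (q : ℕ) (x : ℝ) : ℝ≥0∞ :=
  ENNReal.ofReal (2 * Real.pi * p.lamB) * ∑ k : Fin 4, ENNReal.ofReal (p.prob k) *
    ∫⁻ t in Set.Ioi x, ENNReal.ofReal
      (H (p.m ξ) (q * a * (p.G k / g) * τ * (x ^ 2 + p.dh ^ 2) ^ (p.eta ξ / 2)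
          / (p.m ξ * (t ^ 2 + p.dh ^ 2) ^ (p.eta ξ / 2))) * p.kappa ξ t * t)

/-- Exponent of the interferers in the opposite state. -/
def V (ξ : LinkType) (a τ g : ℝ) (q : ℕ) (x : ℝ) : ℝ≥0∞ :=
  ENNReal.ofReal (2 * Real.pi * p.lamB) * ∑ k : Fin 4, ENNReal.ofReal (p.prob k) *
    ∫⁻ t in Set.Ioi (p.E ξ x), ENNReal.ofReal
      (H (p.m ξ.other)
        (q * p.C ξ.other * a * (p.G k / g) * τ * (x ^ 2 + p.dh ^ 2) ^ (p.eta ξ / 2)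
          / (p.m ξ.other * p.C ξ * (t ^ 2 + p.dh ^ 2) ^ (p.eta ξ.other / 2)))
        * p.kappa ξ.other t * t)

/-- The alternating binomial sum of integrals. -/
def formula (ξ : LinkType) (a τ g : ℝ) : ℝ :=
  ∑ q ∈ Finset.Icc 1 (p.m ξ), (-1 : ℝ) ^ (q + 1) * (Nat.choose (p.m ξ) q : ℝ) *
    ∫ x in Set.Ioi (0 : ℝ),
      Real.exp (-(q * a * (x ^ 2 + p.dh ^ 2) ^ (p.eta ξ / 2) * τ * p.sigmaSq
          / (p.Pb * p.C ξ * g)))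
        * expNeg (p.Q ξ a τ g q x + p.V ξ a τ g q x) * p.fX ξ x

/-! ### The random network -/

/-- Law of a two-valued gain: `gMax` with probability `c`, `gMin` with probability `1 - c`. -/
def gainLaw (c gMax gMin : ℝ) : Measure ℝ :=
  ENNReal.ofReal c • Measure.dirac gMax + ENNReal.ofReal (1 - c) • Measure.dirac gMin

/-- Law of the indicator of being backhaul-enabled. -/
def enabledLaw : Measure Bool :=
  ENNReal.ofReal p.deltaB • Measure.dirac true + ENNReal.ofReal (1 - p.deltaB) • Measure.dirac false

/-- Joint law of the marks of a base station: backhaul indicator, uniform variable deciding the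
link state, line-of-sight and non-line-of-sight fading, gains of the two antennas. -/
def markLaw : Measure (Bool × ℝ × ℝ × ℝ × ℝ × ℝ) :=
  p.enabledLaw.prod ((volume.restrict (Set.Icc (0 : ℝ) 1)).prod
    ((gammaMeasure (p.m .los) (p.m .los)).prod
      ((gammaMeasure (p.m .nlos) (p.m .nlos)).prod
        ((gainLaw p.cG p.GgMax p.GgMin).prod (gainLaw p.cU p.GuMax p.GuMin)))))

end Params

/-- Ground base stations, as a homogeneous Poisson process of density `lamG` with independent and
identically distributed marks. -/
structure Network (p : Params) {Ω : Type*} [MeasurableSpace Ω] (P : Measure Ω) where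
  /-- horizontal positions -/
  X : ℕ → Ω → Plane
  /-- is the base station backhaul-enabled? -/
  enabled : ℕ → Ω → Bool
  /-- uniform variable deciding the link state -/
  U : ℕ → Ω → ℝ
  /-- small-scale fading gains -/
  fading : LinkType → ℕ → Ω → ℝ
  /-- gains of the base station and UAV antennas if the link is an interfering one -/
  gainG : ℕ → Ω → ℝ
  gainU : ℕ → Ω → ℝ
  poisson : IsPoissonProcess X (ENNReal.ofReal p.lamG • volume) P
  measurable_mark : ∀ i, Measurable fun ω =>
    (enabled i ω, U i ω, fading .los i ω, fading .nlos i ω, gainG i ω, gainU i ω)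
  mark_law : ∀ i, P.map (fun ω =>
    (enabled i ω, U i ω, fading .los i ω, fading .nlos i ω, gainG i ω, gainU i ω)) = p.markLaw
  mark_indep : iIndepFun (fun i ω =>
    (enabled i ω, U i ω, fading .los i ω, fading .nlos i ω, gainG i ω, gainU i ω)) P
  indep : IndepFun (fun ω i => X i ω) (fun ω i =>
    (enabled i ω, U i ω, fading .los i ω, fading .nlos i ω, gainG i ω, gainU i ω)) P

namespace Network

variable {p : Params} {Ω : Type*} [MeasurableSpace Ω] {P : Measure Ω} (N : Network p P)

/-- All positions and marks. -/
def data (ω : Ω) : (ℕ → Plane) × (ℕ → Bool × ℝ × ℝ × ℝ × ℝ × ℝ) :=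
  (fun i => N.X i ω, fun i =>
    (N.enabled i ω, N.U i ω, N.fading .los i ω, N.fading .nlos i ω, N.gainG i ω, N.gainU i ω))

/-- Horizontal distance from the reference UAV. -/
def dist (i : ℕ) (ω : Ω) : ℝ := ‖N.X i ω‖

open Classical in
/-- State of the link to base station `i`: given the positions, it is line of sight with
probability `kappa .los (dist i)`. -/
def state (i : ℕ) (ω : Ω) : LinkType :=
  if N.U i ω ≤ p.kappa .los (N.dist i ω) then .los else .nlos

/-- Average path gain of the link to base station `i`. -/
def gain (i : ℕ) (ω : Ω) : ℝ := p.pathGain (N.state i ω) (N.dist i ω)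

/-- Base station `i` is backhaul-enabled and has minimal path loss. -/
def IsServing (i : ℕ) (ω : Ω) : Prop :=
  N.enabled i ω = true ∧ ∀ j, N.enabled j ω = true → N.gain j ω ≤ N.gain i ω

/-- Index of the serving base station (almost surely it exists and is unique). -/
def serving (ω : Ω) : ℕ := sInf {i | N.IsServing i ω}

/-- The event that the serving link is in state `ξ`. -/
def assoc (ξ : LinkType) : Set Ω := {ω | N.state (N.serving ω) ω = ξ}

open Classical in
/-- Interference from all backhaul-enabled base stations other than the serving one. -/
def interference (ω : Ω) : ℝ≥0∞ :=
  ∑' j : ℕ, if N.enabled j ω = true ∧ j ≠ N.serving ω then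
    ENNReal.ofReal (p.Pb * (N.gainG j ω * N.gainU j ω) * N.gain j ω
      * N.fading (N.state j ω) j ω) else 0

/-- Small-scale fading gain of the serving link. -/
def servingFading (ω : Ω) : ℝ := N.fading (N.state (N.serving ω) ω) (N.serving ω) ω

/-- Signal-to-interference-and-noise ratio if the desired link has directivity gain `g`. -/
def sinr (g : ℝ) (ω : Ω) : ℝ≥0∞ :=
  ENNReal.ofReal (p.Pb * g * N.gain (N.serving ω) ω * N.servingFading ω)
    / (ENNReal.ofReal p.sigmaSq + N.interference ω)

/-- The smallest serving fading gain for which the ratio reaches the threshold `τ`. -/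
def fadingThreshold (τ g : ℝ) (ω : Ω) : ℝ≥0∞ :=
  ENNReal.ofReal τ * (ENNReal.ofReal p.sigmaSq + N.interference ω)
    / ENNReal.ofReal (p.Pb * g * N.gain (N.serving ω) ω)

/-- Backhaul probability `S(τ, g)` for desired gain `g`. -/
def S (τ g : ℝ) : ℝ := P.real {ω | ENNReal.ofReal τ ≤ N.sinr g ω}

/-- Conditional backhaul probability given that the serving link is in state `ξ`. -/
def condS (ξ : LinkType) (τ g : ℝ) : ℝ :=
  (cond P (N.assoc ξ)).real {ω | ENNReal.ofReal τ ≤ N.sinr g ω}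

end Network

/-- Tail `P(h ≥ t)` of the unit-mean gamma variable `h` with shape `m`. -/
def gammaTail (m : ℕ) (t : ℝ≥0∞) : ℝ := (gammaMeasure m m).real {h | t ≤ ENNReal.ofReal h}

/-- The expression `1 - (1 - exp (-a t)) ^ m` that replaces the gamma tail. -/
def alzerTail (m : ℕ) (a : ℝ) (t : ℝ≥0∞) : ℝ := 1 - (1 - expNeg (ENNReal.ofReal a * t)) ^ m

open Classical in
/-- Gain of an antenna of beamwidth `θ` with steering error `ε`. -/
def steeredGain (gMax gMin θ ε : ℝ) : ℝ := if |ε| ≤ θ / 2 then gMax else gMin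

/-- Directivity gain of the desired link under steering errors. -/
def desiredGain (p : Params) (εg εu : ℝ) : ℝ :=
  steeredGain p.GgMax p.GgMin p.thG εg * steeredGain p.GuMax p.GuMin p.thU εu

end Backhaul

end

/-!
The proof treats the base stations as one marked Poisson process, with intensity measure
`Params.intensity` on positions and marks, and uses it only through its Laplace functional
`E exp (-∑ f (Y j)) = exp (-∫ (1 - exp (-f)))`, valid for measurable `f` with values in `[0, ∞]`
(`IsPoissonProcess.hasPoissonLaplace`, `HasPoissonLaplace.marked`). The value `f = ∞` on a set
encodes the event that the set contains no point.

*Association and Laplace transform of the threshold.* Let `T` be the fading threshold and `a ≥ 0`.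
If the serving point has path gain `u`, then `a * T` is a noise term plus a sum over the other
points, and `Params.conditionalLaplace` is the mean of `exp` of minus this quantity, with the
additional weight `∞` on the points that would be better servers. It increases with `u`. For a thin cell `(v, u]` of path
gains, the mean of `exp (-a T)` on the event that the serving point is in the cell and in state `ξ`
is the intensity of that part of the cell times a number between the values of
`conditionalLaplace` at `v` and `u`, up to the square of the intensity of the cell
(`Network.integral_servedCell_le`, `Network.le_integral_servedCell`); the error comes from two
points in one cell. Summing over fine partitions, the errors vanish because the total variation
of a monotone function telescopes (`sub_eq_sub_of_increment_bound`). This gives the mean of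
`exp (-a T)` on the event of association as an integral over the serving distance
(`Network.lintegral_assoc`). Polar coordinates and the Laplace transform of the gamma law turn the
exponent into the void exponents plus the interference exponents `Q` and `V`
(`Params.Valid.conditionalLaplace_mul`). The case `a = 0` is the association probability.

*Fading of the serving link.* Whether a base station serves, and the threshold it then has to reach,
do not depend on its own fading gain. Integrating out this gain for each possible serving index
expresses the conditional backhaul probability as the conditional mean of the gamma tail at `T`
(`Network.measure_threshold_le_fading`).

*Alzer's inequalities.* The gamma tail lies between the expressions `1 - (1 - exp (-a t)) ^ m` with
`a = m` and `a = alzerRate m`, by a sign analysis of the derivative of the difference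
(`alzerTail_le_gammaTail`, `gammaTail_le_alzerTail`). Binomial expansion writes the conditional mean
of such an expression as an alternating sum of Laplace transforms of `T` at `q * a`
(`Network.integral_alzerTail`). Both rates equal `1` for `m = 1`.

*Steering errors.* The desired gain takes four values on events that are independent of the network
(`Network.measureReal_steered`, `integral_desiredGain`).
-/

noncomputable section

namespace Backhaul

open Set Filter Topology

/-! ### The exponential of a negative extended number -/

lemma expNeg_top : expNeg ∞ = 0 := by simp [expNeg]

lemma expNeg_zero : expNeg 0 = 1 := by simp [expNeg]

lemma expNeg_of_ne_top {a : ℝ≥0∞} (h : a ≠ ∞) : expNeg a = Real.exp (-a.toReal) := if_neg h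

lemma expNeg_ofReal {a : ℝ} (h : 0 ≤ a) : expNeg (ENNReal.ofReal a) = Real.exp (-a) := by
  rw [expNeg_of_ne_top ENNReal.ofReal_ne_top, ENNReal.toReal_ofReal h]

lemma expNeg_nonneg (a : ℝ≥0∞) : 0 ≤ expNeg a := by
  unfold expNeg; split_ifs <;> positivity

lemma expNeg_eq_toReal_exp (a : ℝ≥0∞) : expNeg a = (EReal.exp (-(a : EReal))).toReal := by
  induction a with
  | top => simp [expNeg_top]
  | coe a =>
    have : (-(((a : ℝ≥0∞)) : EReal)) = ((-(a : ℝ) : ℝ) : EReal) := by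
      push_cast; rfl
    rw [this, EReal.exp_coe, expNeg_of_ne_top (by simp)]
    simp [ENNReal.toReal_ofReal (Real.exp_nonneg _)]

lemma continuous_expNeg : Continuous expNeg := by
  have h : expNeg = fun a : ℝ≥0∞ => (EReal.exp (-(a : EReal))).toReal :=
    funext expNeg_eq_toReal_exp
  rw [h, continuous_iff_continuousAt]
  intro a
  refine (ENNReal.tendsto_toReal ?_).comp
    ((ENNReal.continuous_exp.comp (continuous_neg.comp continuous_coe_ennreal_ereal)).tendsto a)
  simp

@[fun_prop]
lemma measurable_expNeg : Measurable expNeg := continuous_expNeg.measurable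

lemma antitone_expNeg : Antitone expNeg := by
  intro a b h
  by_cases hb : b = ∞
  · rw [hb, expNeg_top]; exact expNeg_nonneg a
  · have ha : a ≠ ∞ := ne_top_of_le_ne_top hb h
    rw [expNeg_of_ne_top ha, expNeg_of_ne_top hb]
    gcongr

lemma expNeg_le_one (a : ℝ≥0∞) : expNeg a ≤ 1 := by
  simpa [expNeg_zero] using antitone_expNeg (zero_le (a := a))

lemma expNeg_add (a b : ℝ≥0∞) : expNeg (a + b) = expNeg a * expNeg b := by
  by_cases ha : a = ∞
  · simp [ha, expNeg_top]
  by_cases hb : b = ∞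
  · simp [hb, expNeg_top]
  rw [expNeg_of_ne_top ha, expNeg_of_ne_top hb, expNeg_of_ne_top (by simp [ha, hb]),
    ENNReal.toReal_add ha hb, ← Real.exp_add]
  ring_nf

lemma expNeg_sum {ι : Type*} (s : Finset ι) (f : ι → ℝ≥0∞) :
    expNeg (∑ i ∈ s, f i) = ∏ i ∈ s, expNeg (f i) := by
  induction s using Finset.cons_induction with
  | empty => simp [expNeg_zero]
  | cons i s hi ih => rw [Finset.sum_cons, Finset.prod_cons, expNeg_add, ih]

lemma expNeg_nat_mul (n : ℕ) (a : ℝ≥0∞) : expNeg (n * a) = expNeg a ^ n := by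
  have := expNeg_sum (Finset.range n) (fun _ => a)
  simpa using this

/-- Complement `1 - exp (-a)` of the exponential, as an extended nonnegative number: the
integrand of the exponent of a Poisson Laplace functional. -/
def oneSubExpNeg (a : ℝ≥0∞) : ℝ≥0∞ := ENNReal.ofReal (1 - expNeg a)

lemma oneSubExpNeg_zero : oneSubExpNeg 0 = 0 := by simp [oneSubExpNeg, expNeg_zero]

lemma oneSubExpNeg_top : oneSubExpNeg ∞ = 1 := by simp [oneSubExpNeg, expNeg_top]

lemma oneSubExpNeg_le_one (a : ℝ≥0∞) : oneSubExpNeg a ≤ 1 := by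
  rw [oneSubExpNeg, ENNReal.ofReal_le_one]
  linarith [expNeg_nonneg a]

lemma continuous_oneSubExpNeg : Continuous oneSubExpNeg :=
  ENNReal.continuous_ofReal.comp (continuous_const.sub continuous_expNeg)

@[fun_prop]
lemma measurable_oneSubExpNeg : Measurable oneSubExpNeg := continuous_oneSubExpNeg.measurable

lemma monotone_oneSubExpNeg : Monotone oneSubExpNeg := fun _ _ h =>
  ENNReal.ofReal_le_ofReal (sub_le_sub_left (antitone_expNeg h) 1)

/-- The number `a` with `exp (-a) = x`, for `x ∈ [0, 1]`. -/
def negLog (x : ℝ) : ℝ≥0∞ := if x = 0 then ∞ else ENNReal.ofReal (-Real.log x)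

@[fun_prop]
lemma measurable_negLog : Measurable negLog := by
  unfold negLog
  exact Measurable.ite (measurableSet_singleton 0) measurable_const (by fun_prop)

lemma expNeg_negLog {x : ℝ} (h0 : 0 ≤ x) (h1 : x ≤ 1) : expNeg (negLog x) = x := by
  unfold negLog
  split_ifs with h
  · rw [expNeg_top, h]
  · rw [expNeg_ofReal (by linarith [Real.log_nonpos h0 h1]), neg_neg,
      Real.exp_log (lt_of_le_of_ne h0 (Ne.symm h))]

lemma expNeg_sub_le (a b : ℝ≥0∞) (r : ℝ) (hb : b ≤ ENNReal.ofReal r) (hr : 0 ≤ r) :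
    expNeg a ≤ expNeg (a + b) + r := by
  have hb' : b ≠ ∞ := ne_top_of_le_ne_top ENNReal.ofReal_ne_top hb
  have hbr : b.toReal ≤ r := ENNReal.toReal_le_of_le_ofReal hr hb
  rw [expNeg_add, expNeg_of_ne_top hb']
  have h1 := Real.add_one_le_exp (-b.toReal)
  have h2 := expNeg_le_one a
  have h3 := expNeg_nonneg a
  have h4 : 0 ≤ b.toReal := ENNReal.toReal_nonneg
  nlinarith

/-! ### Laplace functional of a Poisson process -/

/-- The random points `Y 0, Y 1, …` have the Laplace functional of a Poisson process with intensity
measure `Λ`: the mean of `exp (-∑ f (Y j))` is `exp (-∫ (1 - exp (-f)) dΛ)`, also for functions `f`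
that take the value `∞`. -/
def HasPoissonLaplace {Ω E : Type*} [MeasurableSpace Ω] [MeasurableSpace E]
    (Y : ℕ → Ω → E) (Λ : Measure E) (P : Measure Ω) : Prop :=
  ∀ f : E → ℝ≥0∞, Measurable f →
    ∫ ω, expNeg (∑' j, f (Y j ω)) ∂P = expNeg (∫⁻ x, oneSubExpNeg (f x) ∂Λ)

lemma measurable_tsum_ennreal {Ω : Type*} [MeasurableSpace Ω] {f : ℕ → Ω → ℝ≥0∞}
    (hf : ∀ j, Measurable (f j)) : Measurable fun ω => ∑' j, f j ω := Measurable.tsum hf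

lemma tsum_indicator_eq_pointCount {Ω E : Type*} (X : ℕ → Ω → E) (B : Set E) (c : ℝ≥0∞) (ω : Ω) :
    ∑' j, B.indicator (fun _ => c) (X j ω) = c * (pointCount X B ω : ℝ≥0∞) := by
  have : ∀ j, B.indicator (fun _ => c) (X j ω)
      = {i : ℕ | X i ω ∈ B}.indicator (fun _ => c) j := by
    intro j
    simp [Set.indicator]
  simp_rw [this]
  rw [← tsum_subtype {i : ℕ | X i ω ∈ B} (fun _ => c), ENNReal.tsum_set_const, mul_comm]
  rfl

lemma tendsto_tsum_of_monotone {f : ℕ → ℕ → ℝ≥0∞} (hf : Monotone f) :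
    Tendsto (fun n => ∑' j, f n j) atTop (𝓝 (∑' j, ⨆ n, f n j)) := by
  simp_rw [← lintegral_count]
  rw [lintegral_iSup (fun n => measurable_of_countable _) hf]
  exact tendsto_atTop_iSup fun a b hab => lintegral_mono (hf hab)

section Laplace

variable {Ω E : Type*} [MeasurableSpace Ω] [MeasurableSpace E] {P : Measure Ω}

lemma integrable_of_mem_unit [IsFiniteMeasure P] {f : Ω → ℝ} (hf : Measurable f)
    (h0 : ∀ ω, 0 ≤ f ω) (h1 : ∀ ω, f ω ≤ 1) : Integrable f P :=
  Integrable.of_bound hf.aestronglyMeasurable 1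
    (Eventually.of_forall fun ω => by rw [Real.norm_of_nonneg (h0 ω)]; exact h1 ω)

lemma integrable_expNeg [IsFiniteMeasure P] {f : Ω → ℝ≥0∞} (hf : Measurable f) :
    Integrable (fun ω => expNeg (f ω)) P :=
  integrable_of_mem_unit (by fun_prop) (fun _ => expNeg_nonneg _) (fun _ => expNeg_le_one _)

lemma integral_expNeg_poisson (r : NNReal) (c : ℝ≥0∞) :
    ∫ n : ℕ, expNeg (c * n) ∂(poissonMeasure r) = expNeg (oneSubExpNeg c * r) := by
  have h1 : ∀ n : ℕ, (Real.exp (-r) * (r : ℝ) ^ n / (n.factorial : ℝ)) • expNeg (c * n)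
      = Real.exp (-r) * ((r * expNeg c) ^ n / (n.factorial : ℝ)) := by
    intro n
    rw [mul_comm c, expNeg_nat_mul, smul_eq_mul, mul_pow]
    ring
  rw [integral_poissonMeasure]
  simp_rw [h1]
  rw [tsum_mul_left, (NormedSpace.expSeries_div_hasSum_exp ((r : ℝ) * expNeg c)).tsum_eq,
    ← Real.exp_eq_exp_ℝ, ← Real.exp_add]
  have h2 : oneSubExpNeg c * r = ENNReal.ofReal ((1 - expNeg c) * r) := by
    rw [oneSubExpNeg, ENNReal.ofReal_mul (by linarith [expNeg_le_one c]),
      ENNReal.ofReal_coe_nnreal]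
  have h3 : 0 ≤ (1 - expNeg c) * (r : ℝ) := mul_nonneg (by linarith [expNeg_le_one c]) r.2
  rw [h2, expNeg_ofReal h3]
  congr 1
  ring

lemma IsPoissonProcess.measurable_pointCount {X : ℕ → Ω → E} {Λ : Measure E}
    (h : IsPoissonProcess X Λ P) {B : Set E} (hB : MeasurableSet B) :
    Measurable (pointCount X B) := by
  have h1 : Measurable fun ω => (pointCount X B ω : ℝ≥0∞) := by
    have := measurable_tsum_ennreal (f := fun j ω => B.indicator (fun _ => (1 : ℝ≥0∞)) (X j ω))
      (fun j => (measurable_const.indicator hB).comp (h.measurable j))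
    simpa [tsum_indicator_eq_pointCount] using this
  refine measurable_to_countable' fun n => ?_
  have h2 : pointCount X B ⁻¹' {n} = (fun ω => (pointCount X B ω : ℝ≥0∞)) ⁻¹' {(n : ℝ≥0∞)} := by
    ext ω; simp
  rw [h2]
  exact h1 (measurableSet_singleton _)

lemma IsPoissonProcess.integral_expNeg_pointCount {X : ℕ → Ω → E} {Λ : Measure E}
    (h : IsPoissonProcess X Λ P) {B : Set E} (hB : MeasurableSet B) (hΛ : Λ B < ∞) (c : ℝ≥0∞) :
    ∫ ω, expNeg (c * (pointCount X B ω : ℝ≥0∞)) ∂P = expNeg (oneSubExpNeg c * Λ B) := by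
  have h1 : Measurable fun n : ℕ∞ => expNeg (c * (n : ℝ≥0∞)) := measurable_of_countable _
  rw [← integral_map (φ := pointCount X B) (f := fun n : ℕ∞ => expNeg (c * (n : ℝ≥0∞)))
    (h.measurable_pointCount hB).aemeasurable h1.aestronglyMeasurable, h.law B hB hΛ,
    integral_map (measurable_of_countable _).aemeasurable h1.aestronglyMeasurable]
  simp only [ENat.toENNReal_coe]
  rw [integral_expNeg_poisson, ENNReal.coe_toNNReal hΛ.ne]

/-- The Laplace functional at a simple function, from the independence of the counts in the level
sets of the function. -/
lemma IsPoissonProcess.laplace_simpleFunc [IsProbabilityMeasure P] {X : ℕ → Ω → E} {Λ : Measure E}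
    (h : IsPoissonProcess X Λ P) (F : SimpleFunc E ℝ≥0∞) (hF : ∀ c ≠ 0, Λ (F ⁻¹' {c}) < ∞) :
    ∫ ω, expNeg (∑' j, F (X j ω)) ∂P = expNeg (∫⁻ x, oneSubExpNeg (F x) ∂Λ) := by
  classical
  set s : Finset ℝ≥0∞ := F.range.filter (· ≠ 0) with hs
  have hs0 : ∀ c ∈ s, c ≠ 0 := fun c hc => (Finset.mem_filter.1 hc).2
  have hdec : ∀ (φ : ℝ≥0∞ → ℝ≥0∞), φ 0 = 0 → ∀ x,
      φ (F x) = ∑ c ∈ s, (F ⁻¹' {c}).indicator (fun _ => φ c) x := by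
    intro φ hφ x
    by_cases hx : F x = 0
    · rw [hx, hφ, Finset.sum_eq_zero]
      intro c hc
      rw [indicator_of_notMem]
      simpa [hx] using (hs0 c hc).symm
    · rw [Finset.sum_eq_single (F x)]
      · rw [indicator_of_mem]; simp
      · intro c _ hc
        rw [indicator_of_notMem]
        simpa using hc.symm
      · intro hn
        exact absurd (Finset.mem_filter.2 ⟨F.mem_range_self x, hx⟩) hn
  have hsum : ∀ ω, ∑' j, F (X j ω) = ∑ c ∈ s, c * (pointCount X (F ⁻¹' {c}) ω : ℝ≥0∞) := by
    intro ω
    simp_rw [← tsum_indicator_eq_pointCount]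
    rw [← Summable.tsum_finsetSum (fun _ _ => ENNReal.summable)]
    exact tsum_congr fun j => hdec id rfl (X j ω)
  have hint : ∫⁻ x, oneSubExpNeg (F x) ∂Λ = ∑ c ∈ s, oneSubExpNeg c * Λ (F ⁻¹' {c}) := by
    simp_rw [hdec oneSubExpNeg oneSubExpNeg_zero]
    rw [lintegral_finsetSum _
      (fun c _ => measurable_const.indicator (F.measurableSet_preimage {c}))]
    refine Finset.sum_congr rfl fun c _ => ?_
    rw [lintegral_indicator_const (F.measurableSet_preimage {c})]
  have hind : iIndepFun (fun (c : s) => pointCount X (F ⁻¹' {(c : ℝ≥0∞)})) P := by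
    have h1 := h.indep s.card (fun k => F ⁻¹' {((s.equivFin.symm k : s) : ℝ≥0∞)})
      (fun k => F.measurableSet_preimage _) (fun k => hF _ (hs0 _ (s.equivFin.symm k).2)) ?_
    · have h2 := h1.precomp (g := s.equivFin) s.equivFin.injective
      simpa using h2
    · intro j k hjk
      refine Disjoint.preimage _ ?_
      rw [disjoint_singleton]
      intro heq
      exact hjk (s.equivFin.symm.injective (Subtype.ext heq))
  simp_rw [hsum, hint, expNeg_sum]
  have h3 : ∀ ω, ∏ c ∈ s, expNeg (c * (pointCount X (F ⁻¹' {c}) ω : ℝ≥0∞))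
      = ∏ c : s, expNeg (c * (pointCount X (F ⁻¹' {(c : ℝ≥0∞)}) ω : ℝ≥0∞)) := by
    intro ω
    rw [← Finset.prod_coe_sort s (fun c => expNeg (c * (pointCount X (F ⁻¹' {c}) ω : ℝ≥0∞)))]
  simp_rw [h3]
  rw [hind.integral_fun_prod_comp
    (f := fun (c : s) (n : ℕ∞) => expNeg ((c : ℝ≥0∞) * (n : ℝ≥0∞)))
    (fun c => (h.measurable_pointCount (F.measurableSet_preimage _)).aemeasurable)
    (fun c => (measurable_of_countable _).aestronglyMeasurable)]
  rw [← Finset.prod_coe_sort s]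
  refine Finset.prod_congr rfl fun c _ => ?_
  exact h.integral_expNeg_pointCount (F.measurableSet_preimage _) (hF _ (hs0 _ c.2)) _

/-- Laplace functional of a Poisson process with σ-finite intensity: simple functions and monotone
limits. -/
theorem IsPoissonProcess.hasPoissonLaplace [IsProbabilityMeasure P] {X : ℕ → Ω → E} {Λ : Measure E}
    [SigmaFinite Λ] (h : IsPoissonProcess X Λ P) : HasPoissonLaplace X Λ P := by
  intro f hf
  let F : ℕ → SimpleFunc E ℝ≥0∞ := fun n => (SimpleFunc.eapprox f n).restrict (spanningSets Λ n)
  have hFapp : ∀ n x, F n x = (spanningSets Λ n).indicator (SimpleFunc.eapprox f n) x :=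
    fun n x => by rw [SimpleFunc.restrict_apply _ (measurableSet_spanningSets Λ n)]
  have hmono : ∀ x, Monotone fun n => F n x := by
    intro x a b hab
    simp only [hFapp]
    refine (indicator_le_indicator_of_subset (monotone_spanningSets Λ hab)
      (fun _ => zero_le) x).trans ?_
    exact indicator_le_indicator (SimpleFunc.monotone_eapprox f hab x)
  have hsup : ∀ x, ⨆ n, F n x = f x := by
    intro x
    refine le_antisymm (iSup_le fun n => ?_) ?_
    · rw [hFapp]
      refine (indicator_le_self' (fun _ _ => zero_le) x).trans ?_
      rw [← SimpleFunc.iSup_eapprox_apply hf x]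
      exact le_iSup (fun n => SimpleFunc.eapprox f n x) n
    · rw [← SimpleFunc.iSup_eapprox_apply hf x]
      refine iSup_le fun n => ?_
      obtain ⟨m, hm⟩ := mem_iUnion.1 ((iUnion_spanningSets Λ).symm ▸ mem_univ x)
      refine le_trans ?_ (le_iSup _ (max n m))
      rw [hFapp, indicator_of_mem (monotone_spanningSets Λ (le_max_right n m) hm)]
      exact SimpleFunc.monotone_eapprox f (le_max_left n m) x
  have hfin : ∀ n, ∀ c ≠ 0, Λ (F n ⁻¹' {c}) < ∞ := by
    intro n c hc
    refine lt_of_le_of_lt (measure_mono ?_) (measure_spanningSets_lt_top Λ n)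
    intro x hx
    by_contra hxn
    rw [mem_preimage, hFapp, indicator_of_notMem hxn] at hx
    exact hc hx.symm
  have hlim1 : Tendsto (fun n => ∫ ω, expNeg (∑' j, F n (X j ω)) ∂P) atTop
      (𝓝 (∫ ω, expNeg (∑' j, f (X j ω)) ∂P)) := by
    refine tendsto_integral_of_dominated_convergence (fun _ => 1) (fun n => ?_)
      (integrable_const _) (fun n => Eventually.of_forall fun ω => ?_)
      (Eventually.of_forall fun ω => ?_)
    · exact (measurable_expNeg.comp (measurable_tsum_ennreal
        fun j => (F n).measurable.comp (h.measurable j))).aestronglyMeasurable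
    · rw [Real.norm_of_nonneg (expNeg_nonneg _)]; exact expNeg_le_one _
    · refine (continuous_expNeg.tendsto _).comp ?_
      have := tendsto_tsum_of_monotone (f := fun n j => F n (X j ω))
        (fun a b hab j => hmono (X j ω) hab)
      simpa only [hsup] using this
  have hlim2 : Tendsto (fun n => expNeg (∫⁻ x, oneSubExpNeg (F n x) ∂Λ)) atTop
      (𝓝 (expNeg (∫⁻ x, oneSubExpNeg (f x) ∂Λ))) := by
    refine (continuous_expNeg.tendsto _).comp ?_
    refine lintegral_tendsto_of_tendsto_of_monotone
      (fun n => (measurable_oneSubExpNeg.comp (F n).measurable).aemeasurable)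
      (Eventually.of_forall fun x a b hab => monotone_oneSubExpNeg (hmono x hab))
      (Eventually.of_forall fun x => ?_)
    refine (continuous_oneSubExpNeg.tendsto _).comp ?_
    have := tendsto_atTop_iSup (hmono x)
    rwa [hsup] at this
  refine tendsto_nhds_unique hlim1 ?_
  simp_rw [fun n => h.laplace_simpleFunc (F n) (hfin n)]
  exact hlim2

/-- Independent marking: attaching to the points independent marks with law `ν` gives the Laplace
functional of a Poisson process with intensity `Λ ⊗ ν`. Given the points, the marks contribute the
product of the factors `∫ exp (-f (x, ·)) dν`, each of which is again of the form `exp (-F x)`. -/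
theorem HasPoissonLaplace.marked {K : Type*} [MeasurableSpace K] [IsProbabilityMeasure P]
    {X : ℕ → Ω → E} {M : ℕ → Ω → K} {Λ : Measure E} {ν : Measure K} [IsProbabilityMeasure ν]
    (h : HasPoissonLaplace X Λ P) (hX : ∀ j, Measurable (X j)) (hM : ∀ j, Measurable (M j))
    (hν : ∀ j, P.map (M j) = ν) (hMi : iIndepFun M P)
    (hXM : IndepFun (fun ω j => X j ω) (fun ω j => M j ω) P) :
    HasPoissonLaplace (fun j ω => (X j ω, M j ω)) (Λ.prod ν) P := by
  intro f hf
  set G : E → ℝ := fun x => ∫ k, expNeg (f (x, k)) ∂ν with hG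
  have hGm : Measurable G := by
    have : StronglyMeasurable fun z : E × K => expNeg (f z) :=
      (measurable_expNeg.comp hf).stronglyMeasurable
    exact (this.integral_prod_right (ν := ν)).measurable
  have hG0 : ∀ x, 0 ≤ G x := fun x => integral_nonneg fun k => expNeg_nonneg _
  have hfx : ∀ x, Measurable fun k => f (x, k) := fun x => by fun_prop
  have hG1 : ∀ x, G x ≤ 1 := by
    intro x
    have := integral_mono (integrable_expNeg (P := ν) (hfx x)) (integrable_const 1)
      (fun k => expNeg_le_one _)
    simpa using this
  have hfinite : ∀ (x : ℕ → E) (n : ℕ),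
      ∫ ω, expNeg (∑ j ∈ Finset.range n, f (x j, M j ω)) ∂P
        = expNeg (∑ j ∈ Finset.range n, negLog (G (x j))) := by
    intro x n
    simp_rw [expNeg_sum]
    have h0 : iIndepFun (fun j : Finset.range n => M j) P := hMi.precomp Subtype.val_injective
    have h1 := h0.integral_fun_prod_comp
      (f := fun (j : Finset.range n) k => expNeg (f (x j, k)))
      (fun j => (hM j).aemeasurable)
      (fun j => (measurable_expNeg.comp (hfx _)).aestronglyMeasurable)
    have h2 : ∀ ω, ∏ j ∈ Finset.range n, expNeg (f (x j, M j ω))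
        = ∏ j : Finset.range n, expNeg (f (x j, M j ω)) := fun ω => by
      rw [← Finset.prod_coe_sort (Finset.range n) (fun j => expNeg (f (x j, M j ω)))]
    simp_rw [h2]
    rw [h1, ← Finset.prod_coe_sort (Finset.range n)]
    refine Finset.prod_congr rfl fun j _ => ?_
    rw [expNeg_negLog (hG0 _) (hG1 _), hG]
    simp only
    have h3 : Measurable fun k => expNeg (f (x j, k)) := measurable_expNeg.comp (hfx _)
    rw [← hν j, integral_map (hM j).aemeasurable h3.aestronglyMeasurable]
  have hpart : ∀ (a : ℕ → ℝ≥0∞),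
      Tendsto (fun n => expNeg (∑ j ∈ Finset.range n, a j)) atTop (𝓝 (expNeg (∑' j, a j))) :=
    fun a => (continuous_expNeg.tendsto _).comp ENNReal.summable.hasSum.tendsto_sum_nat
  have hinf : ∀ x : ℕ → E, ∫ ω, expNeg (∑' j, f (x j, M j ω)) ∂P
      = expNeg (∑' j, negLog (G (x j))) := by
    intro x
    have hl : Tendsto (fun n => ∫ ω, expNeg (∑ j ∈ Finset.range n, f (x j, M j ω)) ∂P) atTop
        (𝓝 (∫ ω, expNeg (∑' j, f (x j, M j ω)) ∂P)) := by
      refine tendsto_integral_of_dominated_convergence (fun _ => 1) (fun n => ?_)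
        (integrable_const _) (fun n => Eventually.of_forall fun ω => ?_)
        (Eventually.of_forall fun ω => hpart _)
      · exact (measurable_expNeg.comp (Finset.measurable_sum _
          fun j _ => (hfx _).comp (hM j))).aestronglyMeasurable
      · rw [Real.norm_of_nonneg (expNeg_nonneg _)]; exact expNeg_le_one _
    simp_rw [hfinite x] at hl
    exact tendsto_nhds_unique hl (hpart _)
  have hXm : Measurable fun ω j => X j ω := measurable_pi_lambda _ hX
  have hMm : Measurable fun ω j => M j ω := measurable_pi_lambda _ hM
  let Z : (ℕ → E) × (ℕ → K) → ℝ := fun z => expNeg (∑' j, f (z.1 j, z.2 j))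
  have hZm : Measurable Z := measurable_expNeg.comp (measurable_tsum_ennreal fun j =>
    hf.comp (by fun_prop))
  have hprod := hXM.map_prod_eq_prod_map_map hXm.aemeasurable hMm.aemeasurable
  have : IsProbabilityMeasure (P.map fun ω j => X j ω) :=
    Measure.isProbabilityMeasure_map hXm.aemeasurable
  have : IsProbabilityMeasure (P.map fun ω j => M j ω) :=
    Measure.isProbabilityMeasure_map hMm.aemeasurable
  calc ∫ ω, expNeg (∑' j, f (X j ω, M j ω)) ∂P
      = ∫ z, Z z ∂(P.map fun ω => ((fun j => X j ω), (fun j => M j ω))) :=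
        (integral_map (hXm.prodMk hMm).aemeasurable hZm.aestronglyMeasurable).symm
    _ = ∫ x, ∫ m, Z (x, m) ∂(P.map fun ω j => M j ω) ∂(P.map fun ω j => X j ω) := by
        rw [hprod]
        exact integral_prod _ (integrable_of_mem_unit hZm (fun _ => expNeg_nonneg _)
          (fun _ => expNeg_le_one _))
    _ = ∫ x, expNeg (∑' j, negLog (G (x j))) ∂(P.map fun ω j => X j ω) := by
        congr 1
        funext x
        have hZx : Measurable fun m : ℕ → K => Z (x, m) := hZm.comp (by fun_prop)
        rw [integral_map hMm.aemeasurable hZx.aestronglyMeasurable]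
        exact hinf x
    _ = ∫ ω, expNeg (∑' j, negLog (G (X j ω))) ∂P := by
        refine integral_map hXm.aemeasurable (Measurable.aestronglyMeasurable ?_)
        exact measurable_expNeg.comp (measurable_tsum_ennreal fun j => by fun_prop)
    _ = expNeg (∫⁻ x, oneSubExpNeg (negLog (G x)) ∂Λ) := h _ (measurable_negLog.comp hGm)
    _ = expNeg (∫⁻ z, oneSubExpNeg (f z) ∂(Λ.prod ν)) := by
        have hm : Measurable fun z => oneSubExpNeg (f z) := measurable_oneSubExpNeg.comp hf
        rw [lintegral_prod _ hm.aemeasurable]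
        congr 2
        funext x
        rw [oneSubExpNeg, expNeg_negLog (hG0 _) (hG1 _)]
        have h1 : 1 - G x = ∫ k, (1 - expNeg (f (x, k))) ∂ν := by
          rw [integral_sub (integrable_const _) (integrable_expNeg (hfx x))]
          simp [hG]
        have h2 : Integrable (fun k => 1 - expNeg (f (x, k))) ν :=
          (integrable_const _).sub (integrable_expNeg (hfx x))
        rw [h1, ofReal_integral_eq_lintegral_ofReal h2
          (Eventually.of_forall fun k => by
            simpa using expNeg_le_one _)]
        rfl

end Laplace

/-! ### Alzer's bounds for the tail of a gamma variable -/

/-- A function on `[0, ∞)` that starts at `0`, tends to `0`, and whose derivative never becomes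
positive once it has been negative, is nonnegative. -/
lemma nonneg_of_deriv_sign {F F' : ℝ → ℝ} (hF : ∀ x, HasDerivAt F (F' x) x) (h0 : F 0 = 0)
    (hlim : Tendsto F atTop (𝓝 0)) (hsign : ∀ s t, 0 < s → s < t → F' s < 0 → F' t ≤ 0)
    {t : ℝ} (ht : 0 ≤ t) : 0 ≤ F t := by
  have hc : Continuous F := continuous_iff_continuousAt.2 fun x => (hF x).continuousAt
  by_cases h : ∀ s ∈ Ioo 0 t, 0 ≤ F' s
  · have hm : MonotoneOn F (Icc 0 t) := by
      refine monotoneOn_of_deriv_nonneg (convex_Icc 0 t) hc.continuousOn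
        (fun x _ => (hF x).differentiableAt.differentiableWithinAt) ?_
      intro x hx
      rw [interior_Icc] at hx
      rw [(hF x).deriv]
      exact h x hx
    have := hm (left_mem_Icc.2 ht) (right_mem_Icc.2 ht) ht
    rwa [h0] at this
  · push Not at h
    obtain ⟨s, hs, hneg⟩ := h
    have hm : AntitoneOn F (Ici t) := by
      refine antitoneOn_of_deriv_nonpos (convex_Ici t) hc.continuousOn
        (fun x _ => (hF x).differentiableAt.differentiableWithinAt) ?_
      intro x hx
      rw [interior_Ici] at hx
      rw [(hF x).deriv]
      exact hsign s x hs.1 (hs.2.trans hx) hneg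
    refine le_of_tendsto hlim ?_
    filter_upwards [eventually_ge_atTop t] with x hx
    exact hm self_mem_Ici hx hx

/-- The function `(1 - exp (-y)) / y`, as the mean of `exp (-u y)` over `u ∈ [0, 1]`. -/
def meanExp (y : ℝ) : ℝ := ∫ u in Ioc (0 : ℝ) 1, Real.exp (-(u * y))

lemma meanExp_eq {y : ℝ} (hy : 0 < y) : meanExp y = (1 - Real.exp (-y)) / y := by
  rw [meanExp, ← intervalIntegral.integral_of_le zero_le_one]
  have h : ∀ u ∈ uIcc (0 : ℝ) 1,
      HasDerivAt (fun u => -(Real.exp (-(u * y)) / y)) (Real.exp (-(u * y))) u := by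
    intro u _
    have h1 : HasDerivAt (fun u => -(u * y)) (-(1 * y)) u := ((hasDerivAt_id u).mul_const y).neg
    refine ((h1.exp).div_const y).neg.congr_deriv ?_
    rw [one_mul, mul_neg, neg_div, neg_neg, mul_div_cancel_right₀ _ hy.ne']
  rw [intervalIntegral.integral_eq_sub_of_hasDerivAt h
    (Continuous.intervalIntegrable (by fun_prop) _ _)]
  simp
  ring

lemma integrable_exp_Ioc (y : ℝ) :
    Integrable (fun u : ℝ => Real.exp (-(u * y))) (volume.restrict (Ioc 0 1)) :=
  (Continuous.integrableOn_Icc (by fun_prop)).mono_set Ioc_subset_Icc_self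

lemma meanExp_antitone : Antitone meanExp := by
  intro y z h
  refine setIntegral_mono_on (integrable_exp_Ioc z) (integrable_exp_Ioc y) measurableSet_Ioc ?_
  intro u hu
  have : u * y ≤ u * z := mul_le_mul_of_nonneg_left h hu.1.le
  exact Real.exp_le_exp.2 (by linarith)

lemma meanExp_nonneg (y : ℝ) : 0 ≤ meanExp y :=
  setIntegral_nonneg measurableSet_Ioc fun _ _ => (Real.exp_pos _).le

/-- Lyapunov's inequality for `exp (-U)` with `U` uniform on `[0, 1]`. -/
lemma meanExp_rpow_le {s t : ℝ} (hs : 0 < s) (hst : s < t) :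
    meanExp s ^ (t / s) ≤ meanExp t := by
  have : IsProbabilityMeasure (volume.restrict (Ioc (0 : ℝ) 1)) := ⟨by simp⟩
  have h1 : 1 ≤ t / s := by rw [le_div_iff₀ hs]; linarith
  have hcomp : ∀ u : ℝ, Real.exp (-(u * s)) ^ (t / s) = Real.exp (-(u * t)) := by
    intro u
    rw [← Real.exp_mul]
    congr 1
    field_simp
  have h2 := (convexOn_rpow h1).map_integral_le (μ := volume.restrict (Ioc (0 : ℝ) 1))
    (f := fun u : ℝ => Real.exp (-(u * s)))
    (Real.continuous_rpow_const (by linarith)).continuousOn isClosed_Ici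
    (Eventually.of_forall fun u => (Real.exp_pos _).le) (integrable_exp_Ioc s)
    (by simp only [Function.comp_def, hcomp]; exact integrable_exp_Ioc t)
  simp only [hcomp] at h2
  exact h2

/-- Density of the unit-mean gamma law with integer shape `m`, continued to the real line by its
analytic expression. -/
def gammaDensity (m : ℕ) (x : ℝ) : ℝ :=
  (m : ℝ) ^ m / (Nat.factorial (m - 1) : ℝ) * x ^ (m - 1) * Real.exp (-(m * x))

lemma gammaPDFReal_eq {m : ℕ} (hm : 1 ≤ m) {x : ℝ} (hx : 0 ≤ x) :
    gammaPDFReal m m x = gammaDensity m x := by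
  have h1 : Real.Gamma (m : ℝ) = (Nat.factorial (m - 1) : ℝ) := by
    have := Real.Gamma_nat_eq_factorial (m - 1)
    rw [← this]
    congr 1
    push_cast [Nat.cast_sub hm]
    ring
  have h2 : x ^ ((m : ℝ) - 1) = x ^ (m - 1) := by
    rw [← Real.rpow_natCast]
    congr 1
    push_cast [Nat.cast_sub hm]
    ring
  rw [gammaPDFReal, if_pos hx, gammaDensity, h1, h2, Real.rpow_natCast]

lemma isProbabilityMeasure_gamma_nat {m : ℕ} (hm : 1 ≤ m) :
    IsProbabilityMeasure (gammaMeasure m m) :=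
  isProbabilityMeasure_gammaMeasure (by exact_mod_cast hm) (by exact_mod_cast hm)

lemma continuous_gammaDensity (m : ℕ) : Continuous (gammaDensity m) := by
  unfold gammaDensity; fun_prop

lemma gammaMeasure_Iio_zero (m : ℕ) : gammaMeasure m m (Iio 0) = 0 := by
  rw [gammaMeasure, withDensity_apply _ measurableSet_Iio]
  exact lintegral_gammaPDF_of_nonpos le_rfl

lemma cdf_gamma_eq {m : ℕ} (hm : 1 ≤ m) {t : ℝ} (ht : 0 ≤ t) :
    cdf (gammaMeasure m m) t = ∫ x in (0 : ℝ)..t, gammaDensity m x := by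
  have hm0 : (0 : ℝ) < m := by exact_mod_cast hm
  rw [cdf_gammaMeasure_eq_integral hm0 hm0, intervalIntegral.integral_of_le ht,
    ← integral_Icc_eq_integral_Ioc]
  have h1 : ∫ x in Icc 0 t, gammaDensity m x = ∫ x in Icc 0 t, gammaPDFReal m m x :=
    setIntegral_congr_fun measurableSet_Icc fun x hx => (gammaPDFReal_eq hm hx.1).symm
  rw [h1]
  refine (setIntegral_eq_of_subset_of_forall_sdiff_eq_zero measurableSet_Iic
    Icc_subset_Iic_self ?_)
  intro x hx
  have : x < 0 := by
    by_contra hn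
    exact hx.2 ⟨not_lt.1 hn, hx.1⟩
  rw [gammaPDFReal, if_neg (not_le.2 this)]

lemma gammaTail_ofReal {m : ℕ} (hm : 1 ≤ m) {t : ℝ} (ht : 0 ≤ t) :
    gammaTail m (ENNReal.ofReal t) = 1 - ∫ x in (0 : ℝ)..t, gammaDensity m x := by
  have := isProbabilityMeasure_gamma_nat hm
  rw [gammaTail, ← cdf_gamma_eq hm ht, cdf_eq_real]
  have hatom : gammaMeasure m m {t} = 0 :=
    (withDensity_absolutelyContinuous _ _) (by simp)
  rw [← probReal_compl_eq_one_sub measurableSet_Iic]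
  refine measureReal_congr ?_
  have h1 : ∀ᵐ h ∂(gammaMeasure m m), h ≠ t := by
    rw [ae_iff]; simpa using hatom
  have h2 : ∀ᵐ h ∂(gammaMeasure m m), 0 ≤ h := by
    rw [ae_iff]
    have : {h : ℝ | ¬ 0 ≤ h} = Iio 0 := by ext; simp
    rw [this]; exact gammaMeasure_Iio_zero m
  filter_upwards [h1, h2] with h hne h0
  refine propext ?_
  change ENNReal.ofReal t ≤ ENNReal.ofReal h ↔ ¬ h ≤ t
  rw [ENNReal.ofReal_le_ofReal_iff h0, not_le]
  exact ⟨fun hle => lt_of_le_of_ne hle (Ne.symm hne), le_of_lt⟩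

lemma gammaTail_top (m : ℕ) : gammaTail m ∞ = 0 := by
  simp [gammaTail]

lemma alzerTail_top {m : ℕ} {a : ℝ} (ha : 0 < a) : alzerTail m a ∞ = 0 := by
  rw [alzerTail, ENNReal.mul_top (by simpa using ha), expNeg_top]
  simp

lemma alzerTail_ofReal (m : ℕ) {a t : ℝ} (ha : 0 ≤ a) (ht : 0 ≤ t) :
    alzerTail m a (ENNReal.ofReal t) = 1 - (1 - Real.exp (-(a * t))) ^ m := by
  rw [alzerTail, ← ENNReal.ofReal_mul ha, expNeg_ofReal (mul_nonneg ha ht)]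

lemma hasDerivAt_gamma_sub_pow (m : ℕ) (a t : ℝ) :
    HasDerivAt (fun t => (∫ x in (0 : ℝ)..t, gammaDensity m x) - (1 - Real.exp (-(a * t))) ^ m)
      (gammaDensity m t - m * (1 - Real.exp (-(a * t))) ^ (m - 1) * (a * Real.exp (-(a * t))))
      t := by
  have h1 : HasDerivAt (fun t => ∫ x in (0 : ℝ)..t, gammaDensity m x) (gammaDensity m t) t :=
    (continuous_gammaDensity m).integral_hasStrictDerivAt 0 t |>.hasDerivAt
  have h2 : HasDerivAt (fun t => -(a * t)) (-(a * 1)) t := ((hasDerivAt_id t).const_mul a).neg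
  have h3 := ((h2.exp).const_sub 1).pow m
  refine (h1.sub h3).congr_deriv ?_
  ring

lemma tendsto_gamma_sub_pow {m : ℕ} (hm : 1 ≤ m) {a : ℝ} (ha : 0 < a) :
    Tendsto (fun t => (∫ x in (0 : ℝ)..t, gammaDensity m x) - (1 - Real.exp (-(a * t))) ^ m)
      atTop (𝓝 0) := by
  have := isProbabilityMeasure_gamma_nat hm
  have h1 : Tendsto (fun t => ∫ x in (0 : ℝ)..t, gammaDensity m x) atTop (𝓝 1) := by
    refine (tendsto_cdf_atTop (gammaMeasure m m)).congr' ?_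
    filter_upwards [eventually_ge_atTop 0] with t ht using cdf_gamma_eq hm ht
  have h2 : Tendsto (fun t : ℝ => Real.exp (-(a * t))) atTop (𝓝 0) :=
    Real.tendsto_exp_neg_atTop_nhds_zero.comp (tendsto_id.const_mul_atTop ha)
  have h3 := h1.sub (((tendsto_const_nhds (x := (1 : ℝ))).sub h2).pow m)
  simpa using h3

lemma one_sub_exp_eq {y : ℝ} (hy : 0 < y) : 1 - Real.exp (-y) = y * meanExp y := by
  rw [meanExp_eq hy]; field_simp

lemma alzerRate_pos {m : ℕ} (hm : 1 ≤ m) : 0 < alzerRate m := by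
  have : (0 : ℝ) < m := by exact_mod_cast hm
  unfold alzerRate; positivity

lemma alzerRate_pow {m : ℕ} (hm : 1 ≤ m) :
    alzerRate m ^ m = (m : ℝ) ^ m / (Nat.factorial m : ℝ) := by
  have : (m : ℝ) ≠ 0 := by positivity
  rw [alzerRate, mul_pow, ← Real.rpow_natCast (_ ^ (_ : ℝ)), ← Real.rpow_mul (by positivity),
    div_mul_cancel₀ _ this, Real.rpow_neg_one]
  rfl

lemma alzerRate_one : alzerRate 1 = 1 := by simp [alzerRate]

lemma factorial_pred_cast {m : ℕ} (hm : 1 ≤ m) :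
    (Nat.factorial m : ℝ) = m * (Nat.factorial (m - 1) : ℝ) := by
  exact_mod_cast (Nat.mul_factorial_pred (by omega)).symm

/-- Upper bound for the gamma tail. The derivative of the difference has the sign of
`exp (-(m - γ) t) - w(γ t) ^ (m - 1)` with `w = meanExp`, and it changes sign at most once because
`w (y) ^ (1 / y)` is monotone. -/
lemma gammaTail_le_alzerTail {m : ℕ} (hm : 1 ≤ m) (t : ℝ≥0∞) :
    gammaTail m t ≤ alzerTail m (alzerRate m) t := by
  set a := alzerRate m with hadef
  have ha : 0 < a := alzerRate_pos hm
  have hm0 : (0 : ℝ) < m := by exact_mod_cast hm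
  by_cases htop : t = ∞
  · rw [htop, gammaTail_top, alzerTail_top ha]
  obtain ⟨t, ht, rfl⟩ : ∃ r : ℝ, 0 ≤ r ∧ ENNReal.ofReal r = t :=
    ⟨t.toReal, ENNReal.toReal_nonneg, ENNReal.ofReal_toReal htop⟩
  rw [gammaTail_ofReal hm ht, alzerTail_ofReal m ha.le ht]
  suffices h : 0 ≤ (∫ x in (0 : ℝ)..t, gammaDensity m x) - (1 - Real.exp (-(a * t))) ^ m by
    linarith
  have hfact : ∀ x : ℝ, gammaDensity m x
      = m * a * (a * x) ^ (m - 1) * Real.exp (-(m * x)) := by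
    intro x
    have h1 : (m : ℝ) ^ m / (Nat.factorial (m - 1) : ℝ) = m * a ^ m := by
      rw [alzerRate_pow hm, factorial_pred_cast hm]
      field_simp
    rw [gammaDensity, h1, mul_pow]
    obtain ⟨k, rfl⟩ : ∃ k, m = k + 1 := ⟨m - 1, by omega⟩
    simp only [Nat.add_sub_cancel, pow_succ]
    ring
  have hder : ∀ x : ℝ, 0 < x → gammaDensity m x
      - m * (1 - Real.exp (-(a * x))) ^ (m - 1) * (a * Real.exp (-(a * x)))
      = m * a * (a * x) ^ (m - 1) * Real.exp (-(a * x))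
        * (Real.exp (-((m - a) * x)) - meanExp (a * x) ^ (m - 1)) := by
    intro x hx
    rw [hfact, one_sub_exp_eq (mul_pos ha hx), mul_pow]
    have : Real.exp (-(m * x)) = Real.exp (-(a * x)) * Real.exp (-((m - a) * x)) := by
      rw [← Real.exp_add]; ring_nf
    rw [this]; ring
  refine nonneg_of_deriv_sign (hasDerivAt_gamma_sub_pow m a) (by simp; omega)
    (tendsto_gamma_sub_pow hm ha) ?_ ht
  intro s u hs hsu hneg
  have hu : 0 < u := hs.trans hsu
  rw [hder s hs] at hneg
  rw [hder u hu]
  have h1 : Real.exp (-((m - a) * s)) < meanExp (a * s) ^ (m - 1) := by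
    by_contra hn
    have : 0 ≤ Real.exp (-((m - a) * s)) - meanExp (a * s) ^ (m - 1) := by linarith
    exact absurd hneg (not_lt.2 (by positivity))
  have h2 : Real.exp (-((m - a) * u)) ≤ meanExp (a * u) ^ (m - 1) := by
    have h3 := meanExp_rpow_le (mul_pos ha hs) (mul_lt_mul_of_pos_left hsu ha)
    have hr : a * u / (a * s) = u / s := by field_simp
    rw [hr] at h3
    calc Real.exp (-((m - a) * u)) = Real.exp (-((m - a) * s)) ^ (u / s) := by
          rw [← Real.exp_mul]; congr 1; field_simp
      _ ≤ (meanExp (a * s) ^ (m - 1)) ^ (u / s) :=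
          Real.rpow_le_rpow (Real.exp_pos _).le h1.le (by positivity)
      _ = (meanExp (a * s) ^ (u / s)) ^ (m - 1) := by
          rw [← Real.rpow_natCast, ← Real.rpow_natCast, ← Real.rpow_mul (meanExp_nonneg _),
            ← Real.rpow_mul (meanExp_nonneg _), mul_comm (u / s)]
      _ ≤ meanExp (a * u) ^ (m - 1) :=
          pow_le_pow_left₀ (Real.rpow_nonneg (meanExp_nonneg _) _) h3 _
  have h4 : 0 ≤ m * a * (a * u) ^ (m - 1) * Real.exp (-(a * u)) := by positivity
  exact mul_nonpos_of_nonneg_of_nonpos h4 (by linarith)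

/-- Lower bound for the gamma tail. The derivative of the difference has the sign of
`w(m t) ^ (m - 1) - 1 / m!` with the decreasing function `w = meanExp`. -/
lemma alzerTail_le_gammaTail {m : ℕ} (hm : 1 ≤ m) (t : ℝ≥0∞) :
    alzerTail m m t ≤ gammaTail m t := by
  have hm0 : (0 : ℝ) < m := by exact_mod_cast hm
  by_cases htop : t = ∞
  · rw [htop, gammaTail_top, alzerTail_top hm0]
  obtain ⟨t, ht, rfl⟩ : ∃ r : ℝ, 0 ≤ r ∧ ENNReal.ofReal r = t :=
    ⟨t.toReal, ENNReal.toReal_nonneg, ENNReal.ofReal_toReal htop⟩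
  rw [gammaTail_ofReal hm ht, alzerTail_ofReal m hm0.le ht]
  suffices h : 0 ≤ -((∫ x in (0 : ℝ)..t, gammaDensity m x) - (1 - Real.exp (-(m * t))) ^ m) by
    linarith
  have hder : ∀ x : ℝ, 0 < x → gammaDensity m x
      - m * (1 - Real.exp (-(m * x))) ^ (m - 1) * (m * Real.exp (-(m * x)))
      = m * m * (m * x) ^ (m - 1) * Real.exp (-(m * x))
        * (1 / (Nat.factorial m : ℝ) - meanExp (m * x) ^ (m - 1)) := by
    intro x hx
    rw [gammaDensity, one_sub_exp_eq (mul_pos hm0 hx), mul_pow, mul_pow, factorial_pred_cast hm]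
    obtain ⟨k, rfl⟩ : ∃ k, m = k + 1 := ⟨m - 1, by omega⟩
    simp only [Nat.add_sub_cancel, pow_succ]
    field_simp
  refine nonneg_of_deriv_sign (fun x => (hasDerivAt_gamma_sub_pow m m x).neg) (by simp; omega)
    (neg_zero (G := ℝ) ▸ (tendsto_gamma_sub_pow hm hm0).neg :) ?_ ht
  intro s u hs hsu hneg
  have hu : 0 < u := hs.trans hsu
  rw [hder s hs] at hneg
  rw [hder u hu]
  have h1 : meanExp (m * s) ^ (m - 1) < 1 / (Nat.factorial m : ℝ) := by
    by_contra hn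
    have h5 : 1 / (Nat.factorial m : ℝ) - meanExp (m * s) ^ (m - 1) ≤ 0 := by linarith
    have h6 : 0 ≤ m * m * (m * s) ^ (m - 1) * Real.exp (-(m * s)) := by positivity
    have := mul_nonpos_of_nonneg_of_nonpos h6 h5
    linarith
  have h2 : meanExp (m * u) ^ (m - 1) ≤ meanExp (m * s) ^ (m - 1) :=
    pow_le_pow_left₀ (meanExp_nonneg _)
      (meanExp_antitone (mul_le_mul_of_nonneg_left hsu.le hm0.le)) _
  have h4 : 0 ≤ m * m * (m * u) ^ (m - 1) * Real.exp (-(m * u)) := by positivity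
  have := mul_nonneg h4 (by linarith : 0 ≤ 1 / (Nat.factorial m : ℝ) - meanExp (m * u) ^ (m - 1))
  linarith

/-- Laplace transform of the unit-mean gamma law: multiplying the density by `exp (-c x)` gives a
multiple of the gamma density with a larger rate. -/
lemma integral_expNeg_gamma {m : ℕ} (hm : 1 ≤ m) {c : ℝ} (hc : 0 ≤ c) :
    ∫ h, expNeg (ENNReal.ofReal (c * h)) ∂(gammaMeasure m m) = 1 - H m (c / m) := by
  have hm0 : (0 : ℝ) < m := by exact_mod_cast hm
  have hmc : (0 : ℝ) < m + c := by linarith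
  have h1 : gammaMeasure m m
      = volume.withDensity fun x => ENNReal.ofReal (gammaPDFReal m m x) := rfl
  rw [h1, integral_withDensity_eq_integral_toReal_smul (by fun_prop)
    (Eventually.of_forall fun _ => ENNReal.ofReal_lt_top)]
  have h2 : ∀ x, (ENNReal.ofReal (gammaPDFReal m m x)).toReal
      • expNeg (ENNReal.ofReal (c * x)) = (m / (m + c)) ^ m * gammaPDFReal m (m + c) x := by
    intro x
    rw [ENNReal.toReal_ofReal (gammaPDFReal_nonneg hm0 hm0 x), smul_eq_mul, gammaPDFReal,
      gammaPDFReal]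
    split_ifs with hx
    · rw [expNeg_ofReal (mul_nonneg hc hx), Real.rpow_natCast, Real.rpow_natCast, div_pow]
      have : Real.exp (-((m + c) * x)) = Real.exp (-(m * x)) * Real.exp (-(c * x)) := by
        rw [← Real.exp_add]; ring_nf
      rw [this]
      field_simp
    · simp
  simp_rw [h2]
  have h3 : ∫ x, gammaPDFReal m (m + c) x = 1 := by
    have := lintegral_gammaPDF_eq_one hm0 hmc
    rw [integral_eq_lintegral_of_nonneg_ae
      (Eventually.of_forall (gammaPDFReal_nonneg hm0 hmc))
      (measurable_gammaPDFReal _ _).aestronglyMeasurable]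
    simp only [gammaPDF] at this
    rw [this, ENNReal.toReal_one]
  rw [integral_const_mul, h3, H]
  have h4 : 1 + c / m = (m + c) / m := by field_simp
  rw [h4, div_pow, div_pow]
  field_simp
  ring

/-! ### Two lemmas of analysis -/

/-- Integration of a radial function on the plane in polar coordinates. -/
lemma lintegral_norm_plane {f : ℝ → ℝ≥0∞} (hf : Measurable f) :
    ∫⁻ x : Plane, f ‖x‖ = ENNReal.ofReal (2 * Real.pi) *
      ∫⁻ r in Ioi (0 : ℝ), ENNReal.ofReal r * f r := by
  have hd : Module.finrank ℝ Plane = 2 := by simp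
  calc ∫⁻ x : Plane, f ‖x‖ = ∫⁻ x : ({(0)}ᶜ : Set Plane), f ‖x.1‖ ∂(volume.comap Subtype.val) := by
        rw [lintegral_subtype_comap (measurableSet_singleton _).compl fun x => f ‖x‖,
          restrict_compl_singleton]
    _ = ∫⁻ x, f x.2 ∂(volume : Measure Plane).toSphere.prod
          (.volumeIoiPow (Module.finrank ℝ Plane - 1)) := by
        rw [← (volume : Measure Plane).measurePreserving_homeomorphUnitSphereProd.lintegral_comp
          (by fun_prop)]
        simp
    _ = (volume : Measure Plane).toSphere univ
          * ∫⁻ x : Ioi (0 : ℝ), f x ∂.volumeIoiPow (Module.finrank ℝ Plane - 1) := by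
        rw [lintegral_prod _ (by fun_prop)]
        simp [mul_comm]
    _ = _ := by
        rw [Measure.toSphere_apply_univ, hd, EuclideanSpace.volume_ball_fin_two]
        simp only [Measure.volumeIoiPow]
        rw [lintegral_withDensity_eq_lintegral_mul _ (by fun_prop) (by fun_prop)]
        simp only [Pi.mul_apply]
        rw [lintegral_subtype_comap measurableSet_Ioi fun a => ENNReal.ofReal (a ^ (2 - 1)) * f a]
        congr 1
        · rw [ENNReal.ofReal_mul (by norm_num)]
          simp
        · simp

/-- Two interval functions `ΔG` and `ΔJ` agree if on every subinterval their difference is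
bounded by `C ⋅ ΔD ⋅ (|ΔΨ| + ΔD)` with `D` continuous and monotone and `Ψ` antitone: in the sum over
a fine partition the factors `ΔD` are small, and `∑ (|ΔΨ| + ΔD)` telescopes. -/
lemma sub_eq_sub_of_increment_bound {δ R C : ℝ} (hδR : δ ≤ R) {G J D Ψ : ℝ → ℝ}
    (hD : ContinuousOn D (Icc δ R)) (hC : 0 ≤ C)
    (hΨ : ∀ x y, δ ≤ x → x ≤ y → y ≤ R → Ψ y ≤ Ψ x)
    (hmono : ∀ x y, δ ≤ x → x ≤ y → y ≤ R → D x ≤ D y)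
    (h : ∀ x y, δ ≤ x → x ≤ y → y ≤ R →
      |(G y - G x) - (J y - J x)| ≤ C * (D y - D x) * ((Ψ x - Ψ y) + (D y - D x))) :
    G R - G δ = J R - J δ := by
  have hub := isCompact_Icc.uniformContinuousOn_of_continuous hD
  set K := C * ((Ψ δ - Ψ R) + (D R - D δ)) with hK
  have hK0 : 0 ≤ K := mul_nonneg hC (by
    linarith [hΨ δ R le_rfl hδR le_rfl, hmono δ R le_rfl hδR le_rfl])
  suffices hε : ∀ ε > 0, |(G R - G δ) - (J R - J δ)| ≤ ε * K by
    have h0 : |(G R - G δ) - (J R - J δ)| ≤ 0 := by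
      refine le_of_forall_pos_le_add fun e he => ?_
      have := hε (e / (K + 1)) (by positivity)
      have h2 : e / (K + 1) * K ≤ e := by
        rw [div_mul_eq_mul_div, div_le_iff₀ (by positivity)]
        nlinarith
      linarith
    have := abs_nonpos_iff.1 h0
    linarith
  intro ε hε
  obtain ⟨η, hη, hη'⟩ := Metric.uniformContinuousOn_iff.1 hub ε hε
  obtain ⟨n, hn⟩ := exists_nat_gt ((R - δ) / η)
  have hn0 : (0 : ℝ) < n := lt_of_le_of_lt (div_nonneg (by linarith) hη.le) hn
  set x : ℕ → ℝ := fun k => δ + k * ((R - δ) / n) with hx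
  have hstep : 0 ≤ (R - δ) / n := div_nonneg (by linarith) hn0.le
  have hx0 : x 0 = δ := by simp [hx]
  have hxn : x n = R := by
    simp only [hx]; field_simp; ring
  have hxs : ∀ k, x (k + 1) - x k = (R - δ) / n := by
    intro k; simp only [hx]; push_cast; ring
  have hxle : ∀ k, x k ≤ x (k + 1) := fun k => by linarith [hxs k]
  have hxmono : Monotone x := monotone_nat_of_le_succ hxle
  have hxδ : ∀ k, δ ≤ x k := fun k => hx0 ▸ hxmono (Nat.zero_le k)
  have hxR : ∀ k, k ≤ n → x k ≤ R := fun k hk => hxn ▸ hxmono hk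
  have hcell : ∀ k ∈ Finset.range n,
      |(G (x (k + 1)) - G (x k)) - (J (x (k + 1)) - J (x k))|
        ≤ ε * C * ((Ψ (x k) - Ψ (x (k + 1))) + (D (x (k + 1)) - D (x k))) := by
    intro k hk
    have hk' : k + 1 ≤ n := Finset.mem_range.1 hk
    have h1 := h (x k) (x (k + 1)) (hxδ k) (hxle k) (hxR _ hk')
    have h2 := hmono (x k) (x (k + 1)) (hxδ k) (hxle k) (hxR _ hk')
    have h3 := hΨ (x k) (x (k + 1)) (hxδ k) (hxle k) (hxR _ hk')
    have h4 : D (x (k + 1)) - D (x k) ≤ ε := by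
      have h5 := hη' (x (k + 1)) ⟨hxδ _, hxR _ hk'⟩ (x k) ⟨hxδ _, hxR _ (by omega)⟩ (by
        rw [Real.dist_eq, hxs, abs_of_nonneg hstep, div_lt_iff₀ hn0]
        rw [div_lt_iff₀ hη] at hn
        linarith)
      rw [Real.dist_eq] at h5
      exact (le_abs_self _).trans h5.le
    refine h1.trans ?_
    have h6 : C * (D (x (k + 1)) - D (x k)) ≤ ε * C := by
      rw [mul_comm ε]; exact mul_le_mul_of_nonneg_left h4 hC
    exact mul_le_mul_of_nonneg_right h6 (by linarith)
  have htel : ∀ f : ℕ → ℝ, ∑ k ∈ Finset.range n, (f (k + 1) - f k) = f n - f 0 :=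
    fun f => Finset.sum_range_sub f n
  calc |(G R - G δ) - (J R - J δ)|
      = |∑ k ∈ Finset.range n, ((G (x (k + 1)) - G (x k)) - (J (x (k + 1)) - J (x k)))| := by
        rw [Finset.sum_sub_distrib, htel (fun k => G (x k)), htel (fun k => J (x k)), hx0, hxn]
    _ ≤ ∑ k ∈ Finset.range n, |(G (x (k + 1)) - G (x k)) - (J (x (k + 1)) - J (x k))| :=
        Finset.abs_sum_le_sum_abs _ _
    _ ≤ ∑ k ∈ Finset.range n,
          ε * C * ((Ψ (x k) - Ψ (x (k + 1))) + (D (x (k + 1)) - D (x k))) :=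
        Finset.sum_le_sum hcell
    _ = ε * K := by
        rw [← Finset.mul_sum, Finset.sum_add_distrib, htel (fun k => D (x k))]
        have : ∑ k ∈ Finset.range n, (Ψ (x k) - Ψ (x (k + 1))) = Ψ δ - Ψ R := by
          rw [Finset.sum_range_sub' (fun k => Ψ (x k)), hx0, hxn]
        rw [this, hx0, hxn, hK]
        ring

/-! ### The network as a functional of its marked points -/

/-- Marks of a base station: backhaul indicator, uniform variable, the two fading gains, and the two
antenna gains. -/
abbrev Mark : Type := Bool × ℝ × ℝ × ℝ × ℝ × ℝ

/-- A position together with its marks. -/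
abbrev MarkedPoint : Type := Plane × Mark

/-- Fading gain of a marked point in the given link state. -/
def fadingOf : LinkType → MarkedPoint → ℝ
  | .los, z => z.2.2.2.1
  | .nlos, z => z.2.2.2.2.1

namespace Params

variable (p : Params)

open Classical in
/-- Link state of a marked point. -/
def stateOf (z : MarkedPoint) : LinkType :=
  if z.2.2.1 ≤ p.kappa .los ‖z.1‖ then .los else .nlos

/-- Average path gain of a marked point. -/
def gainOf (z : MarkedPoint) : ℝ := p.pathGain (p.stateOf z) ‖z.1‖

/-- Power received from a marked point if its link is an interfering one. -/
def powerOf (z : MarkedPoint) : ℝ≥0∞ :=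
  ENNReal.ofReal (p.Pb * (z.2.2.2.2.2.1 * z.2.2.2.2.2.2) * p.gainOf z
    * fadingOf (p.stateOf z) z)

/-- The `i`-th marked point is enabled and has maximal path gain among the enabled ones. -/
def IsServer (c : ℕ → MarkedPoint) (i : ℕ) : Prop :=
  (c i).2.1 = true ∧ ∀ j, (c j).2.1 = true → p.gainOf (c j) ≤ p.gainOf (c i)

/-- Index of the serving point; it is `0` if there is none. -/
def server (c : ℕ → MarkedPoint) : ℕ := sInf {i | p.IsServer c i}

open Classical in
/-- Sum of the received powers of the enabled points other than the serving one. -/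
def interferenceOf (c : ℕ → MarkedPoint) : ℝ≥0∞ :=
  ∑' j : ℕ, if (c j).2.1 = true ∧ j ≠ p.server c then p.powerOf (c j) else 0

/-- The fading threshold as a functional of the marked points. -/
def thresholdOf (τ g : ℝ) (c : ℕ → MarkedPoint) : ℝ≥0∞ :=
  ENNReal.ofReal τ * (ENNReal.ofReal p.sigmaSq + p.interferenceOf c)
    / ENNReal.ofReal (p.Pb * g * p.gainOf (c (p.server c)))

lemma measurable_kappa (ξ : LinkType) : Measurable (p.kappa ξ) := by
  cases ξ
  · change Measurable fun r => -p.c * Real.exp (-p.d * Real.arctan (p.dh / r)) + p.e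
    fun_prop
  · change Measurable fun r => 1 - (-p.c * Real.exp (-p.d * Real.arctan (p.dh / r)) + p.e)
    fun_prop

lemma measurable_pathGain (ξ : LinkType) : Measurable (p.pathGain ξ) := by
  unfold pathGain; fun_prop

lemma measurableSet_state_los : MeasurableSet {z : MarkedPoint | z.2.2.1 ≤ p.kappa .los ‖z.1‖} :=
  measurableSet_le (by fun_prop) ((p.measurable_kappa _).comp (by fun_prop))

lemma measurable_state_dep {β : Type*} [MeasurableSpace β] {f : LinkType → MarkedPoint → β}
    (hf : ∀ ξ, Measurable (f ξ)) : Measurable fun z => f (p.stateOf z) z := by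
  classical
  have : (fun z => f (p.stateOf z) z)
      = fun z => if z.2.2.1 ≤ p.kappa .los ‖z.1‖ then f .los z else f .nlos z := by
    funext z
    unfold stateOf
    split_ifs <;> rfl
  rw [this]
  exact Measurable.ite p.measurableSet_state_los (hf _) (hf _)

lemma measurableSet_state (ξ : LinkType) : MeasurableSet {z : MarkedPoint | p.stateOf z = ξ} := by
  classical
  have h : Measurable fun z : MarkedPoint => p.stateOf z = ξ :=
    p.measurable_state_dep (f := fun ζ _ => ζ = ξ) fun _ => measurable_const
  exact measurableSet_setOfPred.2 h

lemma measurable_fadingOf (ξ : LinkType) : Measurable (fadingOf ξ) := by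
  cases ξ
  · change Measurable fun z : MarkedPoint => z.2.2.2.1
    fun_prop
  · change Measurable fun z : MarkedPoint => z.2.2.2.2.1
    fun_prop

lemma measurable_gainOf : Measurable p.gainOf :=
  p.measurable_state_dep (f := fun ξ z => p.pathGain ξ ‖z.1‖)
    fun ξ => (p.measurable_pathGain ξ).comp (by fun_prop)

lemma measurable_powerOf : Measurable p.powerOf := by
  have h1 := p.measurable_gainOf
  have h2 : Measurable fun z => fadingOf (p.stateOf z) z :=
    p.measurable_state_dep measurable_fadingOf
  unfold powerOf
  fun_prop

lemma measurableSet_enabled : MeasurableSet {z : MarkedPoint | z.2.1 = true} :=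
  (measurableSet_singleton true).preimage (by fun_prop : Measurable fun z : MarkedPoint => z.2.1)

lemma measurableSet_isServer (i : ℕ) : MeasurableSet {c | p.IsServer c i} := by
  have hg := p.measurable_gainOf
  have h1 : ∀ j, MeasurableSet {c : ℕ → MarkedPoint | (c j).2.1 = true} := fun j =>
    measurableSet_enabled.preimage (measurable_pi_apply j)
  have h2 : {c | p.IsServer c i} = {c : ℕ → MarkedPoint | (c i).2.1 = true} ∩
      ⋂ j, ({c : ℕ → MarkedPoint | (c j).2.1 = true}ᶜ ∪ {c | p.gainOf (c j) ≤ p.gainOf (c i)}) := by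
    ext c
    simp [IsServer, imp_iff_not_or]
  rw [h2]
  refine (h1 i).inter (MeasurableSet.iInter fun j => (h1 j).compl.union ?_)
  exact measurableSet_le (by fun_prop) (by fun_prop)

lemma measurable_server : Measurable p.server := by
  refine measurable_to_countable' fun n => ?_
  have h : p.server ⁻¹' {n} = ({c | p.IsServer c n} ∩ ⋂ k, ⋂ _ : k < n, {c | p.IsServer c k}ᶜ)
      ∪ ({c | n = 0} ∩ ⋂ k, {c | p.IsServer c k}ᶜ) := by
    ext c
    simp only [mem_preimage, mem_singleton_iff, mem_union, mem_inter_iff, mem_iInter, mem_compl_iff,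
      mem_ofPred_eq, server]
    constructor
    · intro h
      by_cases he : {i | p.IsServer c i}.Nonempty
      · left
        rw [← h]
        exact ⟨Nat.sInf_mem he, fun k hk hs => Nat.notMem_of_lt_sInf hk hs⟩
      · right
        rw [not_nonempty_iff_eq_empty] at he
        rw [he, Nat.sInf_empty] at h
        exact ⟨h.symm, fun k hk => by
          have : k ∈ {i | p.IsServer c i} := hk
          rw [he] at this; exact this⟩
    · rintro (⟨h1, h2⟩ | ⟨h1, h2⟩)
      · refine le_antisymm (Nat.sInf_le h1) ?_
        by_contra hn
        have hmem : sInf {i | p.IsServer c i} ∈ {i | p.IsServer c i} := Nat.sInf_mem ⟨n, h1⟩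
        exact h2 _ (not_le.1 hn) hmem
      · have : {i | p.IsServer c i} = ∅ := eq_empty_of_forall_notMem h2
        rw [this, Nat.sInf_empty, h1]
  rw [h]
  refine ((p.measurableSet_isServer n).inter (MeasurableSet.iInter fun k =>
    MeasurableSet.iInter fun _ => (p.measurableSet_isServer k).compl)).union
    ((MeasurableSet.const _).inter
      (MeasurableSet.iInter fun k => (p.measurableSet_isServer k).compl))

lemma measurable_serverPoint : Measurable fun c : ℕ → MarkedPoint => c (p.server c) := by
  have : Measurable fun q : (ℕ → MarkedPoint) × ℕ => q.1 q.2 :=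
    measurable_from_prod_countable_left fun n => measurable_pi_apply n
  exact this.comp (measurable_id.prodMk p.measurable_server)

lemma measurable_interferenceOf : Measurable p.interferenceOf := by
  classical
  refine measurable_tsum_ennreal fun j => Measurable.ite ?_ ?_ measurable_const
  · exact (measurableSet_enabled.preimage (measurable_pi_apply j)).inter
      ((MeasurableSet.of_discrete (s := {n : ℕ | j ≠ n})).preimage p.measurable_server)
  · exact p.measurable_powerOf.comp (measurable_pi_apply j)

lemma measurable_thresholdOf (τ g : ℝ) : Measurable (p.thresholdOf τ g) := by
  have h1 := p.measurable_interferenceOf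
  have h2 := p.measurable_gainOf.comp p.measurable_serverPoint
  unfold thresholdOf
  simp only [Function.comp_def] at h2
  fun_prop

/-! ### Erasing the fading gains of one base station -/

/-- The marks that decide whether and in which state a base station serves. -/
def keepState (k : Mark) : Mark := (k.1, k.2.1, 0, 0, 0, 0)

/-- The configuration in which the `i`-th point keeps only its backhaul indicator and its uniform
variable. -/
def erase (i : ℕ) (c : ℕ → MarkedPoint) : ℕ → MarkedPoint :=
  fun j => ((c j).1, if j = i then keepState (c j).2 else (c j).2)

lemma stateOf_erase (i : ℕ) (c : ℕ → MarkedPoint) (j : ℕ) :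
    p.stateOf (erase i c j) = p.stateOf (c j) := by
  unfold erase stateOf keepState
  split_ifs <;> simp_all

lemma gainOf_erase (i : ℕ) (c : ℕ → MarkedPoint) (j : ℕ) :
    p.gainOf (erase i c j) = p.gainOf (c j) := by
  rw [gainOf, stateOf_erase]; rfl

lemma enabled_erase (i : ℕ) (c : ℕ → MarkedPoint) (j : ℕ) :
    (erase i c j).2.1 = (c j).2.1 := by
  unfold erase keepState
  split_ifs <;> rfl

lemma server_erase (i : ℕ) (c : ℕ → MarkedPoint) : p.server (erase i c) = p.server c := by
  simp only [server, IsServer, gainOf_erase, enabled_erase]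

lemma thresholdOf_erase (τ g : ℝ) {i : ℕ} {c : ℕ → MarkedPoint} (hi : p.server c = i) :
    p.thresholdOf τ g (erase i c) = p.thresholdOf τ g c := by
  have hI : p.interferenceOf (erase i c) = p.interferenceOf c := by
    unfold interferenceOf
    refine tsum_congr fun j => ?_
    rw [enabled_erase, server_erase]
    by_cases hj : j = i
    · simp [hj, hi]
    · have : erase i c j = c j := by simp [erase, hj]
      rw [this]
  rw [thresholdOf, thresholdOf, hI, server_erase, gainOf_erase]

end Params

/-! ### Independence of the serving fading gain -/

section Indep

variable {Ω : Type*} [MeasurableSpace Ω] {P : Measure Ω}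

lemma indepFun_comp_of_map {K α β : Type*} [MeasurableSpace K] [MeasurableSpace α]
    [MeasurableSpace β] {M : Ω → K} (hM : Measurable M) {f : K → α} {g : K → β}
    (hf : Measurable f) (hg : Measurable g) (h : IndepFun f g (P.map M)) :
    IndepFun (fun ω => f (M ω)) (fun ω => g (M ω)) P := by
  rw [indepFun_iff_measure_inter_preimage_eq_mul] at h ⊢
  intro s t hs ht
  have := h s t hs ht
  rw [Measure.map_apply hM ((hf hs).inter (hg ht)), Measure.map_apply hM (hf hs),
    Measure.map_apply hM (hg ht)] at this
  exact this

/-- If `A` is independent of `B`, and the pair of `C`, then `A` is independent of `(B, C)`. -/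
lemma indepFun_prodMk_right [IsProbabilityMeasure P] {α β γ : Type*} [MeasurableSpace α]
    [MeasurableSpace β] [MeasurableSpace γ] {A : Ω → α} {B : Ω → β} {C : Ω → γ}
    (hA : Measurable A) (hB : Measurable B) (hC : Measurable C) (hAB : IndepFun A B P)
    (hABC : IndepFun (fun ω => (A ω, B ω)) C P) : IndepFun A (fun ω => (B ω, C ω)) P := by
  have hBC : IndepFun B C P := hABC.comp (φ := Prod.snd) (ψ := id) measurable_snd measurable_id
  have := Measure.isProbabilityMeasure_map (μ := P) hA.aemeasurable
  have := Measure.isProbabilityMeasure_map (μ := P) hB.aemeasurable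
  have := Measure.isProbabilityMeasure_map (μ := P) hC.aemeasurable
  rw [indepFun_iff_map_prod_eq_prod_map_map hA.aemeasurable (hB.prodMk hC).aemeasurable,
    hBC.map_prod_eq_prod_map_map hB.aemeasurable hC.aemeasurable]
  have h1 := hABC.map_prod_eq_prod_map_map (hA.prodMk hB).aemeasurable hC.aemeasurable
  rw [hAB.map_prod_eq_prod_map_map hA.aemeasurable hB.aemeasurable] at h1
  have h2 := congrArg (Measure.map MeasurableEquiv.prodAssoc) h1
  rw [(measurePreserving_prodAssoc _ _ _).map_eq, Measure.map_map (by fun_prop) (by fun_prop)] at h2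
  exact h2

/-- One member of an independent sequence is independent of all the others together. -/
lemma indepFun_others {K : Type*} [MeasurableSpace K] {M : ℕ → Ω → K}
    (hM : ∀ j, Measurable (M j)) (h : iIndepFun M P) (i : ℕ) (k₀ : K) :
    IndepFun (M i) (fun ω j => if j = i then k₀ else M j ω) P := by
  have h1 := indep_iSup_of_disjoint (fun j => (hM j).comap_le) h.iIndep
    (S := {i}) (T := {i}ᶜ) disjoint_compl_right
  rw [IndepFun_iff_Indep]
  refine indep_of_indep_of_le_left (indep_of_indep_of_le_right h1 ?_) ?_
  · refine Measurable.comap_le (@measurable_pi_lambda _ _ _ (_) _ _ fun j => ?_)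
    by_cases hj : j = i
    · simp only [hj, if_true]
      exact @measurable_const _ _ _ (_) _
    · simp only [hj, if_false]
      rw [measurable_iff_comap_le]
      exact le_iSup₂_of_le (f := fun j (_ : j ∈ ({i}ᶜ : Set ℕ)) =>
        MeasurableSpace.comap (M j) inferInstance) j hj le_rfl
  · exact le_iSup₂_of_le (f := fun j (_ : j ∈ ({i} : Set ℕ)) =>
        MeasurableSpace.comap (M j) inferInstance) i rfl le_rfl

end Indep

namespace Params

variable {p : Params}

lemma Valid.cG_mem (hp : p.Valid) : 0 ≤ p.cG ∧ p.cG ≤ 1 :=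
  ⟨div_nonneg hp.thG_nonneg (by positivity), (div_le_one (by positivity)).2 hp.thG_le⟩

lemma Valid.cU_mem (hp : p.Valid) : 0 ≤ p.cU ∧ p.cU ≤ 1 :=
  ⟨div_nonneg hp.thU_nonneg (by positivity), (div_le_one (by positivity)).2 hp.thU_le⟩

lemma isProbabilityMeasure_gainLaw {c : ℝ} (h : 0 ≤ c ∧ c ≤ 1) (x y : ℝ) :
    IsProbabilityMeasure (gainLaw c x y) := ⟨by
  simp only [gainLaw, Measure.add_apply, Measure.smul_apply, measure_univ, smul_eq_mul, mul_one]
  rw [← ENNReal.ofReal_add h.1 (by linarith [h.2])]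
  simp⟩

lemma Valid.isProbabilityMeasure_enabledLaw (hp : p.Valid) :
    IsProbabilityMeasure p.enabledLaw := ⟨by
  simp only [enabledLaw, Measure.add_apply, Measure.smul_apply, measure_univ, smul_eq_mul, mul_one]
  rw [← ENNReal.ofReal_add hp.deltaB_pos.le (by linarith [hp.deltaB_le_one])]
  simp⟩

lemma isProbabilityMeasure_uniform :
    IsProbabilityMeasure (volume.restrict (Icc (0 : ℝ) 1)) := ⟨by simp⟩

lemma Valid.isProbabilityMeasure_markLaw (hp : p.Valid) : IsProbabilityMeasure p.markLaw := by
  have := hp.isProbabilityMeasure_enabledLaw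
  have := isProbabilityMeasure_uniform
  have := isProbabilityMeasure_gamma_nat (hp.m_pos .los)
  have := isProbabilityMeasure_gamma_nat (hp.m_pos .nlos)
  have := isProbabilityMeasure_gainLaw hp.cG_mem p.GgMax p.GgMin
  have := isProbabilityMeasure_gainLaw hp.cU_mem p.GuMax p.GuMin
  unfold markLaw
  infer_instance

lemma Valid.map_fading_markLaw (hp : p.Valid) (ξ : LinkType) (x : Plane) :
    p.markLaw.map (fun k => fadingOf ξ (x, k)) = gammaMeasure (p.m ξ) (p.m ξ) := by
  have := hp.isProbabilityMeasure_enabledLaw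
  have := isProbabilityMeasure_uniform
  have := isProbabilityMeasure_gamma_nat (hp.m_pos .los)
  have := isProbabilityMeasure_gamma_nat (hp.m_pos .nlos)
  have := isProbabilityMeasure_gainLaw hp.cG_mem p.GgMax p.GgMin
  have := isProbabilityMeasure_gainLaw hp.cU_mem p.GuMax p.GuMin
  have h : ∀ {f : Bool × ℝ × ℝ × ℝ × ℝ × ℝ → ℝ} {g : ℝ × ℝ × ℝ × ℝ → ℝ}, Measurable g →
      f = (fun k => g k.2.2) → p.markLaw.map f = ((gammaMeasure (p.m .los) (p.m .los)).prod
      ((gammaMeasure (p.m .nlos) (p.m .nlos)).prod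
        ((gainLaw p.cG p.GgMax p.GgMin).prod (gainLaw p.cU p.GuMax p.GuMin)))).map g := by
    intro f g hg hf
    have h1 : f = (g ∘ Prod.snd) ∘ Prod.snd := hf
    rw [h1, ← Measure.map_map (hg.comp measurable_snd) measurable_snd, markLaw,
      ← Measure.snd, Measure.snd_prod, ← Measure.map_map hg measurable_snd, ← Measure.snd,
      Measure.snd_prod]
  cases ξ
  · refine (h (g := Prod.fst) measurable_fst rfl).trans ?_
    rw [← Measure.fst, Measure.fst_prod]
  · refine (h (g := Prod.fst ∘ Prod.snd) (measurable_fst.comp measurable_snd) rfl).trans ?_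
    rw [← Measure.map_map measurable_fst measurable_snd, ← Measure.snd, Measure.snd_prod,
      ← Measure.fst, Measure.fst_prod]

lemma Valid.indepFun_fading_keepState (hp : p.Valid) (ξ : LinkType) (x : Plane) :
    IndepFun (fun k => fadingOf ξ (x, k)) keepState p.markLaw := by
  have := hp.isProbabilityMeasure_markLaw
  have := hp.isProbabilityMeasure_enabledLaw
  have := isProbabilityMeasure_uniform
  have := isProbabilityMeasure_gamma_nat (hp.m_pos .los)
  have := isProbabilityMeasure_gamma_nat (hp.m_pos .nlos)
  have := isProbabilityMeasure_gainLaw hp.cG_mem p.GgMax p.GgMin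
  have := isProbabilityMeasure_gainLaw hp.cU_mem p.GuMax p.GuMin
  have h1 : IndepFun (fun k : Mark => k.2) (fun k => k.1) p.markLaw :=
    (indepFun_prod (X := id) (Y := id) measurable_id measurable_id).symm
  have h2 : IndepFun (fun k : Mark => k.2.2) (fun k => k.2.1) p.markLaw := by
    refine indepFun_comp_of_map (M := Prod.snd) measurable_snd (f := Prod.snd) (g := Prod.fst)
      measurable_snd measurable_fst ?_
    rw [markLaw, ← Measure.snd, Measure.snd_prod]
    exact (indepFun_prod (X := id) (Y := id) measurable_id measurable_id).symm
  have h3 : IndepFun (fun k : Mark => k.2.2) (fun k => (k.2.1, k.1)) p.markLaw :=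
    indepFun_prodMk_right (by fun_prop) (by fun_prop) (by fun_prop) h2
      (h1.comp (φ := fun q => (q.2, q.1)) (ψ := id) (by fun_prop) measurable_id)
  have h4 : Measurable fun q : ℝ × Bool => (q.2, q.1, (0 : ℝ), (0 : ℝ), (0 : ℝ), (0 : ℝ)) := by
    fun_prop
  cases ξ
  · exact h3.comp (φ := fun q => q.1) (by fun_prop) h4
  · exact h3.comp (φ := fun q => q.2.1) (by fun_prop) h4

end Params

namespace Network

variable {p : Params} {Ω : Type*} [MeasurableSpace Ω] {P : Measure Ω} (N : Network p P)

/-- The marks of the `j`-th base station. -/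
def mark (j : ℕ) (ω : Ω) : Mark :=
  (N.enabled j ω, N.U j ω, N.fading .los j ω, N.fading .nlos j ω, N.gainG j ω, N.gainU j ω)

/-- The sequence of marked points. -/
def config (ω : Ω) (j : ℕ) : MarkedPoint := (N.X j ω, N.mark j ω)

lemma measurable_mark' (j : ℕ) : Measurable (N.mark j) := N.measurable_mark j

lemma measurable_config : Measurable N.config :=
  measurable_pi_lambda _ fun j => (N.poisson.measurable j).prodMk (N.measurable_mark j)

lemma serving_eq (ω : Ω) : N.serving ω = p.server (N.config ω) := rfl

lemma fading_eq (ξ : LinkType) (j : ℕ) (ω : Ω) : N.fading ξ j ω = fadingOf ξ (N.config ω j) := by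
  cases ξ <;> rfl

lemma interference_eq (ω : Ω) : N.interference ω = p.interferenceOf (N.config ω) := by
  unfold interference Params.interferenceOf Params.powerOf
  simp_rw [fading_eq]
  rfl

lemma fadingThreshold_eq (τ g : ℝ) (ω : Ω) :
    N.fadingThreshold τ g ω = p.thresholdOf τ g (N.config ω) := by
  rw [fadingThreshold, interference_eq]; rfl

lemma measurable_fadingThreshold (τ g : ℝ) : Measurable (N.fadingThreshold τ g) := by
  have : N.fadingThreshold τ g = fun ω => p.thresholdOf τ g (N.config ω) :=
    funext (N.fadingThreshold_eq τ g)
  rw [this]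
  exact (p.measurable_thresholdOf τ g).comp N.measurable_config

lemma measurable_serving : Measurable N.serving := p.measurable_server.comp N.measurable_config

lemma measurableSet_assoc (ξ : LinkType) : MeasurableSet (N.assoc ξ) :=
  (p.measurableSet_state ξ).preimage (p.measurable_serverPoint.comp N.measurable_config)

lemma measurable_servingFading : Measurable N.servingFading := by
  have h : N.servingFading = fun ω =>
      (fun z => fadingOf (p.stateOf z) z) (N.config ω (p.server (N.config ω))) :=
    funext fun ω => N.fading_eq _ _ ω
  rw [h]
  exact (p.measurable_state_dep Params.measurable_fadingOf).comp
    (p.measurable_serverPoint.comp N.measurable_config)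

/-- The fading gain of base station `i` is independent of the configuration without the fading and
antenna gains of `i`. -/
lemma indepFun_fading_erase [IsProbabilityMeasure P] (hp : p.Valid) (ξ : LinkType) (i : ℕ) :
    IndepFun (N.fading ξ i) (fun ω => Params.erase i (N.config ω)) P := by
  have hMi := N.measurable_mark'
  let R : Ω → ℕ → Mark := fun ω j => if j = i then default else N.mark j ω
  have hR : Measurable R := measurable_pi_lambda _ fun j => by
    by_cases hj : j = i
    · simp [R, hj]
    · simpa [R, hj] using hMi j
  have hkeep : Measurable Params.keepState := by unfold Params.keepState; fun_prop
  have hfad : Measurable fun k : Mark => fadingOf ξ ((0 : Plane), k) :=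
    (Params.measurable_fadingOf ξ).comp (by fun_prop)
  have hfad' : N.fading ξ i = fun ω => fadingOf ξ ((0 : Plane), N.mark i ω) := by
    funext ω; cases ξ <;> rfl
  have h1 : IndepFun (fun ω => fadingOf ξ ((0 : Plane), N.mark i ω))
      (fun ω => Params.keepState (N.mark i ω)) P := by
    refine indepFun_comp_of_map (M := N.mark i) (hMi i) hfad hkeep ?_
    have : P.map (N.mark i) = p.markLaw := N.mark_law i
    rw [this]
    exact hp.indepFun_fading_keepState ξ 0
  have h2 : IndepFun (N.mark i) R P := indepFun_others hMi N.mark_indep i default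
  have h3 : IndepFun (fun ω => fadingOf ξ ((0 : Plane), N.mark i ω))
      (fun ω => (Params.keepState (N.mark i ω), R ω)) P :=
    indepFun_prodMk_right (hfad.comp (hMi i)) (hkeep.comp (hMi i)) hR h1
      (h2.comp (φ := fun k => (fadingOf ξ ((0 : Plane), k), Params.keepState k)) (ψ := id)
        (hfad.prodMk hkeep) measurable_id)
  have hX : Measurable fun ω j => N.X j ω := measurable_pi_lambda _ N.poisson.measurable
  have h4 : IndepFun (fun ω => fadingOf ξ ((0 : Plane), N.mark i ω))
      (fun ω => ((Params.keepState (N.mark i ω), R ω), fun j => N.X j ω)) P := by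
    refine indepFun_prodMk_right (hfad.comp (hMi i)) ((hkeep.comp (hMi i)).prodMk hR) hX h3 ?_
    refine N.indep.symm.comp (φ := fun M : ℕ → Mark => (fadingOf ξ ((0 : Plane), M i),
      (Params.keepState (M i), fun j => if j = i then default else M j))) (ψ := id) ?_ measurable_id
    refine (hfad.comp (measurable_pi_apply i)).prodMk
      ((hkeep.comp (measurable_pi_apply i)).prodMk (measurable_pi_lambda _ fun j => ?_))
    by_cases hj : j = i
    · simp [hj]
    · simpa [hj] using measurable_pi_apply j
  rw [hfad']
  have h5 : Measurable fun q : (Mark × (ℕ → Mark)) × (ℕ → Plane) =>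
      (fun j => (q.2 j, if j = i then q.1.1 else q.1.2 j) : ℕ → MarkedPoint) := by
    refine measurable_pi_lambda _ fun j => ?_
    by_cases hj : j = i
    · simp only [hj, if_true]; fun_prop
    · simp only [hj, if_false]; fun_prop
  have h6 := h4.comp (φ := id) measurable_id h5
  have h7 : (fun ω => Params.erase i (N.config ω)) = (fun q : (Mark × (ℕ → Mark)) × (ℕ → Plane) =>
      (fun j => (q.2 j, if j = i then q.1.1 else q.1.2 j) : ℕ → MarkedPoint)) ∘
      (fun ω => ((Params.keepState (N.mark i ω), R ω), fun j => N.X j ω)) := by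
    funext ω j
    by_cases hj : j = i
    · subst hj; simp [Params.erase, config]
    · simp [Params.erase, config, hj, R]
  rw [h7]
  exact h6

lemma map_fading (hp : p.Valid) (ξ : LinkType) (i : ℕ) :
    P.map (N.fading ξ i) = gammaMeasure (p.m ξ) (p.m ξ) := by
  have hfad : Measurable fun k : Mark => fadingOf ξ ((0 : Plane), k) :=
    (Params.measurable_fadingOf ξ).comp (by fun_prop)
  have hfad' : N.fading ξ i = (fun k : Mark => fadingOf ξ ((0 : Plane), k)) ∘ N.mark i := by
    funext ω; cases ξ <;> rfl
  have : P.map (N.mark i) = p.markLaw := N.mark_law i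
  rw [hfad', ← Measure.map_map hfad (N.measurable_mark' i), this, hp.map_fading_markLaw ξ 0]

lemma measurable_fading (ξ : LinkType) (i : ℕ) : Measurable (N.fading ξ i) := by
  have h : N.fading ξ i = fun ω => fadingOf ξ (N.config ω i) := funext fun ω => N.fading_eq ξ i ω
  rw [h]
  exact (Params.measurable_fadingOf ξ).comp ((measurable_pi_apply i).comp N.measurable_config)

lemma measurable_gammaTail {m : ℕ} (hm : 1 ≤ m) : Measurable (gammaTail m) := by
  have := isProbabilityMeasure_gamma_nat hm
  refine Antitone.measurable fun s t hst => ?_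
  exact measureReal_mono (fun h (hh : t ≤ _) => hst.trans hh)

/-- Probability of the event that the serving fading gain exceeds the threshold, on the event that
the serving link is in state `ξ`: the fading gain is integrated out for each possible serving
index. -/
lemma measure_threshold_le_fading [IsProbabilityMeasure P] (hp : p.Valid) (ξ : LinkType)
    (τ g : ℝ) :
    P (N.assoc ξ ∩ {ω | N.fadingThreshold τ g ω ≤ ENNReal.ofReal (N.servingFading ω)})
      = ∫⁻ ω in N.assoc ξ, ENNReal.ofReal (gammaTail (p.m ξ) (N.fadingThreshold τ g ω)) ∂P := by
  have hprob := isProbabilityMeasure_gamma_nat (hp.m_pos ξ)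
  have hT := N.measurable_fadingThreshold τ g
  have hserv : ∀ i, MeasurableSet (N.serving ⁻¹' {i}) := fun i =>
    N.measurable_serving (measurableSet_singleton i)
  have hE : MeasurableSet {ω | N.fadingThreshold τ g ω ≤ ENNReal.ofReal (N.servingFading ω)} :=
    measurableSet_le hT (N.measurable_servingFading.ennreal_ofReal)
  have hsplit : ∀ S : Set Ω, MeasurableSet S → S = ⋃ i, S ∩ N.serving ⁻¹' {i} := by
    intro S _
    ext ω; simp
  have hdisj : ∀ S : Set Ω, Pairwise (fun i j => Disjoint (S ∩ N.serving ⁻¹' {i})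
      (S ∩ N.serving ⁻¹' {j})) := by
    intro S i j hij
    refine (Disjoint.preimage _ ?_).mono inter_subset_right inter_subset_right
    simpa using hij
  have hA := N.measurableSet_assoc ξ
  rw [hsplit _ (hA.inter hE), measure_iUnion (hdisj _) (fun i => (hA.inter hE).inter (hserv i))]
  conv_rhs => rw [hsplit _ hA]
  rw [lintegral_iUnion (fun i => hA.inter (hserv i)) (hdisj _)]
  refine tsum_congr fun i => ?_
  let S : Set (ℕ → MarkedPoint) := {c | p.server c = i} ∩ {c | p.stateOf (c i) = ξ}
  have hS : MeasurableSet S := ((measurableSet_singleton i).preimage p.measurable_server).inter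
    ((p.measurableSet_state ξ).preimage (measurable_pi_apply i))
  let W : Ω → ℕ → MarkedPoint := fun ω => Params.erase i (N.config ω)
  have hind := N.indepFun_fading_erase hp ξ i
  have hW : Measurable W := by
    refine measurable_pi_lambda _ fun j => ?_
    have hc : Measurable fun ω => N.config ω j := (measurable_pi_apply j).comp N.measurable_config
    have hkeep : Measurable Params.keepState := by unfold Params.keepState; fun_prop
    by_cases hj : j = i
    · simp only [W, Params.erase, hj, if_true]
      subst hj
      exact hc.fst.prodMk (hkeep.comp hc.snd)
    · simp only [W, Params.erase, hj, if_false]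
      exact hc.fst.prodMk hc.snd
  have hWS : ∀ ω, W ω ∈ S ↔ ω ∈ N.assoc ξ ∩ N.serving ⁻¹' {i} := by
    intro ω
    simp only [W, S, mem_inter_iff, mem_ofPred_eq, Params.server_erase, Params.stateOf_erase]
    constructor
    · rintro ⟨h1, h2⟩
      exact ⟨by change N.state (N.serving ω) ω = ξ; rw [N.serving_eq, h1]; exact h2, h1⟩
    · rintro ⟨h1, h2⟩
      have h3 : p.server (N.config ω) = i := h2
      refine ⟨h3, ?_⟩
      have h4 : N.state (N.serving ω) ω = ξ := h1
      rwa [N.serving_eq, h3] at h4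
  have hTW : ∀ ω, W ω ∈ S → p.thresholdOf τ g (W ω) = N.fadingThreshold τ g ω := by
    intro ω hω
    rw [N.fadingThreshold_eq]
    exact p.thresholdOf_erase τ g ((hWS ω).1 hω).2
  let B : Set (ℝ × (ℕ → MarkedPoint)) :=
    {q | q.2 ∈ S ∧ p.thresholdOf τ g q.2 ≤ ENNReal.ofReal q.1}
  have hB : MeasurableSet B := (hS.preimage measurable_snd).inter
    (measurableSet_le ((p.measurable_thresholdOf τ g).comp measurable_snd)
      measurable_fst.ennreal_ofReal)
  have hlhs : (N.assoc ξ ∩ {ω | N.fadingThreshold τ g ω ≤ ENNReal.ofReal (N.servingFading ω)})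
      ∩ N.serving ⁻¹' {i} = (fun ω => (N.fading ξ i ω, W ω)) ⁻¹' B := by
    ext ω
    constructor
    · rintro ⟨⟨h1, h2⟩, h3⟩
      have hω : W ω ∈ S := (hWS ω).2 ⟨h1, h3⟩
      refine ⟨hω, ?_⟩
      have h4 : N.state (N.serving ω) ω = ξ := h1
      have h5 : N.serving ω = i := h3
      have h6 : N.servingFading ω = N.fading ξ i ω := by rw [servingFading, h4, h5]
      simp only [hTW ω hω]
      rw [← h6]; exact h2
    · rintro ⟨h1, h2⟩
      have hω := (hWS ω).1 h1
      refine ⟨⟨hω.1, ?_⟩, hω.2⟩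
      have h4 : N.state (N.serving ω) ω = ξ := hω.1
      have h5 : N.serving ω = i := hω.2
      have h6 : N.servingFading ω = N.fading ξ i ω := by rw [servingFading, h4, h5]
      simp only [hTW ω h1] at h2
      change N.fadingThreshold τ g ω ≤ ENNReal.ofReal (N.servingFading ω)
      rw [h6]; exact h2
  rw [hlhs, ← Measure.map_apply ((N.measurable_fading ξ i).prodMk hW) hB,
    hind.map_prod_eq_prod_map_map (N.measurable_fading ξ i).aemeasurable hW.aemeasurable,
    N.map_fading hp]
  have : IsProbabilityMeasure (P.map W) := Measure.isProbabilityMeasure_map hW.aemeasurable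
  rw [Measure.prod_apply_symm hB]
  have hsec : ∀ c, gammaMeasure (p.m ξ) (p.m ξ) ((fun h => (h, c)) ⁻¹' B)
      = S.indicator (fun c => ENNReal.ofReal (gammaTail (p.m ξ) (p.thresholdOf τ g c))) c := by
    intro c
    by_cases hc : c ∈ S
    · rw [indicator_of_mem hc, gammaTail, ofReal_measureReal]
      congr 1
      ext h
      simp [B, hc]
    · rw [indicator_of_notMem hc]
      have : (fun h => (h, c)) ⁻¹' B = ∅ := by ext h; simp [B, hc]
      rw [this, measure_empty]
  simp_rw [hsec]
  have hgm : Measurable fun c => ENNReal.ofReal (gammaTail (p.m ξ) (p.thresholdOf τ g c)) :=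
    ((measurable_gammaTail (hp.m_pos ξ)).comp (p.measurable_thresholdOf τ g)).ennreal_ofReal
  rw [lintegral_map (hgm.indicator hS) hW]
  rw [← lintegral_indicator (hA.inter (hserv i))]
  refine lintegral_congr fun ω => ?_
  by_cases hω : W ω ∈ S
  · rw [indicator_of_mem hω, indicator_of_mem ((hWS ω).1 hω), hTW ω hω]
  · rw [indicator_of_notMem hω, indicator_of_notMem (fun h => hω ((hWS ω).2 h))]

end Network

/-! ### Points of a Poisson process in null sets, sets of infinite measure, and small cells -/

/-- The combination `2 (1 - 2 ⋅ 2⁻ⁿ + 0ⁿ)` of exponentials of the number `n` of points in `D`. It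
vanishes for `n ≤ 1` and is at least `1` for `n ≥ 2`; its mean is at most half the square of the
intensity of `D`. -/
def twoPointBound {Z : Type*} (D : Set Z) (c : ℕ → Z) : ℝ :=
  2 * (1 - 2 * expNeg (∑' j, D.indicator (fun _ => ENNReal.ofReal (Real.log 2)) (c j))
    + expNeg (∑' j, D.indicator (fun _ => ∞) (c j)))

lemma expNeg_log_two : expNeg (ENNReal.ofReal (Real.log 2)) = 1 / 2 := by
  rw [expNeg_ofReal (Real.log_nonneg (by norm_num)), Real.exp_neg, Real.exp_log (by norm_num)]
  norm_num

lemma twoPointBound_nonneg {Z : Type*} (D : Set Z) (c : ℕ → Z) : 0 ≤ twoPointBound D c := by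
  unfold twoPointBound
  by_cases h : ∃ j, c j ∈ D
  · obtain ⟨j, hj⟩ := h
    have h1 : ENNReal.ofReal (Real.log 2)
        ≤ ∑' j, D.indicator (fun _ => ENNReal.ofReal (Real.log 2)) (c j) := by
      refine le_trans ?_ (ENNReal.le_tsum j)
      simp [hj]
    have h2 := antitone_expNeg h1
    rw [expNeg_log_two] at h2
    have h3 := expNeg_nonneg (∑' j, D.indicator (fun _ => ∞) (c j))
    linarith
  · push Not at h
    simp [h, expNeg_zero]
    norm_num

lemma one_le_twoPointBound {Z : Type*} {D : Set Z} {c : ℕ → Z} {i j : ℕ} (hij : i ≠ j)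
    (hi : c i ∈ D) (hj : c j ∈ D) : 1 ≤ twoPointBound D c := by
  unfold twoPointBound
  have h1 : ENNReal.ofReal (Real.log 2) + ENNReal.ofReal (Real.log 2)
      ≤ ∑' j, D.indicator (fun _ => ENNReal.ofReal (Real.log 2)) (c j) := by
    refine le_trans ?_ (ENNReal.sum_le_tsum {i, j})
    rw [Finset.sum_pair hij]
    simp [hi, hj]
  have h2 := antitone_expNeg h1
  rw [expNeg_add, expNeg_log_two] at h2
  have h3 := expNeg_nonneg (∑' j, D.indicator (fun _ => ∞) (c j))
  linarith

lemma twoPointBound_le {Z : Type*} (D : Set Z) (c : ℕ → Z) : twoPointBound D c ≤ 4 := by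
  unfold twoPointBound
  have h1 := expNeg_nonneg (∑' j, D.indicator (fun _ => ENNReal.ofReal (Real.log 2)) (c j))
  have h2 := expNeg_le_one (∑' j, D.indicator (fun _ => ∞) (c j))
  linarith

section Cells

variable {Ω Z : Type*} [MeasurableSpace Ω] [MeasurableSpace Z] {P : Measure Ω}
  {Y : ℕ → Ω → Z} {Λ : Measure Z}

lemma lintegral_oneSub_indicator {B : Set Z} (hB : MeasurableSet B) (c : ℝ≥0∞) :
    ∫⁻ z, oneSubExpNeg (B.indicator (fun _ => c) z) ∂Λ = oneSubExpNeg c * Λ B := by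
  have : ∀ z, oneSubExpNeg (B.indicator (fun _ => c) z)
      = B.indicator (fun _ => oneSubExpNeg c) z := by
    intro z
    by_cases hz : z ∈ B <;> simp [hz, oneSubExpNeg_zero]
  simp_rw [this]
  rw [lintegral_indicator_const hB]

lemma HasPoissonLaplace.integral_const_add (h : HasPoissonLaplace Y Λ P) {f : Z → ℝ≥0∞}
    (hf : Measurable f) (k : ℝ≥0∞) :
    ∫ ω, expNeg (k + ∑' j, f (Y j ω)) ∂P = expNeg (k + ∫⁻ z, oneSubExpNeg (f z) ∂Λ) := by
  simp_rw [expNeg_add]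
  rw [integral_const_mul, h f hf]

lemma HasPoissonLaplace.integral_indicator (h : HasPoissonLaplace Y Λ P) {B : Set Z}
    (hB : MeasurableSet B) (c : ℝ≥0∞) :
    ∫ ω, expNeg (∑' j, B.indicator (fun _ => c) (Y j ω)) ∂P
      = expNeg (oneSubExpNeg c * Λ B) := by
  rw [h _ (measurable_const.indicator hB), lintegral_oneSub_indicator hB]

lemma HasPoissonLaplace.ae_exists_mem [IsProbabilityMeasure P] (h : HasPoissonLaplace Y Λ P)
    (hY : ∀ j, Measurable (Y j)) {B : Set Z} (hB : MeasurableSet B) (hΛ : Λ B = ∞) :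
    ∀ᵐ ω ∂P, ∃ j, Y j ω ∈ B := by
  have h1 := h.integral_indicator hB ∞
  rw [oneSubExpNeg_top, one_mul, hΛ, expNeg_top] at h1
  have hm : Measurable fun ω => ∑' j, B.indicator (fun _ => (∞ : ℝ≥0∞)) (Y j ω) :=
    measurable_tsum_ennreal fun j => (measurable_const.indicator hB).comp (hY j)
  rw [integral_eq_zero_iff_of_nonneg (fun _ => expNeg_nonneg _) (integrable_expNeg hm)] at h1
  filter_upwards [h1] with ω hω
  by_contra hn
  push Not at hn
  simp [hn, expNeg_zero] at hω

lemma HasPoissonLaplace.ae_forall_notMem [IsProbabilityMeasure P] (h : HasPoissonLaplace Y Λ P)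
    (hY : ∀ j, Measurable (Y j)) {B : Set Z} (hB : MeasurableSet B) (hΛ : Λ B = 0) :
    ∀ᵐ ω ∂P, ∀ j, Y j ω ∉ B := by
  have h1 := h.integral_indicator hB ∞
  rw [hΛ, mul_zero, expNeg_zero] at h1
  have hm : Measurable fun ω => ∑' j, B.indicator (fun _ => (∞ : ℝ≥0∞)) (Y j ω) :=
    measurable_tsum_ennreal fun j => (measurable_const.indicator hB).comp (hY j)
  have h2 : ∫ ω, (1 - expNeg (∑' j, B.indicator (fun _ => (∞ : ℝ≥0∞)) (Y j ω))) ∂P = 0 := by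
    rw [integral_sub (integrable_const _) (integrable_expNeg hm), h1]; simp
  have h4 : Integrable
      (fun ω => 1 - expNeg (∑' j, B.indicator (fun _ => (∞ : ℝ≥0∞)) (Y j ω))) P :=
    (integrable_const _).sub (integrable_expNeg hm)
  rw [integral_eq_zero_iff_of_nonneg (fun _ => by simpa using expNeg_le_one _) h4] at h2
  filter_upwards [h2] with ω hω j hj
  have h3 : ∑' j, B.indicator (fun _ => (∞ : ℝ≥0∞)) (Y j ω) = ∞ :=
    ENNReal.tsum_eq_top_of_eq_top ⟨j, by simp [hj]⟩
  simp [h3, expNeg_top] at hω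

/-- Mean of `exp (-∑ f)` on the event that some point falls into `B`, where `f` vanishes on `B`. -/
lemma HasPoissonLaplace.integral_hit [IsProbabilityMeasure P] (h : HasPoissonLaplace Y Λ P)
    (hY : ∀ j, Measurable (Y j)) {B : Set Z} (hB : MeasurableSet B) {f : Z → ℝ≥0∞}
    (hf : Measurable f) (hfB : ∀ z ∈ B, f z = 0) (k : ℝ≥0∞) :
    ∫ ω, (1 - expNeg (∑' j, B.indicator (fun _ => ∞) (Y j ω)))
        * expNeg (k + ∑' j, f (Y j ω)) ∂P
      = (1 - expNeg (Λ B)) * expNeg (k + ∫⁻ z, oneSubExpNeg (f z) ∂Λ) := by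
  have hBm : Measurable (B.indicator fun _ => (∞ : ℝ≥0∞)) := measurable_const.indicator hB
  have hadd : ∀ ω, (1 - expNeg (∑' j, B.indicator (fun _ => ∞) (Y j ω)))
        * expNeg (k + ∑' j, f (Y j ω))
      = expNeg (k + ∑' j, f (Y j ω))
        - expNeg (k + ∑' j, (f + B.indicator fun _ => ∞) (Y j ω)) := by
    intro ω
    simp only [Pi.add_apply]
    rw [ENNReal.tsum_add, ← add_assoc, expNeg_add (k + _)]
    ring
  have hint : ∫⁻ z, oneSubExpNeg ((f + B.indicator fun _ => ∞) z) ∂Λ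
      = ∫⁻ z, oneSubExpNeg (f z) ∂Λ + Λ B := by
    have h1 : ∀ z, oneSubExpNeg ((f + B.indicator fun _ => ∞) z)
        = oneSubExpNeg (f z) + oneSubExpNeg (B.indicator (fun _ => ∞) z) := by
      intro z
      by_cases hz : z ∈ B <;> simp [hz, hfB, oneSubExpNeg_zero]
    simp_rw [h1]
    have h2 : Measurable fun z => oneSubExpNeg (f z) := measurable_oneSubExpNeg.comp hf
    rw [lintegral_add_left h2, lintegral_oneSub_indicator hB,
      oneSubExpNeg_top, one_mul]
  have hm1 : Measurable fun ω => k + ∑' j, f (Y j ω) :=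
    (measurable_tsum_ennreal fun j => hf.comp (hY j)).const_add k
  have hm2 : Measurable fun ω => k + ∑' j, (f + B.indicator fun _ => ∞) (Y j ω) :=
    (measurable_tsum_ennreal fun j => (hf.add hBm).comp (hY j)).const_add k
  simp_rw [hadd]
  rw [integral_sub (integrable_expNeg hm1) (integrable_expNeg hm2), h.integral_const_add hf,
    h.integral_const_add (hf.add hBm), hint, ← add_assoc, expNeg_add (k + _)]
  ring

lemma integrable_hit [IsProbabilityMeasure P] (hY : ∀ j, Measurable (Y j)) {B : Set Z}
    (hB : MeasurableSet B) {f : Z → ℝ≥0∞} (hf : Measurable f) (k : ℝ≥0∞) :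
    Integrable (fun ω => (1 - expNeg (∑' j, B.indicator (fun _ => ∞) (Y j ω)))
      * expNeg (k + ∑' j, f (Y j ω))) P := by
  have hm1 : Measurable fun ω => ∑' j, B.indicator (fun _ => (∞ : ℝ≥0∞)) (Y j ω) :=
    measurable_tsum_ennreal fun j => (measurable_const.indicator hB).comp (hY j)
  have hm2 : Measurable fun ω => k + ∑' j, f (Y j ω) :=
    (measurable_tsum_ennreal fun j => hf.comp (hY j)).const_add k
  refine integrable_of_mem_unit (by fun_prop) (fun ω => ?_) (fun ω => ?_)
  · exact mul_nonneg (sub_nonneg.2 (expNeg_le_one _)) (expNeg_nonneg _)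
  · exact mul_le_one₀ (sub_le_self _ (expNeg_nonneg _)) (expNeg_nonneg _) (expNeg_le_one _)

lemma measurable_twoPointBound (hY : ∀ j, Measurable (Y j)) {D : Set Z} (hD : MeasurableSet D) :
    Measurable fun ω => twoPointBound D (fun j => Y j ω) := by
  have hm : ∀ c : ℝ≥0∞, Measurable fun ω => ∑' j, D.indicator (fun _ => c) (Y j ω) := fun c =>
    measurable_tsum_ennreal fun j => (measurable_const.indicator hD).comp (hY j)
  have h1 := hm ∞
  have h2 := hm (ENNReal.ofReal (Real.log 2))
  unfold twoPointBound
  fun_prop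

lemma integrable_twoPointBound [IsProbabilityMeasure P] (hY : ∀ j, Measurable (Y j)) {D : Set Z}
    (hD : MeasurableSet D) : Integrable (fun ω => twoPointBound D (fun j => Y j ω)) P :=
  Integrable.of_bound (measurable_twoPointBound hY hD).aestronglyMeasurable 4
    (Eventually.of_forall fun ω => by
      rw [Real.norm_of_nonneg (twoPointBound_nonneg _ _)]; exact twoPointBound_le _ _)

lemma HasPoissonLaplace.integral_twoPointBound_le [IsProbabilityMeasure P]
    (h : HasPoissonLaplace Y Λ P) (hY : ∀ j, Measurable (Y j)) {D : Set Z} (hD : MeasurableSet D)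
    (hΛ : Λ D ≠ ∞) :
    ∫ ω, twoPointBound D (fun j => Y j ω) ∂P ≤ (Λ D).toReal ^ 2 / 2 := by
  have hm : ∀ c : ℝ≥0∞, Measurable fun ω => ∑' j, D.indicator (fun _ => c) (Y j ω) := fun c =>
    measurable_tsum_ennreal fun j => (measurable_const.indicator hD).comp (hY j)
  have hi := fun c => integrable_expNeg (P := P) (hm c)
  have hs : Integrable (fun ω => 1 - 2 * expNeg (∑' j,
      D.indicator (fun _ => ENNReal.ofReal (Real.log 2)) (Y j ω))) P :=
    (integrable_const _).sub ((hi _).const_mul _)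
  unfold twoPointBound
  rw [integral_const_mul, integral_add hs (hi _),
    integral_sub (integrable_const _) ((hi _).const_mul _),
    integral_const_mul, h.integral_indicator hD, h.integral_indicator hD, oneSubExpNeg_top, one_mul,
    oneSubExpNeg, expNeg_log_two]
  set x := (Λ D).toReal with hx
  have hx0 : 0 ≤ x := ENNReal.toReal_nonneg
  have h1 : expNeg (Λ D) = Real.exp (-x) := expNeg_of_ne_top hΛ
  have h2 : expNeg (ENNReal.ofReal (1 - 1 / 2) * Λ D) = Real.exp (-(x / 2)) := by
    rw [expNeg_of_ne_top (ENNReal.mul_ne_top ENNReal.ofReal_ne_top hΛ), ENNReal.toReal_mul,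
      ENNReal.toReal_ofReal (by norm_num)]
    congr 1
    rw [← hx]; ring
  have h3 : Real.exp (-x) = Real.exp (-(x / 2)) ^ 2 := by
    rw [← Real.exp_nat_mul]; congr 1; push_cast; ring
  rw [h1, h2, h3]
  simp only [integral_const, probReal_univ, smul_eq_mul, mul_one]
  have h4 := Real.add_one_le_exp (-(x / 2))
  have h5 : Real.exp (-(x / 2)) ≤ 1 := Real.exp_le_one_iff.2 (by linarith)
  nlinarith

end Cells

/-! ### Existence of a serving base station -/

namespace Params

variable (p : Params)

/-- Intensity measure of the marked base stations. -/
def intensity : Measure MarkedPoint := (ENNReal.ofReal p.lamG • volume).prod p.markLaw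

variable {p}

lemma Valid.pathGain_pos (hp : p.Valid) (ξ : LinkType) {s : ℝ} (hs : 0 < s) :
    0 < p.pathGain ξ s := by
  have := hp.C_pos ξ
  unfold pathGain
  positivity

lemma Valid.tendsto_pathGain (hp : p.Valid) (ξ : LinkType) :
    Tendsto (p.pathGain ξ) atTop (𝓝 0) := by
  have h1 : Tendsto (fun s : ℝ => s ^ 2 + p.dh ^ 2) atTop atTop :=
    tendsto_atTop_add_const_right _ _ (tendsto_pow_atTop two_ne_zero)
  have h2 := (tendsto_rpow_neg_atTop (half_pos (hp.eta_pos ξ))).comp h1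
  have h3 := h2.const_mul (p.C ξ)
  rw [mul_zero] at h3
  refine h3.congr fun s => ?_
  simp [pathGain, neg_div]

lemma markLaw_enabled (hp : p.Valid) :
    p.markLaw {k | k.1 = true} = ENNReal.ofReal p.deltaB := by
  have := isProbabilityMeasure_uniform
  have := isProbabilityMeasure_gamma_nat (hp.m_pos .los)
  have := isProbabilityMeasure_gamma_nat (hp.m_pos .nlos)
  have := isProbabilityMeasure_gainLaw hp.cG_mem p.GgMax p.GgMin
  have := isProbabilityMeasure_gainLaw hp.cU_mem p.GuMax p.GuMin
  have h : {k : Mark | k.1 = true} = ({true} : Set Bool) ×ˢ univ := by ext k; simp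
  rw [h, markLaw, Measure.prod_prod]
  simp [enabledLaw]

end Params

namespace Network

variable {p : Params} {Ω : Type*} [MeasurableSpace Ω] {P : Measure Ω} (N : Network p P)

lemma measurable_config_apply (j : ℕ) : Measurable fun ω => N.config ω j :=
  (measurable_pi_apply j).comp N.measurable_config

lemma ae_finite_ball (R : ℝ) : ∀ᵐ ω ∂P, {j | N.dist j ω ≤ R}.Finite := by
  have hfin : (ENNReal.ofReal p.lamG • (volume : Measure Plane)) (Metric.closedBall 0 R) < ∞ := by
    rw [Measure.smul_apply, smul_eq_mul]
    exact ENNReal.mul_lt_top ENNReal.ofReal_lt_top measure_closedBall_lt_top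
  have hm := N.poisson.measurable_pointCount (B := Metric.closedBall 0 R) measurableSet_closedBall
  have h1 := N.poisson.law _ measurableSet_closedBall hfin
  have h2 : P (pointCount N.X (Metric.closedBall 0 R) ⁻¹' {⊤}) = 0 := by
    rw [← Measure.map_apply hm (measurableSet_singleton _), h1,
      Measure.map_apply (measurable_of_countable _) (measurableSet_singleton _)]
    have : (fun n : ℕ => (n : ℕ∞)) ⁻¹' {⊤} = ∅ := by ext n; simp
    rw [this, measure_empty]
  have h3 : ∀ᵐ ω ∂P, pointCount N.X (Metric.closedBall 0 R) ω ≠ ⊤ := by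
    rw [ae_iff]
    convert h2 using 2
    ext ω; simp
  filter_upwards [h3] with ω hω
  have : {j | N.dist j ω ≤ R} = {i : ℕ | N.X i ω ∈ Metric.closedBall 0 R} := by
    ext j; simp [dist]
  rw [this]
  exact encard_ne_top_iff.1 hω

variable [IsProbabilityMeasure P]

/-- The marked base stations form a Poisson process. -/
lemma hasPoissonLaplace (hp : p.Valid) :
    HasPoissonLaplace (fun j ω => N.config ω j) p.intensity P := by
  have := hp.isProbabilityMeasure_markLaw
  have : SigmaFinite (ENNReal.ofReal p.lamG • (volume : Measure Plane)) := by
    exact SMul.sigmaFinite p.lamG.toNNReal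
  exact N.poisson.hasPoissonLaplace.marked N.poisson.measurable N.measurable_mark N.mark_law
    N.mark_indep N.indep

lemma ae_dist_pos (hp : p.Valid) : ∀ᵐ ω ∂P, ∀ j, 0 < N.dist j ω := by
  have := hp.isProbabilityMeasure_markLaw
  have h := (N.hasPoissonLaplace hp).ae_forall_notMem N.measurable_config_apply
    (B := ({0} : Set Plane) ×ˢ (univ : Set Mark))
    ((measurableSet_singleton _).prod MeasurableSet.univ) (by
      rw [Params.intensity, Measure.prod_prod]; simp)
  filter_upwards [h] with ω hω j
  have := hω j
  simp only [mem_prod, mem_singleton_iff, mem_univ, and_true] at this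
  exact norm_pos_iff.2 this

/-- Almost surely some enabled base station has maximal path gain: there are enabled ones, and only
finitely many stations are as good as a given one, since the path gain vanishes at infinity. -/
lemma ae_isServer (hp : p.Valid) :
    ∀ᵐ ω ∂P, p.IsServer (N.config ω) (N.serving ω) := by
  have := hp.isProbabilityMeasure_markLaw
  have hen := (N.hasPoissonLaplace hp).ae_exists_mem N.measurable_config_apply
    (B := (univ : Set Plane) ×ˢ {k : Mark | k.1 = true})
    (MeasurableSet.univ.prod ((measurableSet_singleton true).preimage measurable_fst)) (by
      rw [Params.intensity, Measure.prod_prod, Params.markLaw_enabled hp]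
      have h1 := hp.lamG_pos
      have h2 := hp.deltaB_pos
      have h3 : (volume : Measure Plane) univ = ∞ := by simp
      rw [Measure.smul_apply, h3, smul_eq_mul, ENNReal.mul_top (by simpa using h1),
        ENNReal.top_mul (by simpa using h2)])
  have hfin : ∀ᵐ ω ∂P, ∀ n : ℕ, {j | N.dist j ω ≤ n}.Finite :=
    ae_all_iff.2 fun n => N.ae_finite_ball n
  filter_upwards [hen, hfin, N.ae_dist_pos hp] with ω ⟨j₀, hj₀⟩ hfin hpos
  have hj₀' : N.enabled j₀ ω = true := hj₀.2
  have hg₀ : 0 < N.gain j₀ ω := hp.pathGain_pos _ (hpos j₀)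
  obtain ⟨R₁, hR₁⟩ := eventually_atTop.1
    ((hp.tendsto_pathGain .los).eventually (gt_mem_nhds hg₀))
  obtain ⟨R₂, hR₂⟩ := eventually_atTop.1
    ((hp.tendsto_pathGain .nlos).eventually (gt_mem_nhds hg₀))
  obtain ⟨n, hn⟩ := exists_nat_ge (max R₁ R₂)
  have hS : {j | N.enabled j ω = true ∧ N.gain j₀ ω ≤ N.gain j ω}.Finite := by
    refine (hfin n).subset fun j hj => ?_
    by_contra hnj
    have hnj' : (n : ℝ) < N.dist j ω := not_le.1 hnj
    have h1 : N.gain j ω < N.gain j₀ ω := by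
      have h2 : ∀ ξ, p.pathGain ξ (N.dist j ω) < N.gain j₀ ω := by
        intro ξ
        cases ξ
        · exact hR₁ _ ((le_max_left _ _).trans (hn.trans hnj'.le))
        · exact hR₂ _ ((le_max_right _ _).trans (hn.trans hnj'.le))
      exact h2 _
    exact absurd hj.2 (not_le.2 h1)
  obtain ⟨i, hi, hmax⟩ := exists_max_image _ (fun j => N.gain j ω) hS ⟨j₀, hj₀', le_rfl⟩
  have hserver : p.IsServer (N.config ω) i := by
    refine ⟨hi.1, fun j hj => ?_⟩
    by_cases hle : N.gain j₀ ω ≤ N.gain j ω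
    · exact hmax j ⟨hj, hle⟩
    · exact (not_le.1 hle).le.trans hi.2
  exact Nat.sInf_mem (s := {i | p.IsServer (N.config ω) i}) ⟨i, hserver⟩

end Network

/-! ### Integration against the intensity of the marked base stations -/

namespace Params

variable {p : Params}

lemma Valid.kappa_mem (hp : p.Valid) (ξ : LinkType) {r : ℝ} (hr : 0 < r) :
    0 ≤ p.kappa ξ r ∧ p.kappa ξ r ≤ 1 := by
  have h0 := hp.kappa_nonneg r hr
  have h1 := hp.kappa_le_one r hr
  cases ξ
  · exact ⟨h0, h1⟩
  · change 0 ≤ 1 - p.kappa .los r ∧ 1 - p.kappa .los r ≤ 1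
    constructor <;> linarith

lemma Valid.lamB_pos (hp : p.Valid) : 0 < p.lamB := mul_pos hp.deltaB_pos hp.lamG_pos

lemma Valid.prob_nonneg (hp : p.Valid) (k : Fin 4) : 0 ≤ p.prob k := by
  have h1 := hp.cG_mem
  have h2 := hp.cU_mem
  have h3 : 0 ≤ 1 - p.cG := by linarith
  have h4 : 0 ≤ 1 - p.cU := by linarith
  fin_cases k
  · exact mul_nonneg h1.1 h2.1
  · exact mul_nonneg h1.1 h4
  · exact mul_nonneg h3 h2.1
  · exact mul_nonneg h3 h4

lemma Valid.sum_prob (hp : p.Valid) : ∑ k, ENNReal.ofReal (p.prob k) = 1 := by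
  rw [← ENNReal.ofReal_sum_of_nonneg fun k _ => hp.prob_nonneg k]
  simp only [prob, Fin.sum_univ_four]
  simp
  ring

lemma lintegral_gainLaw (c x y : ℝ) {f : ℝ → ℝ≥0∞} (hf : Measurable f) :
    ∫⁻ t, f t ∂(gainLaw c x y) = ENNReal.ofReal c * f x + ENNReal.ofReal (1 - c) * f y := by
  rw [gainLaw, lintegral_add_measure, lintegral_smul_measure, lintegral_smul_measure,
    lintegral_dirac' _ hf, lintegral_dirac' _ hf]
  rfl

/-- Mean over the directivity gain of an interfering link. -/
lemma Valid.lintegral_gains (hp : p.Valid) {f : ℝ → ℝ≥0∞} (hf : Measurable f) :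
    ∫⁻ q : ℝ × ℝ, f (q.1 * q.2)
        ∂((gainLaw p.cG p.GgMax p.GgMin).prod (gainLaw p.cU p.GuMax p.GuMin))
      = ∑ k, ENNReal.ofReal (p.prob k) * f (p.G k) := by
  have := isProbabilityMeasure_gainLaw hp.cG_mem p.GgMax p.GgMin
  have := isProbabilityMeasure_gainLaw hp.cU_mem p.GuMax p.GuMin
  have h1 := hp.cG_mem
  have h2 := hp.cU_mem
  have h3 : 0 ≤ 1 - p.cG := by linarith
  have hq : Measurable fun q : ℝ × ℝ => f (q.1 * q.2) := hf.comp (by fun_prop)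
  rw [lintegral_prod _ hq.aemeasurable]
  have hin : ∀ x, ∫⁻ y, f (x * y) ∂(gainLaw p.cU p.GuMax p.GuMin)
      = ENNReal.ofReal p.cU * f (x * p.GuMax) + ENNReal.ofReal (1 - p.cU) * f (x * p.GuMin) :=
    fun x => lintegral_gainLaw _ _ _ (hf.comp (by fun_prop : Measurable fun y : ℝ => x * y))
  simp_rw [hin]
  have hm : Measurable fun x => ENNReal.ofReal p.cU * f (x * p.GuMax)
      + ENNReal.ofReal (1 - p.cU) * f (x * p.GuMin) := by
    have hc : ∀ c, Measurable fun x : ℝ => f (x * c) := fun c => hf.comp (by fun_prop)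
    exact ((hc _).const_mul _).add ((hc _).const_mul _)
  rw [lintegral_gainLaw _ _ _ hm]
  simp only [prob, G, Fin.sum_univ_four]
  simp only [Matrix.cons_val_zero, Matrix.cons_val_one, Matrix.cons_val]
  rw [ENNReal.ofReal_mul h1.1, ENNReal.ofReal_mul h1.1, ENNReal.ofReal_mul h3,
    ENNReal.ofReal_mul h3]
  ring

lemma lintegral_uniform_ite {κ : ℝ} (h0 : 0 ≤ κ) (h1 : κ ≤ 1) (a b : ℝ≥0∞) :
    ∫⁻ u in Icc (0 : ℝ) 1, (if u ≤ κ then a else b)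
      = ENNReal.ofReal κ * a + ENNReal.ofReal (1 - κ) * b := by
  have h : ∀ u, (if u ≤ κ then a else b)
      = (Iic κ).indicator (fun _ => a) u + (Ioi κ).indicator (fun _ => b) u := by
    intro u
    by_cases hu : u ≤ κ
    · simp [hu]
    · simp [hu, not_le.1 hu]
  simp_rw [h]
  rw [lintegral_add_left (measurable_const.indicator measurableSet_Iic),
    lintegral_indicator_const measurableSet_Iic, lintegral_indicator_const measurableSet_Ioi,
    Measure.restrict_apply measurableSet_Iic, Measure.restrict_apply measurableSet_Ioi]
  have e1 : Iic κ ∩ Icc 0 1 = Icc 0 κ := by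
    ext u
    simp only [mem_inter_iff, mem_Iic, mem_Icc]
    constructor
    · rintro ⟨h2, h3, _⟩; exact ⟨h3, h2⟩
    · rintro ⟨h2, h3⟩; exact ⟨h3, h2, h3.trans h1⟩
  have e2 : Ioi κ ∩ Icc 0 1 = Ioc κ 1 := by
    ext u
    simp only [mem_inter_iff, mem_Ioi, mem_Icc, mem_Ioc]
    constructor
    · rintro ⟨h2, _, h3⟩; exact ⟨h2, h3⟩
    · rintro ⟨h2, h3⟩; exact ⟨h2, h0.trans h2.le, h3⟩
  rw [e1, e2, Real.volume_Icc, Real.volume_Ioc, sub_zero]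
  ring

/-- Contribution of the links in state `ξ` to an integral against the intensity, in polar
coordinates and up to the factor `2 π lamB`. -/
def radialIntegral (p : Params) (ξ : LinkType) (φ : ℝ → ℝ → ℝ → ℝ≥0∞) : ℝ≥0∞ :=
  ∫⁻ r in Ioi (0 : ℝ), ENNReal.ofReal (p.kappa ξ r * r) *
    ∑ k, ENNReal.ofReal (p.prob k) * ∫⁻ h, φ r h (p.G k) ∂(gammaMeasure (p.m ξ) (p.m ξ))

/-- Integral against the intensity of a function of the state, the length, the fading gain and the
directivity gain of the enabled links. -/
lemma Valid.lintegral_intensity (hp : p.Valid) {φ : LinkType → ℝ → ℝ → ℝ → ℝ≥0∞}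
    (hφ : ∀ ξ, Measurable fun q : ℝ × ℝ × ℝ => φ ξ q.1 q.2.1 q.2.2) :
    ∫⁻ z : MarkedPoint, (if z.2.1 = true then φ (p.stateOf z) ‖z.1‖ (fadingOf (p.stateOf z) z)
        (z.2.2.2.2.2.1 * z.2.2.2.2.2.2) else 0) ∂p.intensity
      = ENNReal.ofReal (2 * Real.pi * p.lamB)
        * (p.radialIntegral .los (φ .los) + p.radialIntegral .nlos (φ .nlos)) := by
  classical
  have := hp.isProbabilityMeasure_markLaw
  have := hp.isProbabilityMeasure_enabledLaw
  have := isProbabilityMeasure_uniform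
  have := isProbabilityMeasure_gamma_nat (hp.m_pos .los)
  have := isProbabilityMeasure_gamma_nat (hp.m_pos .nlos)
  have := isProbabilityMeasure_gainLaw hp.cG_mem p.GgMax p.GgMin
  have := isProbabilityMeasure_gainLaw hp.cU_mem p.GuMax p.GuMin
  -- the integrand as a function of the distance and the marks
  let F : ℝ × Mark → ℝ≥0∞ := fun q => if q.2.1 = true then
    (if q.2.2.1 ≤ p.kappa .los q.1 then φ .los q.1 q.2.2.2.1 (q.2.2.2.2.2.1 * q.2.2.2.2.2.2)
      else φ .nlos q.1 q.2.2.2.2.1 (q.2.2.2.2.2.1 * q.2.2.2.2.2.2)) else 0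
  have hFm : Measurable F := by
    refine Measurable.ite ((measurableSet_singleton true).preimage
      (by fun_prop : Measurable fun q : ℝ × Mark => q.2.1)) (Measurable.ite ?_ ?_ ?_)
      measurable_const
    · exact measurableSet_le (by fun_prop) ((p.measurable_kappa _).comp measurable_fst)
    · exact (hφ .los).comp (by fun_prop : Measurable fun q : ℝ × Mark =>
        (q.1, q.2.2.2.1, q.2.2.2.2.2.1 * q.2.2.2.2.2.2))
    · exact (hφ .nlos).comp (by fun_prop : Measurable fun q : ℝ × Mark =>
        (q.1, q.2.2.2.2.1, q.2.2.2.2.2.1 * q.2.2.2.2.2.2))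
  have hF : ∀ z : MarkedPoint, (if z.2.1 = true then φ (p.stateOf z) ‖z.1‖
      (fadingOf (p.stateOf z) z) (z.2.2.2.2.2.1 * z.2.2.2.2.2.2) else 0) = F (‖z.1‖, z.2) := by
    intro z
    simp only [F, stateOf]
    split_ifs <;> rfl
  simp_rw [hF]
  have hFn : Measurable fun z : MarkedPoint => F (‖z.1‖, z.2) := hFm.comp (by fun_prop)
  have hin : Measurable fun r => ∫⁻ k, F (r, k) ∂p.markLaw := hFm.lintegral_prod_right'
  rw [intensity, lintegral_prod _ hFn.aemeasurable, lintegral_smul_measure,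
    lintegral_norm_plane (f := fun r => ∫⁻ k, F (r, k) ∂p.markLaw) hin]
  -- integration over the marks at a fixed distance
  let K : LinkType → ℝ → ℝ≥0∞ := fun ξ r =>
    ∑ k, ENNReal.ofReal (p.prob k) * ∫⁻ h, φ ξ r h (p.G k) ∂(gammaMeasure (p.m ξ) (p.m ξ))
  have hφh : ∀ ξ r G, Measurable fun h => φ ξ r h G := fun ξ r G =>
    (hφ ξ).comp (by fun_prop : Measurable fun h : ℝ => (r, h, G))
  have hφG : ∀ ξ r h, Measurable fun G => φ ξ r h G := fun ξ r h =>
    (hφ ξ).comp (by fun_prop : Measurable fun G : ℝ => (r, h, G))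
  have hKm : ∀ ξ, Measurable (K ξ) := fun ξ => by
    have := isProbabilityMeasure_gamma_nat (hp.m_pos ξ)
    refine Finset.measurable_sum _ fun k _ => Measurable.const_mul ?_ _
    exact ((hφ ξ).comp (by fun_prop : Measurable fun q : ℝ × ℝ =>
      (q.1, q.2, p.G k))).lintegral_prod_right'
  have hgain : ∀ ξ r, ∫⁻ h, ∫⁻ q : ℝ × ℝ, φ ξ r h (q.1 * q.2)
        ∂((gainLaw p.cG p.GgMax p.GgMin).prod (gainLaw p.cU p.GuMax p.GuMin))
        ∂(gammaMeasure (p.m ξ) (p.m ξ)) = K ξ r := by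
    intro ξ r
    simp_rw [fun h => hp.lintegral_gains (hφG ξ r h)]
    rw [lintegral_finsetSum _ (fun k _ => (hφh ξ r _).const_mul _)]
    exact Finset.sum_congr rfl fun k _ => lintegral_const_mul _ (hφh ξ r _)
  have hmark : ∀ r, 0 < r → ∫⁻ k, F (r, k) ∂p.markLaw = ENNReal.ofReal p.deltaB *
      (ENNReal.ofReal (p.kappa .los r) * K .los r
        + ENNReal.ofReal (p.kappa .nlos r) * K .nlos r) := by
    intro r hr
    have hFr : Measurable fun k => F (r, k) := hFm.comp (by fun_prop)
    rw [markLaw, lintegral_prod _ hFr.aemeasurable, enabledLaw, lintegral_add_measure,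
      lintegral_smul_measure, lintegral_smul_measure,
      lintegral_dirac, lintegral_dirac]
    have hfalse : ∀ q, F (r, false, q) = 0 := fun q => by simp [F]
    have hFt : Measurable fun q => F (r, true, q) :=
      hFm.comp (by fun_prop : Measurable fun q : ℝ × ℝ × ℝ × ℝ × ℝ => (r, true, q))
    simp only [hfalse, lintegral_zero, mul_zero, add_zero, smul_eq_mul]
    rw [lintegral_prod _ hFt.aemeasurable]
    congr 1
    have hu : ∀ u : ℝ, ∫⁻ q : ℝ × ℝ × ℝ × ℝ, F (r, true, u, q)
          ∂((gammaMeasure (p.m .los) (p.m .los)).prod ((gammaMeasure (p.m .nlos) (p.m .nlos)).prod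
        ((gainLaw p.cG p.GgMax p.GgMin).prod (gainLaw p.cU p.GuMax p.GuMin))))
        = if u ≤ p.kappa .los r then K .los r else K .nlos r := by
      intro u
      split_ifs with h
      · have h1 : ∀ q : ℝ × ℝ × ℝ × ℝ, F (r, true, u, q) = φ .los r q.1 (q.2.2.1 * q.2.2.2) :=
          fun q => by simp [F, h]
        have h2 : Measurable fun q : ℝ × ℝ × ℝ × ℝ => φ .los r q.1 (q.2.2.1 * q.2.2.2) :=
          (hφ .los).comp (by fun_prop : Measurable fun q : ℝ × ℝ × ℝ × ℝ =>
            (r, q.1, q.2.2.1 * q.2.2.2))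
        simp_rw [h1]
        rw [lintegral_prod _ h2.aemeasurable, ← hgain]
        refine lintegral_congr fun h => ?_
        have h3 : Measurable fun q : ℝ × ℝ × ℝ => φ .los r h (q.2.1 * q.2.2) :=
          (hφG .los r h).comp (by fun_prop)
        rw [lintegral_prod _ h3.aemeasurable]
        simp
      · have h1 : ∀ q : ℝ × ℝ × ℝ × ℝ, F (r, true, u, q) = φ .nlos r q.2.1 (q.2.2.1 * q.2.2.2) :=
          fun q => by simp [F, h]
        have h2 : Measurable fun q : ℝ × ℝ × ℝ × ℝ => φ .nlos r q.2.1 (q.2.2.1 * q.2.2.2) :=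
          (hφ .nlos).comp (by fun_prop : Measurable fun q : ℝ × ℝ × ℝ × ℝ =>
            (r, q.2.1, q.2.2.1 * q.2.2.2))
        have h3 : Measurable fun q : ℝ × ℝ × ℝ => φ .nlos r q.1 (q.2.1 * q.2.2) :=
          (hφ .nlos).comp (by fun_prop : Measurable fun q : ℝ × ℝ × ℝ =>
            (r, q.1, q.2.1 * q.2.2))
        simp_rw [h1]
        rw [lintegral_prod _ h2.aemeasurable, ← hgain]
        simp only [lintegral_const, measure_univ, mul_one]
        rw [lintegral_prod _ h3.aemeasurable]
    simp_rw [hu]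
    rw [lintegral_uniform_ite (hp.kappa_mem .los hr).1 (hp.kappa_mem .los hr).2]
    rfl
  have hpolar : ∫⁻ r in Ioi (0 : ℝ), ENNReal.ofReal r * ∫⁻ k, F (r, k) ∂p.markLaw
      = ENNReal.ofReal p.deltaB
        * (p.radialIntegral .los (φ .los) + p.radialIntegral .nlos (φ .nlos)) := by
    have hκm : ∀ ξ, Measurable fun r => ENNReal.ofReal (p.kappa ξ r * r) * K ξ r := fun ξ =>
      ((p.measurable_kappa ξ).mul measurable_id).ennreal_ofReal.mul (hKm ξ)
    have hrad : ∀ ξ, p.radialIntegral ξ (φ ξ)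
        = ∫⁻ r in Ioi (0 : ℝ), ENNReal.ofReal (p.kappa ξ r * r) * K ξ r := fun _ => rfl
    have hsum : Measurable fun r => ENNReal.ofReal (p.kappa .los r * r) * K .los r
        + ENNReal.ofReal (p.kappa .nlos r * r) * K .nlos r := (hκm .los).add (hκm .nlos)
    rw [hrad, hrad, ← lintegral_add_left (hκm .los), ← lintegral_const_mul _ hsum]
    refine setLIntegral_congr_fun measurableSet_Ioi fun r hr => ?_
    have hr' : 0 < r := hr
    rw [hmark r hr', ENNReal.ofReal_mul (hp.kappa_mem .los hr').1,
      ENNReal.ofReal_mul (hp.kappa_mem .nlos hr').1]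
    simp only [K]
    ring
  rw [hpolar, lamB, smul_eq_mul, ← mul_assoc, ← mul_assoc,
    ← ENNReal.ofReal_mul hp.lamG_pos.le, ← ENNReal.ofReal_mul
      (mul_nonneg hp.lamG_pos.le (by positivity))]
  congr 2
  ring

/-! ### Comparison of path gains -/

lemma sq_add_dh_sq_pos {x : ℝ} (hx : 0 < x) : 0 < x ^ 2 + p.dh ^ 2 := by positivity

lemma pathGain_eq_div (ζ : LinkType) (s : ℝ) :
    p.pathGain ζ s = p.C ζ / (s ^ 2 + p.dh ^ 2) ^ (p.eta ζ / 2) := by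
  rw [pathGain, neg_div, Real.rpow_neg (by positivity)]
  rfl

/-- A link of the other state has at most the gain of a link of length `x` exactly if it is at least
as long as the exclusion radius. If the radicand in the exclusion radius is negative, then this
radius is `0` and both sides hold for every length. -/
lemma Valid.pathGain_other_le_iff (hp : p.Valid) (ξ : LinkType) {x r : ℝ} (hx : 0 < x)
    (hr : 0 < r) : p.pathGain ξ.other r ≤ p.pathGain ξ x ↔ p.E ξ x ≤ r := by
  have hX := sq_add_dh_sq_pos (p := p) hx
  have hR := sq_add_dh_sq_pos (p := p) hr
  have hC := hp.C_pos ξ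
  have hC' := hp.C_pos ξ.other
  have hη' := hp.eta_pos ξ.other
  set X := x ^ 2 + p.dh ^ 2
  set R := r ^ 2 + p.dh ^ 2 with hRdef
  have h1 : p.E ξ x ≤ r ↔ (p.C ξ.other / p.C ξ) ^ (2 / p.eta ξ.other)
      * X ^ (p.eta ξ / p.eta ξ.other) ≤ R := by
    rw [E, Real.sqrt_le_iff, and_iff_right hr.le, sub_le_iff_le_add]
  have h2 : (p.C ξ.other / p.C ξ) ^ (2 / p.eta ξ.other) * X ^ (p.eta ξ / p.eta ξ.other)
      = (p.C ξ.other / p.C ξ * X ^ (p.eta ξ / 2)) ^ (2 / p.eta ξ.other) := by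
    rw [Real.mul_rpow (by positivity) (by positivity), ← Real.rpow_mul hX.le]
    congr 2
    field_simp
  have h3 : R = (R ^ (p.eta ξ.other / 2)) ^ (2 / p.eta ξ.other) := by
    rw [← Real.rpow_mul hR.le, div_mul_div_comm, mul_comm, div_self (by positivity), Real.rpow_one]
  rw [h1, h2, h3, Real.rpow_le_rpow_iff (by positivity) (by positivity) (by positivity)]
  rw [pathGain_eq_div, pathGain_eq_div, div_le_div_iff₀ (by positivity) (by positivity),
    div_mul_eq_mul_div,
    div_le_iff₀ hC, mul_comm (p.C ξ)]

lemma Valid.pathGain_le_iff (hp : p.Valid) (ξ : LinkType) {x r : ℝ} (hx : 0 < x)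
    (hr : 0 < r) : p.pathGain ξ r ≤ p.pathGain ξ x ↔ x ≤ r := by
  have hX := sq_add_dh_sq_pos (p := p) hx
  have hR := sq_add_dh_sq_pos (p := p) hr
  have hη := hp.eta_pos ξ
  rw [pathGain, pathGain, mul_le_mul_iff_right₀ (hp.C_pos ξ),
    Real.rpow_le_rpow_iff_of_neg hR hX (by linarith), add_le_add_iff_right,
    sq_le_sq₀ hx.le hr.le]

/-- The least length at which a link in state `ζ` has at most the gain of a link in state `ξ` of
length `x`. -/
def exclusionRadius (p : Params) (ξ ζ : LinkType) (x : ℝ) : ℝ :=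
  match ξ, ζ with
  | .los, .los => x
  | .nlos, .nlos => x
  | .los, .nlos => p.E .los x
  | .nlos, .los => p.E .nlos x

lemma Valid.pathGain_le_iff_exclusionRadius (hp : p.Valid) (ξ ζ : LinkType) {x r : ℝ} (hx : 0 < x)
    (hr : 0 < r) : p.pathGain ζ r ≤ p.pathGain ξ x ↔ p.exclusionRadius ξ ζ x ≤ r := by
  cases ξ <;> cases ζ
  · exact hp.pathGain_le_iff _ hx hr
  · exact hp.pathGain_other_le_iff .los hx hr
  · exact hp.pathGain_other_le_iff .nlos hx hr
  · exact hp.pathGain_le_iff _ hx hr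

lemma exclusionRadius_self (ξ : LinkType) (x : ℝ) : p.exclusionRadius ξ ξ x = x := by
  cases ξ <;> rfl

lemma exclusionRadius_other (ξ : LinkType) (x : ℝ) :
    p.exclusionRadius ξ ξ.other x = p.E ξ x := by
  cases ξ <;> rfl

end Params

/-! ### Serving point in a thin cell of path gains -/

namespace Params

variable (p : Params)

/-- Factor that converts noise and interference into `a` times the fading threshold, if the serving
point has path gain `u`. -/
def powerScale (a τ g u : ℝ) : ℝ≥0∞ :=
  ENNReal.ofReal a * ENNReal.ofReal τ / ENNReal.ofReal (p.Pb * g * u)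

open Classical in
/-- Contribution of a marked point to `a` times the fading threshold if the serving point has path
gain `u`. It is `∞` for the points that would be better servers, so that `exp (-∑ lossExponent)`
vanishes if there is any. -/
def lossExponent (a τ g u : ℝ) (z : MarkedPoint) : ℝ≥0∞ :=
  if z.2.1 = true then
    (if u < p.gainOf z then ∞ else p.powerScale a τ g u * p.powerOf z) else 0

/-- The enabled points with path gain in `(v, u]`. -/
def gainCell (v u : ℝ) : Set MarkedPoint := {z | z.2.1 = true ∧ v < p.gainOf z ∧ p.gainOf z ≤ u}

/-- The enabled points in state `ξ` with path gain in `(v, u]`. -/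
def stateCell (ξ : LinkType) (v u : ℝ) : Set MarkedPoint :=
  {z | z ∈ p.gainCell v u ∧ p.stateOf z = ξ}

/-- Laplace transform at `a` of the fading threshold, given that the serving point has path gain
`u`, times the probability that no point is better. -/
def conditionalLaplace (a τ g u : ℝ) : ℝ :=
  expNeg (p.powerScale a τ g u * ENNReal.ofReal p.sigmaSq
    + ∫⁻ z, oneSubExpNeg (p.lossExponent a τ g u z) ∂p.intensity)

variable {p}

lemma mul_thresholdOf (a τ g : ℝ) (c : ℕ → MarkedPoint) :
    ENNReal.ofReal a * p.thresholdOf τ g c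
      = p.powerScale a τ g (p.gainOf (c (p.server c)))
        * (ENNReal.ofReal p.sigmaSq + p.interferenceOf c) := by
  simp only [thresholdOf, powerScale, div_eq_mul_inv]
  ring

lemma Valid.powerScale_anti (hp : p.Valid) (a τ : ℝ) {g u v : ℝ} (hg : 0 < g) (h : v ≤ u) :
    p.powerScale a τ g u ≤ p.powerScale a τ g v := by
  refine ENNReal.div_le_div_left (ENNReal.ofReal_le_ofReal ?_) _
  exact mul_le_mul_of_nonneg_left h (mul_pos hp.Pb_pos hg).le

lemma Valid.lossExponent_anti (hp : p.Valid) (a τ : ℝ) {g u v : ℝ} (hg : 0 < g) (h : v ≤ u)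
    (z : MarkedPoint) : p.lossExponent a τ g u z ≤ p.lossExponent a τ g v z := by
  have h1 := hp.powerScale_anti a τ hg h
  unfold lossExponent
  by_cases h2 : z.2.1 = true
  · rw [if_pos h2, if_pos h2]
    by_cases h3 : v < p.gainOf z
    · rw [if_pos h3]; exact le_top
    · rw [if_neg h3, if_neg fun h4 => h3 (h.trans_lt h4)]
      gcongr
  · rw [if_neg h2, if_neg h2]

lemma measurable_lossExponent (a τ g u : ℝ) : Measurable (p.lossExponent a τ g u) := by
  classical
  exact Measurable.ite measurableSet_enabled
    (Measurable.ite (measurableSet_lt measurable_const p.measurable_gainOf) measurable_const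
      (p.measurable_powerOf.const_mul _)) measurable_const

lemma measurableSet_gainCell (v u : ℝ) : MeasurableSet (p.gainCell v u) :=
  measurableSet_enabled.inter ((measurableSet_lt measurable_const p.measurable_gainOf).inter
    (measurableSet_le p.measurable_gainOf measurable_const))

lemma measurableSet_stateCell (ξ : LinkType) (v u : ℝ) : MeasurableSet (p.stateCell ξ v u) :=
  (measurableSet_gainCell v u).inter (p.measurableSet_state ξ)

lemma Valid.conditionalLaplace_mono (hp : p.Valid) (a τ : ℝ) {g : ℝ} (hg : 0 < g) :
    Monotone (p.conditionalLaplace a τ g) := by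
  intro v u h
  refine antitone_expNeg (add_le_add ?_ (lintegral_mono fun z =>
    monotone_oneSubExpNeg (hp.lossExponent_anti a τ hg h z)))
  have := hp.powerScale_anti a τ hg h
  gcongr

open Classical in
/-- Only points outside the cell contribute to the loss if the serving point is in it. -/
lemma Valid.expNeg_threshold_le (hp : p.Valid) (a τ : ℝ) {g v u : ℝ} (hg : 0 < g) (ξ : LinkType)
    {c : ℕ → MarkedPoint} (hs : p.IsServer c (p.server c)) :
    (if c (p.server c) ∈ p.stateCell ξ v u then expNeg (ENNReal.ofReal a * p.thresholdOf τ g c)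
        else 0)
      ≤ (1 - expNeg (∑' j, (p.stateCell ξ v u).indicator (fun _ => ∞) (c j)))
        * expNeg (p.powerScale a τ g u * ENNReal.ofReal p.sigmaSq
          + ∑' j, (p.gainCell v u)ᶜ.indicator (p.lossExponent a τ g u) (c j)) := by
  split_ifs with h
  · have h1 : ∑' j, (p.stateCell ξ v u).indicator (fun _ => (∞ : ℝ≥0∞)) (c j) = ∞ :=
      ENNReal.tsum_eq_top_of_eq_top ⟨p.server c, by simp [h]⟩
    rw [h1, expNeg_top, sub_zero, one_mul, mul_thresholdOf]
    refine antitone_expNeg ?_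
    have hD : c (p.server c) ∈ p.gainCell v u := h.1
    have hle := hp.powerScale_anti a τ hg hD.2.2
    rw [mul_add]
    refine add_le_add (by gcongr) ?_
    rw [interferenceOf, ← ENNReal.tsum_mul_left]
    refine ENNReal.tsum_le_tsum fun j => ?_
    by_cases hj : c j ∈ p.gainCell v u
    · simp [hj]
    rw [indicator_of_mem (by exact hj), lossExponent]
    by_cases he : (c j).2.1 = true
    · have hjs : j ≠ p.server c := fun hjs => hj (hjs ▸ hD)
      rw [if_pos he, if_neg (not_lt.2 ((hs.2 j he).trans hD.2.2)), if_pos ⟨he, hjs⟩]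
      gcongr
    · rw [if_neg he]; exact zero_le
  · refine mul_nonneg (sub_nonneg.2 (expNeg_le_one _)) (expNeg_nonneg _)

open Classical in
/-- If the cell contains a single point and no point is better, then this point serves. -/
lemma Valid.le_expNeg_threshold_add (hp : p.Valid) (a τ : ℝ) {g v u : ℝ} (hg : 0 < g)
    (ξ : LinkType) {c : ℕ → MarkedPoint} (hs : p.IsServer c (p.server c)) :
    (1 - expNeg (∑' j, (p.stateCell ξ v u).indicator (fun _ => ∞) (c j)))
        * expNeg (p.powerScale a τ g v * ENNReal.ofReal p.sigmaSq
          + ∑' j, (p.gainCell v u)ᶜ.indicator (p.lossExponent a τ g v) (c j))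
      ≤ (if c (p.server c) ∈ p.stateCell ξ v u then
          expNeg (ENNReal.ofReal a * p.thresholdOf τ g c) else 0)
        + twoPointBound (p.gainCell v u) c := by
  have hite : 0 ≤ (if c (p.server c) ∈ p.stateCell ξ v u then
      expNeg (ENNReal.ofReal a * p.thresholdOf τ g c) else 0) := by
    split_ifs
    exacts [expNeg_nonneg _, le_rfl]
  have htwo := twoPointBound_nonneg (p.gainCell v u) c
  set k := p.powerScale a τ g v * ENNReal.ofReal p.sigmaSq
  set S := ∑' j, (p.gainCell v u)ᶜ.indicator (p.lossExponent a τ g v) (c j) with hS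
  have hk0 := expNeg_nonneg (k + S)
  have hk1 := expNeg_le_one (k + S)
  by_cases hB : ∃ i, c i ∈ p.stateCell ξ v u
  swap
  · push Not at hB
    simp only [hB, not_false_eq_true, indicator_of_notMem, tsum_zero, expNeg_zero, sub_self,
      zero_mul, if_false, zero_add]
    exact htwo
  obtain ⟨i, hi⟩ := hB
  have hle : (1 - expNeg (∑' j, (p.stateCell ξ v u).indicator (fun _ => ∞) (c j)))
      * expNeg (k + S) ≤ expNeg (k + S) :=
    mul_le_of_le_one_left hk0 (sub_le_self _ (expNeg_nonneg _))
  by_cases h2 : ∃ j, j ≠ i ∧ c j ∈ p.gainCell v u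
  · obtain ⟨j, hji, hj⟩ := h2
    linarith [one_le_twoPointBound hji hj hi.1]
  push Not at h2
  by_cases h3 : ∃ j, (c j).2.1 = true ∧ u < p.gainOf (c j)
  · obtain ⟨j, hje, hju⟩ := h3
    have hjD : c j ∉ p.gainCell v u := fun h => not_lt.2 h.2.2 hju
    have hvj : v < p.gainOf (c j) := lt_of_le_of_lt (hi.1.2.1.le.trans hi.1.2.2) hju
    have hS' : S = ∞ := ENNReal.tsum_eq_top_of_eq_top ⟨j, by
      rw [indicator_of_mem (by exact hjD), lossExponent, if_pos hje, if_pos hvj]⟩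
    rw [hS', add_top, expNeg_top] at hle
    rw [hS', add_top, expNeg_top]
    linarith
  push Not at h3
  have hv : v < p.gainOf (c (p.server c)) := hi.1.2.1.trans_le (hs.2 i hi.1.1)
  have hsi : p.server c = i := by
    by_contra hne
    exact h2 _ hne ⟨hs.1, hv, h3 _ hs.1⟩
  rw [if_pos (by rw [hsi]; exact hi)]
  refine hle.trans (le_trans (antitone_expNeg ?_) (le_add_of_nonneg_right htwo))
  rw [mul_thresholdOf, mul_add]
  have hsc := hp.powerScale_anti a τ hg hv.le
  refine add_le_add (mul_le_mul' hsc le_rfl) ?_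
  rw [interferenceOf, ← ENNReal.tsum_mul_left]
  refine ENNReal.tsum_le_tsum fun j => ?_
  by_cases hj : (c j).2.1 = true ∧ j ≠ p.server c
  · have hjD : c j ∉ p.gainCell v u := h2 j (hsi ▸ hj.2)
    have hjv : ¬ v < p.gainOf (c j) := fun h => hjD ⟨hj.1, h, h3 j hj.1⟩
    rw [if_pos hj, indicator_of_mem (by exact hjD), lossExponent, if_pos hj.1, if_neg hjv]
    gcongr
  · rw [if_neg hj, mul_zero]; exact zero_le

end Params

lemma one_sub_exp_neg_ge {x : ℝ} (hx : 0 ≤ x) : x - x ^ 2 / 2 ≤ 1 - Real.exp (-x) := by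
  have h1 : 0 < 1 + x + x ^ 2 / 2 := by positivity
  have h2 := Real.quadratic_le_exp_of_nonneg hx
  have h3 : Real.exp (-x) ≤ 1 / (1 + x + x ^ 2 / 2) := by
    rw [Real.exp_neg, ← one_div]; gcongr
  have h4 : 1 / (1 + x + x ^ 2 / 2) ≤ 1 - x + x ^ 2 / 2 := by
    rw [div_le_iff₀ h1]
    nlinarith [sq_nonneg (x ^ 2)]
  linarith

namespace Network

variable {p : Params} {Ω : Type*} [MeasurableSpace Ω] {P : Measure Ω} (N : Network p P)

/-- The event that the serving point lies in the given cell. -/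
def servedCell (ξ : LinkType) (v u : ℝ) : Set Ω :=
  {ω | N.config ω (N.serving ω) ∈ p.stateCell ξ v u}

lemma measurableSet_servedCell (ξ : LinkType) (v u : ℝ) : MeasurableSet (N.servedCell ξ v u) :=
  (Params.measurableSet_stateCell ξ v u).preimage
    (p.measurable_serverPoint.comp N.measurable_config)

lemma measurable_mul_fadingThreshold (a τ g : ℝ) :
    Measurable fun ω => ENNReal.ofReal a * N.fadingThreshold τ g ω :=
  (N.measurable_fadingThreshold τ g).const_mul _

variable [IsProbabilityMeasure P]

/-- If the serving point is in the cell, then the cell is hit, and the points outside the cell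
contribute at least the loss at the upper end of the cell. Replacing these points by all points
costs at most the intensity of the cell. -/
lemma integral_servedCell_le (hp : p.Valid) (a τ : ℝ) {g v u : ℝ} (hg : 0 < g) (ξ : LinkType)
    (hD : p.intensity (p.gainCell v u) ≠ ∞) :
    ∫ ω in N.servedCell ξ v u, expNeg (ENNReal.ofReal a * N.fadingThreshold τ g ω) ∂P
      ≤ (p.intensity (p.stateCell ξ v u)).toReal
        * (p.conditionalLaplace a τ g u + (p.intensity (p.gainCell v u)).toReal) := by
  classical
  have hY := N.measurable_config_apply
  have hDm := Params.measurableSet_gainCell (p := p) v u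
  have hBm := Params.measurableSet_stateCell (p := p) ξ v u
  have hf : Measurable ((p.gainCell v u)ᶜ.indicator (p.lossExponent a τ g u)) :=
    (Params.measurable_lossExponent a τ g u).indicator hDm.compl
  have hhit := (N.hasPoissonLaplace hp).integral_hit hY hBm hf
    (fun z hz => indicator_of_notMem (by simpa using hz.1) _)
    (p.powerScale a τ g u * ENNReal.ofReal p.sigmaSq)
  set k := p.powerScale a τ g u * ENNReal.ofReal p.sigmaSq with hk
  have hint := integrable_hit (P := P) hY hBm hf k
  have h1 : ∫ ω in N.servedCell ξ v u, expNeg (ENNReal.ofReal a * N.fadingThreshold τ g ω) ∂P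
      ≤ (1 - expNeg (p.intensity (p.stateCell ξ v u))) * expNeg (k + ∫⁻ z, oneSubExpNeg
        ((p.gainCell v u)ᶜ.indicator (p.lossExponent a τ g u) z) ∂p.intensity) := by
    rw [← hhit, ← integral_indicator (N.measurableSet_servedCell ξ v u)]
    refine integral_mono_ae ((integrable_expNeg
      (N.measurable_mul_fadingThreshold a τ g)).indicator (N.measurableSet_servedCell ξ v u))
      hint ?_
    filter_upwards [N.ae_isServer hp] with ω hω
    refine le_trans (le_of_eq ?_) (hp.expNeg_threshold_le a τ hg ξ (v := v) (u := u) hω)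
    simp only [indicator, servedCell, N.fadingThreshold_eq, N.serving_eq]
    rfl
  have hle : ∫⁻ z, oneSubExpNeg (p.lossExponent a τ g u z) ∂p.intensity
      ≤ ∫⁻ z, oneSubExpNeg ((p.gainCell v u)ᶜ.indicator (p.lossExponent a τ g u) z) ∂p.intensity
        + p.intensity (p.gainCell v u) := by
    rw [← lintegral_indicator_one hDm, ← lintegral_add_right _ (measurable_one.indicator hDm)]
    refine lintegral_mono fun z => ?_
    by_cases hz : z ∈ p.gainCell v u
    · simpa [hz] using le_add_left (oneSubExpNeg_le_one _)
    · simp [hz]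
  have h2 := expNeg_sub_le (k + ∫⁻ z, oneSubExpNeg
    ((p.gainCell v u)ᶜ.indicator (p.lossExponent a τ g u) z) ∂p.intensity)
    (p.intensity (p.gainCell v u)) (p.intensity (p.gainCell v u)).toReal
    (ENNReal.ofReal_toReal hD).ge ENNReal.toReal_nonneg
  have h3 : expNeg (k + ∫⁻ z, oneSubExpNeg ((p.gainCell v u)ᶜ.indicator
      (p.lossExponent a τ g u) z) ∂p.intensity + p.intensity (p.gainCell v u))
      ≤ p.conditionalLaplace a τ g u := by
    refine antitone_expNeg ?_
    rw [add_assoc]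
    gcongr
  have hBD : p.intensity (p.stateCell ξ v u) ≠ ∞ :=
    ne_top_of_le_ne_top hD (measure_mono fun z hz => hz.1)
  refine h1.trans (mul_le_mul ?_ (h2.trans (by linarith)) (expNeg_nonneg _) ENNReal.toReal_nonneg)
  rw [expNeg_of_ne_top hBD]
  linarith [Real.add_one_le_exp (-(p.intensity (p.stateCell ξ v u)).toReal)]

/-- If the cell is hit and no point is better, then the serving point is in the cell, except where
two points lie in the cell. -/
lemma le_integral_servedCell (hp : p.Valid) (a τ : ℝ) {g v u : ℝ} (hg : 0 < g) (ξ : LinkType)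
    (hD : p.intensity (p.gainCell v u) ≠ ∞) :
    (p.intensity (p.stateCell ξ v u)).toReal * p.conditionalLaplace a τ g v
        - (p.intensity (p.gainCell v u)).toReal ^ 2
      ≤ ∫ ω in N.servedCell ξ v u, expNeg (ENNReal.ofReal a * N.fadingThreshold τ g ω) ∂P := by
  classical
  have hY := N.measurable_config_apply
  have hDm := Params.measurableSet_gainCell (p := p) v u
  have hBm := Params.measurableSet_stateCell (p := p) ξ v u
  have hf : Measurable ((p.gainCell v u)ᶜ.indicator (p.lossExponent a τ g v)) :=
    (Params.measurable_lossExponent a τ g v).indicator hDm.compl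
  have hhit := (N.hasPoissonLaplace hp).integral_hit hY hBm hf
    (fun z hz => indicator_of_notMem (by simpa using hz.1) _)
    (p.powerScale a τ g v * ENNReal.ofReal p.sigmaSq)
  set k := p.powerScale a τ g v * ENNReal.ofReal p.sigmaSq with hk
  have hint := integrable_hit (P := P) hY hBm hf k
  have hintI := (integrable_expNeg (P := P) (N.measurable_mul_fadingThreshold a τ g)).indicator
    (N.measurableSet_servedCell ξ v u)
  have hintT := integrable_twoPointBound (P := P) hY hDm
  have h1 : (1 - expNeg (p.intensity (p.stateCell ξ v u))) * expNeg (k + ∫⁻ z, oneSubExpNeg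
        ((p.gainCell v u)ᶜ.indicator (p.lossExponent a τ g v) z) ∂p.intensity)
      ≤ ∫ ω in N.servedCell ξ v u, expNeg (ENNReal.ofReal a * N.fadingThreshold τ g ω) ∂P
        + ∫ ω, twoPointBound (p.gainCell v u) (fun j => N.config ω j) ∂P := by
    rw [← hhit, ← integral_indicator (N.measurableSet_servedCell ξ v u),
      ← integral_add hintI hintT]
    refine integral_mono_ae hint (hintI.add hintT) ?_
    filter_upwards [N.ae_isServer hp] with ω hω
    refine (hp.le_expNeg_threshold_add a τ hg ξ (v := v) (u := u) hω).trans (le_of_eq ?_)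
    simp only [indicator, servedCell, N.fadingThreshold_eq, N.serving_eq]
    rfl
  have h2 := (N.hasPoissonLaplace hp).integral_twoPointBound_le hY hDm hD
  have h3 : p.conditionalLaplace a τ g v ≤ expNeg (k + ∫⁻ z, oneSubExpNeg
      ((p.gainCell v u)ᶜ.indicator (p.lossExponent a τ g v) z) ∂p.intensity) := by
    refine antitone_expNeg ?_
    gcongr with z
    exact monotone_oneSubExpNeg (indicator_le_self _ _ _)
  have hBD : p.intensity (p.stateCell ξ v u) ≤ p.intensity (p.gainCell v u) :=
    measure_mono fun z hz => hz.1
  have hBD' := ENNReal.toReal_mono hD hBD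
  rw [expNeg_of_ne_top (ne_top_of_le_ne_top hD hBD)] at h1
  set b := (p.intensity (p.stateCell ξ v u)).toReal
  set d := (p.intensity (p.gainCell v u)).toReal
  have hb : 0 ≤ b := ENNReal.toReal_nonneg
  have h4 := one_sub_exp_neg_ge hb
  have h5 : 0 ≤ 1 - Real.exp (-b) := by
    have := Real.exp_le_one_iff.2 (neg_nonpos.2 hb); linarith
  have h6 : 0 ≤ p.conditionalLaplace a τ g v := expNeg_nonneg _
  have h7 : p.conditionalLaplace a τ g v ≤ 1 := expNeg_le_one _
  have h8 := mul_le_mul_of_nonneg_left h3 h5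
  have h9 := mul_le_mul_of_nonneg_right h4 h6
  have h10 : b ^ 2 ≤ d ^ 2 := by gcongr
  nlinarith [mul_le_mul_of_nonneg_left h7 (sq_nonneg b)]

end Network

/-! ### Intensity of the cells -/

namespace Params

variable {p : Params}

/-- Mean number of enabled base stations in state `ζ` within distance `s`. -/
def radialMass (p : Params) (ζ : LinkType) (s : ℝ) : ℝ :=
  2 * Real.pi * p.lamB * ∫ r in (0 : ℝ)..s, p.kappa ζ r * r

lemma exists_abs_kappa_le (ζ : LinkType) : ∃ K, ∀ r, |p.kappa ζ r| ≤ K := by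
  have h : ∀ r, |-p.c * Real.exp (-p.d * Real.arctan (p.dh / r)) + p.e|
      ≤ |p.c| * Real.exp (|p.d| * 2) + |p.e| := by
    intro r
    refine (abs_add_le _ _).trans (add_le_add_left ?_ _)
    rw [abs_mul, abs_neg, Real.abs_exp]
    refine mul_le_mul_of_nonneg_left (Real.exp_le_exp.2 ?_) (abs_nonneg _)
    refine (le_abs_self _).trans ?_
    rw [abs_mul, abs_neg]
    refine mul_le_mul_of_nonneg_left ?_ (abs_nonneg _)
    rw [abs_le]
    constructor <;>
      linarith [Real.neg_pi_div_two_lt_arctan (p.dh / r), Real.arctan_lt_pi_div_two (p.dh / r),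
        Real.pi_lt_four]
  cases ζ
  · exact ⟨_, h⟩
  · refine ⟨1 + (|p.c| * Real.exp (|p.d| * 2) + |p.e|), fun r => ?_⟩
    refine (abs_sub _ _).trans (add_le_add ?_ (h r))
    simp

lemma intervalIntegrable_kappa_mul (ζ : LinkType) (a b : ℝ) :
    IntervalIntegrable (fun r => p.kappa ζ r * r) volume a b := by
  obtain ⟨K, hK⟩ := p.exists_abs_kappa_le ζ
  refine IntervalIntegrable.mul_continuousOn ?_ continuousOn_id
  rw [intervalIntegrable_iff]
  exact Measure.integrableOn_of_bounded (M := K) (by simp)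
    (p.measurable_kappa ζ).aestronglyMeasurable (Eventually.of_forall hK)

lemma continuous_radialMass (ζ : LinkType) : Continuous (p.radialMass ζ) :=
  (intervalIntegral.continuous_primitive (intervalIntegrable_kappa_mul ζ) 0).const_mul _

lemma radialMass_sub (ζ : LinkType) (a b : ℝ) :
    p.radialMass ζ b - p.radialMass ζ a
      = ∫ r in a..b, 2 * Real.pi * p.lamB * (p.kappa ζ r * r) := by
  rw [intervalIntegral.integral_const_mul, radialMass, radialMass, ← mul_sub,
    intervalIntegral.integral_interval_sub_left (intervalIntegrable_kappa_mul ζ _ _)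
      (intervalIntegrable_kappa_mul ζ _ _)]

lemma Valid.serverDensity_nonneg (hp : p.Valid) (ζ : LinkType) {r : ℝ} (hr : 0 < r) :
    0 ≤ 2 * Real.pi * p.lamB * (p.kappa ζ r * r) := by
  have h1 := hp.lamB_pos
  have h2 := (hp.kappa_mem ζ hr).1
  positivity

lemma Valid.radialMass_mono (hp : p.Valid) (ζ : LinkType) {a b : ℝ} (ha : 0 ≤ a) (h : a ≤ b) :
    p.radialMass ζ a ≤ p.radialMass ζ b := by
  rw [← sub_nonneg, radialMass_sub, intervalIntegral.integral_of_le h]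
  exact setIntegral_nonneg measurableSet_Ioc fun r hr =>
    hp.serverDensity_nonneg ζ (ha.trans_lt hr.1)

lemma radialMass_zero (ζ : LinkType) : p.radialMass ζ 0 = 0 := by simp [radialMass]

lemma Valid.lintegral_kappa (hp : p.Valid) (ζ : LinkType) {a b : ℝ} (ha : 0 ≤ a) (h : a ≤ b) :
    ENNReal.ofReal (2 * Real.pi * p.lamB) * ∫⁻ r in Ioc a b, ENNReal.ofReal (p.kappa ζ r * r)
      = ENNReal.ofReal (p.radialMass ζ b - p.radialMass ζ a) := by
  have h1 := hp.lamB_pos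
  rw [radialMass_sub, intervalIntegral.integral_const_mul,
    ENNReal.ofReal_mul (p := 2 * Real.pi * p.lamB) (by positivity),
    intervalIntegral.integral_of_le h, ofReal_integral_eq_lintegral_ofReal]
  · exact (intervalIntegrable_iff_integrableOn_Ioc_of_le h).1 (intervalIntegrable_kappa_mul ζ a b)
  · refine (ae_restrict_iff' measurableSet_Ioc).2 (Eventually.of_forall fun r hr => ?_)
    have hr0 : 0 < r := ha.trans_lt hr.1
    exact mul_nonneg (hp.kappa_mem ζ hr0).1 hr0.le

/-- The average over fading and directivity is irrelevant for functions of the length. -/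
lemma Valid.radialIntegral_const (hp : p.Valid) (ζ : LinkType) (f : ℝ → ℝ≥0∞) :
    p.radialIntegral ζ (fun r _ _ => f r)
      = ∫⁻ r in Ioi (0 : ℝ), ENNReal.ofReal (p.kappa ζ r * r) * f r := by
  have := isProbabilityMeasure_gamma_nat (hp.m_pos ζ)
  unfold radialIntegral
  simp only [lintegral_const, measure_univ, mul_one]
  simp_rw [← Finset.sum_mul, hp.sum_prob, one_mul]

lemma E_nonneg (ξ : LinkType) (x : ℝ) : 0 ≤ p.E ξ x := Real.sqrt_nonneg _

lemma Valid.continuous_E (hp : p.Valid) (ξ : LinkType) : Continuous (p.E ξ) := by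
  have h1 := hp.eta_pos ξ
  have h2 := hp.eta_pos ξ.other
  have : Continuous fun x : ℝ => (x ^ 2 + p.dh ^ 2) ^ (p.eta ξ / p.eta ξ.other) :=
    Continuous.rpow_const (by fun_prop) fun x => Or.inr (by positivity)
  unfold E
  fun_prop

lemma Valid.E_mono (hp : p.Valid) (ξ : LinkType) {x y : ℝ} (hx : 0 ≤ x) (h : x ≤ y) :
    p.E ξ x ≤ p.E ξ y := by
  have h1 := hp.eta_pos ξ
  have h2 := hp.eta_pos ξ.other
  have h3 := hp.C_pos ξ
  have h4 := hp.C_pos ξ.other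
  unfold E
  gcongr

lemma Valid.continuous_exclusionRadius (hp : p.Valid) (ξ ζ : LinkType) :
    Continuous (p.exclusionRadius ξ ζ) := by
  cases ξ <;> cases ζ
  exacts [continuous_id, hp.continuous_E .los, hp.continuous_E .nlos, continuous_id]

lemma exclusionRadius_nonneg (ξ ζ : LinkType) {x : ℝ} (hx : 0 ≤ x) :
    0 ≤ p.exclusionRadius ξ ζ x := by
  cases ξ <;> cases ζ
  exacts [hx, E_nonneg _ _, E_nonneg _ _, hx]

lemma Valid.exclusionRadius_mono (hp : p.Valid) (ξ ζ : LinkType) {x y : ℝ} (hx : 0 ≤ x)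
    (h : x ≤ y) : p.exclusionRadius ξ ζ x ≤ p.exclusionRadius ξ ζ y := by
  cases ξ <;> cases ζ
  exacts [h, hp.E_mono _ hx h, hp.E_mono _ hx h, h]

lemma Valid.intensity_stateCell (hp : p.Valid) (ξ ζ : LinkType) {x y : ℝ} (hx : 0 < x)
    (h : x ≤ y) :
    p.intensity (p.stateCell ζ (p.pathGain ξ y) (p.pathGain ξ x))
      = ENNReal.ofReal (p.radialMass ζ (p.exclusionRadius ξ ζ y)
        - p.radialMass ζ (p.exclusionRadius ξ ζ x)) := by
  classical
  set v := p.pathGain ξ y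
  set u := p.pathGain ξ x
  let φ : LinkType → ℝ → ℝ≥0∞ := fun ζ' r =>
    if ζ' = ζ ∧ v < p.pathGain ζ' r ∧ p.pathGain ζ' r ≤ u then 1 else 0
  have hφ : ∀ ζ', Measurable (φ ζ') := fun ζ' =>
    Measurable.ite ((MeasurableSet.const _).inter
      ((measurableSet_lt measurable_const (p.measurable_pathGain ζ')).inter
        (measurableSet_le (p.measurable_pathGain ζ') measurable_const)))
      measurable_const measurable_const
  have hS : p.intensity (p.stateCell ζ v u) = ∫⁻ z : MarkedPoint,
      (if z.2.1 = true then φ (p.stateOf z) ‖z.1‖ else 0) ∂p.intensity := by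
    rw [← lintegral_indicator_one (measurableSet_stateCell ζ v u)]
    refine lintegral_congr fun z => ?_
    have hmem : z ∈ p.stateCell ζ v u ↔ z.2.1 = true ∧ (p.stateOf z = ζ
        ∧ v < p.pathGain (p.stateOf z) ‖z.1‖ ∧ p.pathGain (p.stateOf z) ‖z.1‖ ≤ u) := by
      change (_ ∧ _ ∧ _) ∧ _ ↔ _
      simp only [gainOf]
      tauto
    by_cases hz : z ∈ p.stateCell ζ v u
    · have hz' := hmem.1 hz
      simp only [φ]
      rw [indicator_of_mem hz, if_pos hz'.1, if_pos hz'.2, Pi.one_apply]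
    · rw [indicator_of_notMem hz]
      rw [hmem] at hz
      simp only [φ]
      split_ifs with h1 h2
      exacts [absurd ⟨h1, h2⟩ hz, rfl, rfl]
  have hself : ∫⁻ r in Ioi (0 : ℝ), ENNReal.ofReal (p.kappa ζ r * r) * φ ζ r
      = ∫⁻ r in Ioc (p.exclusionRadius ξ ζ x) (p.exclusionRadius ξ ζ y),
        ENNReal.ofReal (p.kappa ζ r * r) := by
    have hrx := exclusionRadius_nonneg (p := p) ξ ζ hx.le
    have hset : Ioc (p.exclusionRadius ξ ζ x) (p.exclusionRadius ξ ζ y)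
        = Ioc (p.exclusionRadius ξ ζ x) (p.exclusionRadius ξ ζ y) ∩ Ioi 0 :=
      (inter_eq_left.2 fun r hr => hrx.trans_lt hr.1).symm
    rw [hset, ← Measure.restrict_restrict measurableSet_Ioc,
      ← lintegral_indicator measurableSet_Ioc]
    -- the two boundary lengths, where strict and weak inequalities differ, form a null set
    refine setLIntegral_congr_fun_ae measurableSet_Ioi ?_
    filter_upwards [Measure.ae_ne volume (p.exclusionRadius ξ ζ x),
      Measure.ae_ne volume (p.exclusionRadius ξ ζ y)] with r hr1 hr2 hr
    have e1 := hp.pathGain_le_iff_exclusionRadius ξ ζ hx (r := r) hr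
    have e2 := hp.pathGain_le_iff_exclusionRadius ξ ζ (hx.trans_le h) (r := r) hr
    have hiff : (ζ = ζ ∧ v < p.pathGain ζ r ∧ p.pathGain ζ r ≤ u)
        ↔ r ∈ Ioc (p.exclusionRadius ξ ζ x) (p.exclusionRadius ξ ζ y) := by
      rw [e1, ← not_le, e2, mem_Ioc]
      constructor
      · rintro ⟨_, h3, h4⟩
        exact ⟨lt_of_le_of_ne h4 (Ne.symm hr1), (not_le.1 h3).le⟩
      · rintro ⟨h3, h4⟩
        exact ⟨rfl, not_le.2 (lt_of_le_of_ne h4 hr2), h3.le⟩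
    by_cases hm : r ∈ Ioc (p.exclusionRadius ξ ζ x) (p.exclusionRadius ξ ζ y)
    · rw [indicator_of_mem hm]
      change _ * (if _ then (1 : ℝ≥0∞) else 0) = _
      rw [if_pos (hiff.2 hm), mul_one]
    · rw [indicator_of_notMem hm]
      change _ * (if _ then (1 : ℝ≥0∞) else 0) = _
      rw [if_neg fun h3 => hm (hiff.1 h3), mul_zero]
  have hzero : ∀ ζ', ζ' ≠ ζ →
      ∫⁻ r in Ioi (0 : ℝ), ENNReal.ofReal (p.kappa ζ' r * r) * φ ζ' r = 0 :=
    fun ζ' hζ => by simp [φ, hζ]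
  rw [hS, hp.lintegral_intensity (φ := fun ζ' r _ _ => φ ζ' r)
    (fun ζ' => (hφ ζ').comp measurable_fst), hp.radialIntegral_const, hp.radialIntegral_const,
    ← hp.lintegral_kappa ζ (exclusionRadius_nonneg ξ ζ hx.le) (hp.exclusionRadius_mono ξ ζ hx.le h),
    ← hself]
  cases ζ
  · rw [hzero .nlos (by simp), add_zero]
  · rw [hzero .los (by simp), zero_add]

/-- Mean number of enabled base stations with larger gain than a link in state `ξ` of length `x`. -/
def betterMass (p : Params) (ξ : LinkType) (x : ℝ) : ℝ :=
  p.radialMass .los (p.exclusionRadius ξ .los x) + p.radialMass .nlos (p.exclusionRadius ξ .nlos x)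

lemma Valid.continuous_betterMass (hp : p.Valid) (ξ : LinkType) : Continuous (p.betterMass ξ) :=
  ((continuous_radialMass _).comp (hp.continuous_exclusionRadius _ _)).add
    ((continuous_radialMass _).comp (hp.continuous_exclusionRadius _ _))

lemma Valid.radialMass_exclusionRadius_mono (hp : p.Valid) (ξ ζ : LinkType) {x y : ℝ} (hx : 0 ≤ x)
    (h : x ≤ y) :
    p.radialMass ζ (p.exclusionRadius ξ ζ x) ≤ p.radialMass ζ (p.exclusionRadius ξ ζ y) :=
  hp.radialMass_mono ζ (exclusionRadius_nonneg ξ ζ hx) (hp.exclusionRadius_mono ξ ζ hx h)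

lemma Valid.intensity_gainCell (hp : p.Valid) (ξ : LinkType) {x y : ℝ} (hx : 0 < x)
    (h : x ≤ y) :
    p.intensity (p.gainCell (p.pathGain ξ y) (p.pathGain ξ x))
      = ENNReal.ofReal (p.betterMass ξ y - p.betterMass ξ x) := by
  have hsplit : p.gainCell (p.pathGain ξ y) (p.pathGain ξ x)
      = p.stateCell .los (p.pathGain ξ y) (p.pathGain ξ x)
        ∪ p.stateCell .nlos (p.pathGain ξ y) (p.pathGain ξ x) := by
    ext z
    change _ ↔ (_ ∧ _) ∨ (_ ∧ _)
    rw [← and_or_left]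
    cases p.stateOf z <;> simp
  have hdisj : Disjoint (p.stateCell .los (p.pathGain ξ y) (p.pathGain ξ x))
      (p.stateCell .nlos (p.pathGain ξ y) (p.pathGain ξ x)) :=
    disjoint_left.2 fun z h1 h2 => by
      have := h1.2.symm.trans h2.2
      cases this
  rw [hsplit, measure_union hdisj (measurableSet_stateCell _ _ _), hp.intensity_stateCell ξ _ hx h,
    hp.intensity_stateCell ξ _ hx h, ← ENNReal.ofReal_add
    (sub_nonneg.2 (hp.radialMass_exclusionRadius_mono ξ _ hx.le h))
    (sub_nonneg.2 (hp.radialMass_exclusionRadius_mono ξ _ hx.le h))]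
  congr 1
  unfold betterMass
  ring

end Params

/-! ### Law of the threshold and the serving distance -/

namespace Network

variable {p : Params} {Ω : Type*} [MeasurableSpace Ω] {P : Measure Ω} (N : Network p P)

lemma servedCell_union (ζ : LinkType) {u v w : ℝ} (h1 : w ≤ v) (h2 : v ≤ u) :
    N.servedCell ζ w u = N.servedCell ζ w v ∪ N.servedCell ζ v u := by
  ext ω
  change ((_ ∧ _ ∧ _) ∧ _) ↔ ((_ ∧ _ ∧ _) ∧ _) ∨ ((_ ∧ _ ∧ _) ∧ _)
  constructor
  · rintro ⟨⟨he, h3, h4⟩, hs⟩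
    by_cases h5 : p.gainOf (N.config ω (N.serving ω)) ≤ v
    · exact Or.inl ⟨⟨he, h3, h5⟩, hs⟩
    · exact Or.inr ⟨⟨he, not_le.1 h5, h4⟩, hs⟩
  · rintro (⟨⟨he, h3, h4⟩, hs⟩ | ⟨⟨he, h3, h4⟩, hs⟩)
    · exact ⟨⟨he, h3, h4.trans h2⟩, hs⟩
    · exact ⟨⟨he, h1.trans_lt h3, h4⟩, hs⟩

lemma disjoint_servedCell (ζ : LinkType) (u v w : ℝ) :
    Disjoint (N.servedCell ζ w v) (N.servedCell ζ v u) :=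
  disjoint_left.2 fun _ h1 h2 => not_lt.2 h1.1.2.2 h2.1.2.1

variable [IsProbabilityMeasure P]

/-- The Laplace transform of the threshold on the event that the serving link is in state `ξ` and
has length between `δ` and `R`. -/
lemma integral_servedCell (hp : p.Valid) (a τ : ℝ) {g : ℝ} (hg : 0 < g) (ξ : LinkType) {δ R : ℝ}
    (hδ : 0 < δ) (hδR : δ ≤ R) :
    IntervalIntegrable (fun t => p.conditionalLaplace a τ g (p.pathGain ξ t)
      * (2 * Real.pi * p.lamB * (p.kappa ξ t * t))) volume δ R ∧
    ∫ ω in N.servedCell ξ (p.pathGain ξ R) (p.pathGain ξ δ),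
        expNeg (ENNReal.ofReal a * N.fadingThreshold τ g ω) ∂P
      = ∫ t in δ..R, p.conditionalLaplace a τ g (p.pathGain ξ t)
        * (2 * Real.pi * p.lamB * (p.kappa ξ t * t)) := by
  set Ψ : ℝ → ℝ := fun t => p.conditionalLaplace a τ g (p.pathGain ξ t) with hΨ
  set k : ℝ → ℝ := fun t => 2 * Real.pi * p.lamB * (p.kappa ξ t * t) with hk
  have hΨm : Measurable Ψ :=
    (hp.conditionalLaplace_mono a τ hg).measurable.comp (p.measurable_pathGain ξ)
  have hki : ∀ x y, IntervalIntegrable k volume x y := fun x y =>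
    (Params.intervalIntegrable_kappa_mul ξ x y).const_mul _
  have hi : ∀ x y, IntervalIntegrable (fun t => Ψ t * k t) volume x y := by
    intro x y
    have h1 := hki x y
    rw [intervalIntegrable_iff] at h1 ⊢
    refine h1.bdd_mul (c := 1) hΨm.aestronglyMeasurable (Eventually.of_forall fun t => ?_)
    have h0 : 0 ≤ Ψ t := expNeg_nonneg _
    rw [Real.norm_of_nonneg h0]
    exact expNeg_le_one _
  refine ⟨hi δ R, ?_⟩
  have hpg : ∀ {x y}, δ ≤ x → x ≤ y → p.pathGain ξ y ≤ p.pathGain ξ x := fun hx hxy =>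
    (hp.pathGain_le_iff ξ (hδ.trans_le hx) (hδ.trans_le (hx.trans hxy))).2 hxy
  set T : Ω → ℝ := fun ω => expNeg (ENNReal.ofReal a * N.fadingThreshold τ g ω) with hT
  have hTi : Integrable T P := integrable_expNeg (N.measurable_mul_fadingThreshold a τ g)
  have hincr := sub_eq_sub_of_increment_bound hδR (C := 2)
    (G := fun x => ∫ ω in N.servedCell ξ (p.pathGain ξ x) (p.pathGain ξ δ), T ω ∂P)
    (J := fun x => ∫ t in δ..x, Ψ t * k t) (D := p.betterMass ξ) (Ψ := Ψ)
    (hp.continuous_betterMass ξ).continuousOn (by norm_num)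
    (fun x y hx hxy _ => hp.conditionalLaplace_mono a τ hg (hpg hx hxy))
    (fun x y hx hxy _ => add_le_add
      (hp.radialMass_exclusionRadius_mono ξ _ (hδ.le.trans hx) hxy)
      (hp.radialMass_exclusionRadius_mono ξ _ (hδ.le.trans hx) hxy)) ?_
  · simp only [intervalIntegral.integral_same, sub_zero] at hincr
    have hempty : N.servedCell ξ (p.pathGain ξ δ) (p.pathGain ξ δ) = ∅ :=
      eq_empty_of_forall_notMem fun ω h => not_lt.2 h.1.2.2 h.1.2.1
    rwa [hempty, setIntegral_empty, sub_zero] at hincr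
  intro x y hx hxy hy
  have hx0 : 0 < x := hδ.trans_le hx
  have hG : ∫ ω in N.servedCell ξ (p.pathGain ξ y) (p.pathGain ξ δ), T ω ∂P
      - ∫ ω in N.servedCell ξ (p.pathGain ξ x) (p.pathGain ξ δ), T ω ∂P
      = ∫ ω in N.servedCell ξ (p.pathGain ξ y) (p.pathGain ξ x), T ω ∂P := by
    rw [N.servedCell_union ξ (hpg hx hxy) (hpg le_rfl hx),
      setIntegral_union (N.disjoint_servedCell _ _ _ _) (N.measurableSet_servedCell _ _ _)
        hTi.integrableOn hTi.integrableOn, add_sub_cancel_right]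
  have hJ : (∫ t in δ..y, Ψ t * k t) - ∫ t in δ..x, Ψ t * k t = ∫ t in x..y, Ψ t * k t :=
    intervalIntegral.integral_interval_sub_left (hi _ _) (hi _ _)
  have hDeq := hp.intensity_gainCell ξ hx0 hxy
  have hBeq := hp.intensity_stateCell ξ ξ hx0 hxy
  rw [Params.exclusionRadius_self, Params.exclusionRadius_self] at hBeq
  have hDtop : p.intensity (p.gainCell (p.pathGain ξ y) (p.pathGain ξ x)) ≠ ∞ := by
    rw [hDeq]; exact ENNReal.ofReal_ne_top
  have hBD : (p.intensity (p.stateCell ξ (p.pathGain ξ y) (p.pathGain ξ x))).toReal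
      ≤ (p.intensity (p.gainCell (p.pathGain ξ y) (p.pathGain ξ x))).toReal :=
    ENNReal.toReal_mono hDtop (measure_mono fun z hz => hz.1)
  have hup := N.integral_servedCell_le hp a τ hg ξ hDtop
  have hlo := N.le_integral_servedCell hp a τ hg ξ hDtop
  have hD0 : p.betterMass ξ x ≤ p.betterMass ξ y := add_le_add
    (hp.radialMass_exclusionRadius_mono ξ _ hx0.le hxy)
    (hp.radialMass_exclusionRadius_mono ξ _ hx0.le hxy)
  have hB0 := hp.radialMass_mono ξ hx0.le hxy
  rw [hDeq, hBeq, ENNReal.toReal_ofReal (sub_nonneg.2 hD0), ENNReal.toReal_ofReal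
    (sub_nonneg.2 hB0)] at hup hlo hBD
  have hb : ∫ t in x..y, k t = p.radialMass ξ y - p.radialMass ξ x :=
    (Params.radialMass_sub ξ x y).symm
  have hJup : ∫ t in x..y, Ψ t * k t ≤ Ψ x * (p.radialMass ξ y - p.radialMass ξ x) := by
    rw [← hb, ← intervalIntegral.integral_const_mul]
    refine intervalIntegral.integral_mono_on hxy (hi _ _) ((hki _ _).const_mul _) fun t ht => ?_
    exact mul_le_mul_of_nonneg_right (hp.conditionalLaplace_mono a τ hg (hpg hx ht.1))
      (hp.serverDensity_nonneg ξ (hx0.trans_le ht.1))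
  have hJlo : Ψ y * (p.radialMass ξ y - p.radialMass ξ x) ≤ ∫ t in x..y, Ψ t * k t := by
    rw [← hb, ← intervalIntegral.integral_const_mul]
    refine intervalIntegral.integral_mono_on hxy ((hki _ _).const_mul _) (hi _ _) fun t ht => ?_
    exact mul_le_mul_of_nonneg_right (hp.conditionalLaplace_mono a τ hg (hpg (hx.trans ht.1) ht.2))
      (hp.serverDensity_nonneg ξ (hx0.trans_le ht.1))
  have hΨxy : Ψ y ≤ Ψ x := hp.conditionalLaplace_mono a τ hg (hpg hx hxy)
  rw [hG, hJ]
  set b := p.radialMass ξ y - p.radialMass ξ x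
  set d := p.betterMass ξ y - p.betterMass ξ x
  have hb0 : 0 ≤ b := sub_nonneg.2 hB0
  have hd0 : 0 ≤ d := sub_nonneg.2 hD0
  change _ ≤ b * (Ψ x + d) at hup
  change b * Ψ y - d ^ 2 ≤ _ at hlo
  have h1 : b * (Ψ x - Ψ y) ≤ d * (Ψ x - Ψ y) :=
    mul_le_mul_of_nonneg_right hBD (sub_nonneg.2 hΨxy)
  have h2 : 0 ≤ d * (Ψ x - Ψ y) := mul_nonneg hd0 (sub_nonneg.2 hΨxy)
  have h3 : b * d ≤ d * d := mul_le_mul_of_nonneg_right hBD hd0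
  have h4 : 0 ≤ d * d := mul_nonneg hd0 hd0
  rw [abs_le]
  constructor <;> nlinarith

/-- The Laplace transform of the threshold on the event that the serving link is in state `ξ`, as
an integral over the length of that link. -/
lemma lintegral_assoc (hp : p.Valid) (a τ : ℝ) {g : ℝ} (hg : 0 < g) (ξ : LinkType) :
    ∫⁻ ω in N.assoc ξ, ENNReal.ofReal (expNeg (ENNReal.ofReal a * N.fadingThreshold τ g ω)) ∂P
      = ∫⁻ t in Ioi (0 : ℝ), ENNReal.ofReal (p.conditionalLaplace a τ g (p.pathGain ξ t)
        * (2 * Real.pi * p.lamB * (p.kappa ξ t * t))) := by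
  set F : ℝ → ℝ := fun t => p.conditionalLaplace a τ g (p.pathGain ξ t)
    * (2 * Real.pi * p.lamB * (p.kappa ξ t * t)) with hF
  set T : Ω → ℝ := fun ω => expNeg (ENNReal.ofReal a * N.fadingThreshold τ g ω) with hT
  have hTi : Integrable T P := integrable_expNeg (N.measurable_mul_fadingThreshold a τ g)
  -- exhaustion of the serving distances by the intervals `(1 / (n + 1), n + 1]`
  let δ : ℕ → ℝ := fun n => 1 / ((n : ℝ) + 1)
  let R : ℕ → ℝ := fun n => (n : ℝ) + 1
  have hδ : ∀ n, 0 < δ n := fun n => by positivity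
  have hδ1 : ∀ n, δ n ≤ 1 := fun n => by
    rw [div_le_one (by positivity)]; linarith [n.cast_nonneg (α := ℝ)]
  have hR1 : ∀ n, 1 ≤ R n := fun n => by simp [R]
  have hδR : ∀ n, δ n ≤ R n := fun n => (hδ1 n).trans (hR1 n)
  have hδa : Antitone δ := fun m n h => Nat.one_div_le_one_div h
  have hRm : Monotone R := fun m n h => by simp only [R]; gcongr
  have hδlim : ∀ t : ℝ, 0 < t → ∃ n, δ n < t := fun t ht => exists_nat_one_div_lt ht
  have hRlim : ∀ t : ℝ, ∃ n, t < R n := fun t => by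
    obtain ⟨n, hn⟩ := exists_nat_gt t
    exact ⟨n, hn.trans (lt_add_one _)⟩
  have hpos : ∀ t, 0 < t → 0 ≤ F t := fun t ht =>
    mul_nonneg (expNeg_nonneg _) (hp.serverDensity_nonneg ξ ht)
  let S : ℕ → Set Ω := fun n => N.servedCell ξ (p.pathGain ξ (R n)) (p.pathGain ξ (δ n))
  have hcell : ∀ n, ∫⁻ ω in S n, ENNReal.ofReal (T ω) ∂P
      = ∫⁻ t in Ioc (δ n) (R n), ENNReal.ofReal (F t) := by
    intro n
    obtain ⟨h1, h2⟩ := N.integral_servedCell hp a τ hg ξ (hδ n) (hδR n)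
    rw [← ofReal_integral_eq_lintegral_ofReal hTi.integrableOn
      (Eventually.of_forall fun _ => expNeg_nonneg _), h2, intervalIntegral.integral_of_le (hδR n),
      ofReal_integral_eq_lintegral_ofReal]
    · exact (intervalIntegrable_iff_integrableOn_Ioc_of_le (hδR n)).1 h1
    · exact (ae_restrict_iff' measurableSet_Ioc).2
        (Eventually.of_forall fun t ht => hpos t ((hδ n).trans ht.1))
  have hSm : Monotone S := by
    intro m n h ω hω
    obtain ⟨⟨he, h1, h2⟩, hs⟩ := hω
    refine ⟨⟨he, lt_of_le_of_lt ?_ h1, h2.trans ?_⟩, hs⟩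
    · exact (hp.pathGain_le_iff ξ ((hδ m).trans_le (hδR m)) ((hδ n).trans_le (hδR n))).2 (hRm h)
    · exact (hp.pathGain_le_iff ξ (hδ n) (hδ m)).2 (hδa h)
  have hIm : Monotone fun n => Ioc (δ n) (R n) := fun m n h =>
    Ioc_subset_Ioc (hδa h) (hRm h)
  have hIU : ⋃ n, Ioc (δ n) (R n) = Ioi (0 : ℝ) := by
    ext t
    simp only [mem_iUnion, mem_Ioc, mem_Ioi]
    constructor
    · rintro ⟨n, h1, _⟩; exact (hδ n).trans h1
    · intro ht
      obtain ⟨n, hn⟩ := hδlim t ht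
      obtain ⟨m, hm⟩ := hRlim t
      exact ⟨max n m, (hδa (le_max_left n m)).trans_lt hn, hm.le.trans (hRm (le_max_right n m))⟩
  have hSU : (⋃ n, S n : Set Ω) =ᵐ[P] N.assoc ξ := by
    filter_upwards [N.ae_isServer hp, N.ae_dist_pos hp] with ω hs hd
    refine propext ?_
    change ω ∈ ⋃ n, S n ↔ ω ∈ N.assoc ξ
    rw [mem_iUnion]
    constructor
    · rintro ⟨n, hn⟩; exact hn.2
    · intro hω
      have hst : p.stateOf (N.config ω (N.serving ω)) = ξ := hω
      have hd0 : 0 < N.dist (N.serving ω) ω := hd _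
      obtain ⟨n, hn⟩ := hδlim _ hd0
      obtain ⟨m, hm⟩ := hRlim (N.dist (N.serving ω) ω)
      have hgain : p.gainOf (N.config ω (N.serving ω)) = p.pathGain ξ (N.dist (N.serving ω) ω) := by
        rw [Params.gainOf, hst]; rfl
      refine ⟨max n m, ⟨hs.1, ?_, ?_⟩, hst⟩
      · rw [hgain, ← not_le, hp.pathGain_le_iff ξ ((hδ _).trans_le (hδR _)) hd0, not_le]
        exact hm.trans_le (hRm (le_max_right n m))
      · rw [hgain, hp.pathGain_le_iff ξ (hδ _) hd0]
        exact (hδa (le_max_left n m)).trans hn.le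
  rw [← setLIntegral_congr hSU, ← hIU, setLIntegral_iUnion_of_directed _ hSm.directed_le,
    setLIntegral_iUnion_of_directed _ hIm.directed_le]
  exact iSup_congr hcell

end Network

/-! ### The exponents of the interference -/

namespace Params

variable {p : Params}

lemma Valid.G_pos (hp : p.Valid) (k : Fin 4) : 0 < p.G k := by
  have h1 := hp.GgMax_pos
  have h2 := hp.GgMin_pos
  have h3 := hp.GuMax_pos
  have h4 := hp.GuMin_pos
  fin_cases k
  exacts [mul_pos h1 h3, mul_pos h1 h4, mul_pos h2 h3, mul_pos h2 h4]

/-- Exponent of the interferers in state `ζ` if the serving link is in state `ξ` and has length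
`x`. -/
def interferenceExponent (p : Params) (ξ ζ : LinkType) (a τ g x : ℝ) : ℝ≥0∞ :=
  ENNReal.ofReal (2 * Real.pi * p.lamB) * ∑ k : Fin 4, ENNReal.ofReal (p.prob k) *
    ∫⁻ t in Ioi (p.exclusionRadius ξ ζ x), ENNReal.ofReal
      (H (p.m ζ) (a * τ * p.G k / g * (p.pathGain ζ t / p.pathGain ξ x) / p.m ζ)
        * p.kappa ζ t * t)

lemma Valid.pathGain_div (hp : p.Valid) (ξ ζ : LinkType) {x t : ℝ} (hx : 0 < x) (ht : 0 < t) :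
    p.pathGain ζ t / p.pathGain ξ x = p.C ζ * (x ^ 2 + p.dh ^ 2) ^ (p.eta ξ / 2)
      / (p.C ξ * (t ^ 2 + p.dh ^ 2) ^ (p.eta ζ / 2)) := by
  have h1 := hp.C_pos ξ
  have h2 : 0 < (x ^ 2 + p.dh ^ 2) ^ (p.eta ξ / 2) := by positivity
  have h3 : 0 < (t ^ 2 + p.dh ^ 2) ^ (p.eta ζ / 2) := by positivity
  rw [pathGain_eq_div, pathGain_eq_div]
  field_simp

lemma Valid.Q_eq (hp : p.Valid) (ξ : LinkType) (a τ : ℝ) {g x : ℝ} (hg : 0 < g) (q : ℕ)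
    (hx : 0 < x) : p.Q ξ a τ g q x = p.interferenceExponent ξ ξ (q * a) τ g x := by
  unfold Q interferenceExponent
  rw [exclusionRadius_self]
  congr 1
  refine Finset.sum_congr rfl fun k _ => ?_
  congr 1
  refine setLIntegral_congr_fun measurableSet_Ioi fun t ht => ?_
  have ht0 : 0 < t := hx.trans ht
  have h1 := hp.C_pos ξ
  have h3 : 0 < (t ^ 2 + p.dh ^ 2) ^ (p.eta ξ / 2) := by positivity
  have h4 : (0 : ℝ) < p.m ξ := by exact_mod_cast hp.m_pos ξ
  rw [hp.pathGain_div ξ ξ hx ht0]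
  congr 4
  field_simp

lemma Valid.V_eq (hp : p.Valid) (ξ : LinkType) (a τ : ℝ) {g x : ℝ} (hg : 0 < g) (q : ℕ)
    (hx : 0 < x) : p.V ξ a τ g q x = p.interferenceExponent ξ ξ.other (q * a) τ g x := by
  unfold V interferenceExponent
  rw [exclusionRadius_other]
  congr 1
  refine Finset.sum_congr rfl fun k _ => ?_
  congr 1
  refine setLIntegral_congr_fun measurableSet_Ioi fun t ht => ?_
  have ht0 : 0 < t := (E_nonneg ξ x).trans_lt ht
  have h1 := hp.C_pos ξ
  have h3 : 0 < (t ^ 2 + p.dh ^ 2) ^ (p.eta ξ.other / 2) := by positivity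
  have h4 : (0 : ℝ) < p.m ξ.other := by exact_mod_cast hp.m_pos ξ.other
  rw [hp.pathGain_div ξ ξ.other hx ht0]
  congr 4
  field_simp

lemma H_zero (m : ℕ) : H m 0 = 0 := by simp [H]

lemma H_nonneg (m : ℕ) {x : ℝ} (hx : 0 ≤ x) : 0 ≤ H m x := by
  have h1 : (1 : ℝ) ≤ (1 + x) ^ m := one_le_pow₀ (by linarith)
  have h2 : 1 / (1 + x) ^ m ≤ 1 := (div_le_one (by linarith)).2 h1
  rw [H]; linarith

lemma lintegral_oneSubExpNeg_gamma {m : ℕ} (hm : 1 ≤ m) {c : ℝ} (hc : 0 ≤ c) :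
    ∫⁻ h, oneSubExpNeg (ENNReal.ofReal (c * h)) ∂(gammaMeasure m m)
      = ENNReal.ofReal (H m (c / m)) := by
  have := isProbabilityMeasure_gamma_nat hm
  have hi : Integrable (fun h => expNeg (ENNReal.ofReal (c * h))) (gammaMeasure m m) :=
    integrable_expNeg (by fun_prop)
  have h1 : ∫ h, (1 - expNeg (ENNReal.ofReal (c * h))) ∂(gammaMeasure m m) = H m (c / m) := by
    rw [integral_sub (integrable_const _) hi, integral_expNeg_gamma hm hc]
    simp
  have hi' : Integrable (fun h => 1 - expNeg (ENNReal.ofReal (c * h))) (gammaMeasure m m) :=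
    (integrable_const _).sub hi
  rw [← h1, ofReal_integral_eq_lintegral_ofReal hi'
    (Eventually.of_forall fun h => sub_nonneg.2 (expNeg_le_one _))]
  rfl

/-- Contribution of the links in state `ζ` to the exponent: those that would be better servers
must be absent, the others interfere. -/
lemma Valid.radialIntegral_loss (hp : p.Valid) {a τ g x : ℝ} (ha : 0 ≤ a) (hτ : 0 ≤ τ)
    (hg : 0 < g) (hx : 0 < x) (ξ ζ : LinkType) [DecidableLT ℝ] :
    ENNReal.ofReal (2 * Real.pi * p.lamB) * p.radialIntegral ζ (fun r h G =>
        if p.pathGain ξ x < p.pathGain ζ r then 1 else oneSubExpNeg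
          (p.powerScale a τ g (p.pathGain ξ x) * ENNReal.ofReal (p.Pb * G * p.pathGain ζ r * h)))
      = ENNReal.ofReal (p.radialMass ζ (p.exclusionRadius ξ ζ x))
        + p.interferenceExponent ξ ζ a τ g x := by
  have := isProbabilityMeasure_gamma_nat (hp.m_pos ζ)
  set e := p.exclusionRadius ξ ζ x with he
  have he0 : 0 ≤ e := exclusionRadius_nonneg ξ ζ hx.le
  have hu := hp.pathGain_pos ξ hx
  have hPb := hp.Pb_pos
  have hm : (0 : ℝ) < p.m ζ := by exact_mod_cast hp.m_pos ζ
  set I : ℝ → ℝ≥0∞ := fun r => ENNReal.ofReal (p.kappa ζ r * r) * ∑ k, ENNReal.ofReal (p.prob k)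
    * ∫⁻ h, (if p.pathGain ξ x < p.pathGain ζ r then 1 else oneSubExpNeg
          (p.powerScale a τ g (p.pathGain ξ x)
            * ENNReal.ofReal (p.Pb * p.G k * p.pathGain ζ r * h)))
      ∂(gammaMeasure (p.m ζ) (p.m ζ)) with hI
  have hrad : p.radialIntegral ζ (fun r h G =>
        if p.pathGain ξ x < p.pathGain ζ r then 1 else oneSubExpNeg
          (p.powerScale a τ g (p.pathGain ξ x) * ENNReal.ofReal (p.Pb * G * p.pathGain ζ r * h)))
      = ∫⁻ r in Ioi (0 : ℝ), I r := rfl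
  have hnear : ∫⁻ r in Ioc 0 e, I r = ∫⁻ r in Ioc 0 e, ENNReal.ofReal (p.kappa ζ r * r) := by
    refine setLIntegral_congr_fun_ae measurableSet_Ioc ?_
    filter_upwards [Measure.ae_ne volume e] with r hre hr
    have h1 : p.pathGain ξ x < p.pathGain ζ r := by
      rw [← not_le, hp.pathGain_le_iff_exclusionRadius ξ ζ hx hr.1, not_le]
      exact lt_of_le_of_ne hr.2 hre
    simp only [hI, h1, if_true, lintegral_one, measure_univ, mul_one, hp.sum_prob]
  let c : Fin 4 → ℝ → ℝ := fun k t =>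
    a * τ * p.G k / g * (p.pathGain ζ t / p.pathGain ξ x) / p.m ζ
  have hfar : ∫⁻ r in Ioi e, I r = ∑ k, ENNReal.ofReal (p.prob k)
      * ∫⁻ t in Ioi e, ENNReal.ofReal (H (p.m ζ) (c k t) * p.kappa ζ t * t) := by
    have hHm : ∀ k, Measurable fun t => ENNReal.ofReal (H (p.m ζ) (c k t) * p.kappa ζ t * t) := by
      intro k
      have h1 := p.measurable_pathGain ζ
      have h2 := p.measurable_kappa ζ
      unfold H
      fun_prop
    simp_rw [← fun k => lintegral_const_mul (μ := volume.restrict (Ioi e))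
      (ENNReal.ofReal (p.prob k)) (hHm k)]
    rw [← lintegral_finsetSum _ fun k _ => (hHm k).const_mul _]
    refine setLIntegral_congr_fun measurableSet_Ioi fun r hr => ?_
    have hr0 : 0 < r := he0.trans_lt hr
    have h1 : ¬ p.pathGain ξ x < p.pathGain ζ r := by
      rw [not_lt, hp.pathGain_le_iff_exclusionRadius ξ ζ hx hr0]
      exact le_of_lt hr
    have hv := hp.pathGain_pos ζ hr0
    simp only [hI, h1, if_false]
    rw [Finset.mul_sum]
    refine Finset.sum_congr rfl fun k _ => ?_
    have hGk := hp.G_pos k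
    have h2 : ∀ h : ℝ, p.powerScale a τ g (p.pathGain ξ x)
        * ENNReal.ofReal (p.Pb * p.G k * p.pathGain ζ r * h)
        = ENNReal.ofReal (a * τ * p.G k / g * (p.pathGain ζ r / p.pathGain ξ x) * h) := by
      intro h
      rw [powerScale, ← ENNReal.ofReal_mul ha, ← ENNReal.ofReal_div_of_pos (by positivity),
        ← ENNReal.ofReal_mul (by positivity)]
      congr 1
      field_simp
    have hck : 0 ≤ a * τ * p.G k / g * (p.pathGain ζ r / p.pathGain ξ x) := by positivity
    simp_rw [h2]
    rw [lintegral_oneSubExpNeg_gamma (hp.m_pos ζ) hck,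
      mul_assoc (H (p.m ζ) (c k r)), ENNReal.ofReal_mul (p := H (p.m ζ) (c k r))
        (H_nonneg _ (div_nonneg hck hm.le))]
    ring
  have hmass : ENNReal.ofReal (2 * Real.pi * p.lamB)
      * ∫⁻ r in Ioc 0 e, ENNReal.ofReal (p.kappa ζ r * r) = ENNReal.ofReal (p.radialMass ζ e) := by
    rw [hp.lintegral_kappa ζ le_rfl he0, radialMass_zero, sub_zero]
  rw [hrad, ← Ioc_union_Ioi_eq_Ioi he0, lintegral_union measurableSet_Ioi
    (disjoint_left.2 fun t h1 h2 => not_lt.2 h1.2 h2), hnear, hfar, mul_add, hmass]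
  rfl

lemma Valid.lintegral_lossExponent (hp : p.Valid) {a τ g x : ℝ} (ha : 0 ≤ a) (hτ : 0 ≤ τ)
    (hg : 0 < g) (hx : 0 < x) (ξ : LinkType) :
    ∫⁻ z, oneSubExpNeg (p.lossExponent a τ g (p.pathGain ξ x) z) ∂p.intensity
      = (ENNReal.ofReal (p.radialMass ξ x) + p.interferenceExponent ξ ξ a τ g x)
        + (ENNReal.ofReal (p.radialMass ξ.other (p.E ξ x))
          + p.interferenceExponent ξ ξ.other a τ g x) := by
  classical
  let φ : LinkType → ℝ → ℝ → ℝ → ℝ≥0∞ := fun ζ r h G =>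
    if p.pathGain ξ x < p.pathGain ζ r then 1 else oneSubExpNeg
      (p.powerScale a τ g (p.pathGain ξ x) * ENNReal.ofReal (p.Pb * G * p.pathGain ζ r * h))
  have hφ : ∀ ζ, Measurable fun q : ℝ × ℝ × ℝ => φ ζ q.1 q.2.1 q.2.2 := by
    intro ζ
    have h1 : Measurable fun q : ℝ × ℝ × ℝ => p.pathGain ζ q.1 :=
      (p.measurable_pathGain ζ).comp measurable_fst
    exact Measurable.ite (measurableSet_lt measurable_const h1) measurable_const (by fun_prop)
  have hloss : ∀ z : MarkedPoint, oneSubExpNeg (p.lossExponent a τ g (p.pathGain ξ x) z)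
      = if z.2.1 = true then φ (p.stateOf z) ‖z.1‖ (fadingOf (p.stateOf z) z)
        (z.2.2.2.2.2.1 * z.2.2.2.2.2.2) else 0 := by
    intro z
    simp only [lossExponent, φ, powerOf]
    by_cases h1 : z.2.1 = true
    · simp only [h1, if_true]
      by_cases h2 : p.pathGain ξ x < p.gainOf z
      · have h2' : p.pathGain ξ x < p.pathGain (p.stateOf z) ‖z.1‖ := h2
        rw [if_pos h2, if_pos h2', oneSubExpNeg_top]
      · have h2' : ¬ p.pathGain ξ x < p.pathGain (p.stateOf z) ‖z.1‖ := h2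
        rw [if_neg h2, if_neg h2']
        rfl
    · rw [if_neg h1, if_neg h1, oneSubExpNeg_zero]
  simp_rw [hloss]
  rw [hp.lintegral_intensity hφ, mul_add,
    hp.radialIntegral_loss ha hτ hg hx, hp.radialIntegral_loss ha hτ hg hx]
  cases ξ
  · rfl
  · exact add_comm _ _

/-- The weight of the serving distance `x` in the analytic form of the theorem. -/
lemma Valid.conditionalLaplace_mul (hp : p.Valid) {a τ g x : ℝ} (ha : 0 ≤ a) (hτ : 0 ≤ τ)
    (hg : 0 < g) (hx : 0 < x) (ξ : LinkType) :
    p.conditionalLaplace a τ g (p.pathGain ξ x) * (2 * Real.pi * p.lamB * (p.kappa ξ x * x))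
      = Real.exp (-(a * (x ^ 2 + p.dh ^ 2) ^ (p.eta ξ / 2) * τ * p.sigmaSq / (p.Pb * p.C ξ * g)))
        * expNeg (p.interferenceExponent ξ ξ a τ g x + p.interferenceExponent ξ ξ.other a τ g x)
        * (p.voidProb ξ x * p.fNearest ξ x) := by
  have hPb := hp.Pb_pos
  have hC := hp.C_pos ξ
  have hσ := hp.sigmaSq_pos
  have hX : 0 < (x ^ 2 + p.dh ^ 2) ^ (p.eta ξ / 2) := by positivity
  have hu := hp.pathGain_pos ξ hx
  have hnoise : p.powerScale a τ g (p.pathGain ξ x) * ENNReal.ofReal p.sigmaSq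
      = ENNReal.ofReal (a * (x ^ 2 + p.dh ^ 2) ^ (p.eta ξ / 2) * τ * p.sigmaSq
        / (p.Pb * p.C ξ * g)) := by
    rw [powerScale, ← ENNReal.ofReal_mul ha, ← ENNReal.ofReal_div_of_pos (by positivity),
      ← ENNReal.ofReal_mul (by positivity), pathGain_eq_div]
    congr 1
    field_simp
  have hself : 0 ≤ p.radialMass ξ x := by
    rw [← radialMass_zero (p := p) ξ]; exact hp.radialMass_mono ξ le_rfl hx.le
  have hother : 0 ≤ p.radialMass ξ.other (p.E ξ x) := by
    rw [← radialMass_zero (p := p) ξ.other]; exact hp.radialMass_mono _ le_rfl (E_nonneg ξ x)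
  have hvoid : p.voidProb ξ x = Real.exp (-p.radialMass ξ.other (p.E ξ x)) := rfl
  have hnear : p.fNearest ξ x = 2 * Real.pi * p.lamB * x * p.kappa ξ x
      * Real.exp (-p.radialMass ξ x) := rfl
  rw [conditionalLaplace, hp.lintegral_lossExponent ha hτ hg hx, hnoise, hvoid, hnear]
  simp only [expNeg_add]
  rw [expNeg_ofReal (by positivity), expNeg_ofReal hself, expNeg_ofReal hother]
  ring

lemma interferenceExponent_zero (ξ ζ : LinkType) (τ g x : ℝ) :
    p.interferenceExponent ξ ζ 0 τ g x = 0 := by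
  simp [interferenceExponent, H_zero]

end Params

/-! ### Association probability and Laplace transform of the threshold -/

/-- For a null event both sides are `0`. -/
lemma integral_cond {Ω : Type*} [MeasurableSpace Ω] (P : Measure Ω) (s : Set Ω) (f : Ω → ℝ) :
    ∫ ω, f ω ∂(cond P s) = (P.real s)⁻¹ * ∫ ω in s, f ω ∂P := by
  rw [ProbabilityTheory.cond, integral_smul_measure, ENNReal.toReal_inv]
  rfl

namespace Network

variable {p : Params} {Ω : Type*} [MeasurableSpace Ω] {P : Measure Ω} (N : Network p P)
  [IsProbabilityMeasure P]

/-- Mean of `exp (-a T)` on the event that the serving link is in state `ξ`. -/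
lemma setIntegral_assoc (hp : p.Valid) {a τ g : ℝ} (ha : 0 ≤ a) (hτ : 0 ≤ τ) (hg : 0 < g)
    (ξ : LinkType) :
    ∫ ω in N.assoc ξ, expNeg (ENNReal.ofReal a * N.fadingThreshold τ g ω) ∂P
      = ∫ x in Ioi (0 : ℝ),
        Real.exp (-(a * (x ^ 2 + p.dh ^ 2) ^ (p.eta ξ / 2) * τ * p.sigmaSq / (p.Pb * p.C ξ * g)))
          * expNeg (p.interferenceExponent ξ ξ a τ g x + p.interferenceExponent ξ ξ.other a τ g x)
          * (p.voidProb ξ x * p.fNearest ξ x) := by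
  have hT := N.measurable_mul_fadingThreshold a τ g
  have hΨm : Measurable fun t => p.conditionalLaplace a τ g (p.pathGain ξ t) :=
    (hp.conditionalLaplace_mono a τ hg).measurable.comp (p.measurable_pathGain ξ)
  have hκm := p.measurable_kappa ξ
  rw [← setIntegral_congr_fun measurableSet_Ioi fun x hx =>
      hp.conditionalLaplace_mul ha hτ hg hx ξ,
    integral_eq_lintegral_of_nonneg_ae (Eventually.of_forall fun _ => expNeg_nonneg _)
      (by fun_prop : Measurable fun ω => expNeg (ENNReal.ofReal a
        * N.fadingThreshold τ g ω)).aestronglyMeasurable,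
    integral_eq_lintegral_of_nonneg_ae _ (by fun_prop), N.lintegral_assoc hp a τ hg ξ]
  exact (ae_restrict_iff' measurableSet_Ioi).2 (Eventually.of_forall fun x hx =>
    mul_nonneg (expNeg_nonneg _) (hp.serverDensity_nonneg ξ hx))

/-- The association probability. -/
lemma measureReal_assoc (hp : p.Valid) (ξ : LinkType) : P.real (N.assoc ξ) = p.A ξ := by
  have h := N.setIntegral_assoc hp (a := 0) (τ := 1) (g := 1) le_rfl zero_le_one one_pos ξ
  simpa [expNeg_zero, Params.interferenceExponent_zero, Params.A] using h

/-- One summand of the analytic expression, as a conditional expectation. -/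
lemma integral_cond_assoc (hp : p.Valid) {a τ g : ℝ} (ha : 0 ≤ a) (hτ : 0 ≤ τ) (hg : 0 < g)
    (ξ : LinkType) (q : ℕ) :
    ∫ ω, expNeg (ENNReal.ofReal a * N.fadingThreshold τ g ω) ^ q ∂(cond P (N.assoc ξ))
      = ∫ x in Ioi (0 : ℝ),
        Real.exp (-(q * a * (x ^ 2 + p.dh ^ 2) ^ (p.eta ξ / 2) * τ * p.sigmaSq
          / (p.Pb * p.C ξ * g)))
        * expNeg (p.Q ξ a τ g q x + p.V ξ a τ g q x) * p.fX ξ x := by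
  have h1 : ∀ ω, expNeg (ENNReal.ofReal a * N.fadingThreshold τ g ω) ^ q
      = expNeg (ENNReal.ofReal (q * a) * N.fadingThreshold τ g ω) := by
    intro ω
    rw [← expNeg_nat_mul, ENNReal.ofReal_mul (Nat.cast_nonneg q), ENNReal.ofReal_natCast, mul_assoc]
  simp_rw [h1]
  rw [integral_cond, N.setIntegral_assoc hp (mul_nonneg (Nat.cast_nonneg q) ha) hτ hg,
    N.measureReal_assoc hp, ← integral_const_mul]
  refine setIntegral_congr_fun measurableSet_Ioi fun x hx => ?_
  rw [hp.Q_eq ξ a τ hg q hx, hp.V_eq ξ a τ hg q hx, Params.fX]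
  ring

end Network

/-! ### Conditional backhaul probabilities -/

lemma measurable_alzerTail (m : ℕ) (a : ℝ) : Measurable (alzerTail m a) := by
  unfold alzerTail
  fun_prop

lemma alzerTail_mem (m : ℕ) (a : ℝ) (t : ℝ≥0∞) : 0 ≤ alzerTail m a t ∧ alzerTail m a t ≤ 1 := by
  have h1 := expNeg_nonneg (ENNReal.ofReal a * t)
  have h2 := expNeg_le_one (ENNReal.ofReal a * t)
  have h3 : 0 ≤ (1 - expNeg (ENNReal.ofReal a * t)) ^ m := pow_nonneg (by linarith) m
  have h4 : (1 - expNeg (ENNReal.ofReal a * t)) ^ m ≤ 1 := pow_le_one₀ (by linarith) (by linarith)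
  unfold alzerTail
  constructor <;> linarith

lemma one_sub_one_sub_pow (m : ℕ) (y : ℝ) :
    1 - (1 - y) ^ m
      = ∑ q ∈ Finset.Icc 1 m, (-1 : ℝ) ^ (q + 1) * (Nat.choose m q : ℝ) * y ^ q := by
  have h : (1 - y) ^ m = ∑ q ∈ Finset.range (m + 1), (-y) ^ q * (Nat.choose m q : ℝ) := by
    rw [sub_eq_neg_add, add_pow]
    simp
  rw [h, Finset.sum_range_succ', Finset.range_eq_Ico,
    Finset.sum_Ico_add' (fun q => (-y) ^ q * (Nat.choose m q : ℝ)) 0 m 1]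
  simp only [pow_zero, Nat.choose_zero_right, Nat.cast_one, mul_one, zero_add]
  have h2 : Finset.Ico 1 (m + 1) = Finset.Icc 1 m := by ext; simp
  rw [h2, sub_add_cancel_right, ← Finset.sum_neg_distrib]
  refine Finset.sum_congr rfl fun q _ => ?_
  rw [neg_pow y, pow_succ]
  ring

namespace Network

variable {p : Params} {Ω : Type*} [MeasurableSpace Ω] {P : Measure Ω} (N : Network p P)

lemma assoc_nlos : N.assoc .nlos = (N.assoc .los)ᶜ := by
  ext ω
  change N.state _ ω = _ ↔ ¬ N.state _ ω = _
  cases N.state (N.serving ω) ω <;> simp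

lemma condS_eq (ξ : LinkType) (τ g : ℝ) :
    N.condS ξ τ g = (P.real (N.assoc ξ))⁻¹
      * P.real (N.assoc ξ ∩ {ω | ENNReal.ofReal τ ≤ N.sinr g ω}) := by
  rw [condS, measureReal_def, cond_apply (N.measurableSet_assoc ξ), ENNReal.toReal_mul,
    ENNReal.toReal_inv]
  rfl

lemma integrable_alzerTail (ξ : LinkType) (a τ g : ℝ) :
    Integrable (fun ω => alzerTail (p.m ξ) a (N.fadingThreshold τ g ω)) (cond P (N.assoc ξ)) :=
  integrable_of_mem_unit ((measurable_alzerTail _ _).comp (N.measurable_fadingThreshold τ g))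
    (fun _ => (alzerTail_mem _ _ _).1) (fun _ => (alzerTail_mem _ _ _).2)

lemma integrable_gammaTail (hp : p.Valid) (ξ : LinkType) (τ g : ℝ) :
    Integrable (fun ω => gammaTail (p.m ξ) (N.fadingThreshold τ g ω)) (cond P (N.assoc ξ)) := by
  have := isProbabilityMeasure_gamma_nat (hp.m_pos ξ)
  exact integrable_of_mem_unit
    ((measurable_gammaTail (hp.m_pos ξ)).comp (N.measurable_fadingThreshold τ g))
    (fun _ => measureReal_nonneg) (fun _ => measureReal_le_one)

variable [IsProbabilityMeasure P]

/-- The threshold is the least fading gain for which the ratio reaches `τ`. -/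
lemma ae_le_sinr_iff (hp : p.Valid) (τ : ℝ) {g : ℝ} (hg : 0 < g) :
    ∀ᵐ ω ∂P, ENNReal.ofReal τ ≤ N.sinr g ω
      ↔ N.fadingThreshold τ g ω ≤ ENNReal.ofReal (N.servingFading ω) := by
  filter_upwards [N.ae_dist_pos hp] with ω hd
  have hc : 0 < p.Pb * g * N.gain (N.serving ω) ω :=
    mul_pos (mul_pos hp.Pb_pos hg) (hp.pathGain_pos _ (hd _))
  have hσ : ENNReal.ofReal p.sigmaSq + N.interference ω ≠ 0 := by
    have := hp.sigmaSq_pos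
    simp [this]
  rw [sinr, fadingThreshold, ENNReal.le_div_iff_mul_le (Or.inl hσ) (Or.inr ENNReal.ofReal_ne_top),
    ENNReal.div_le_iff (by simpa using hc) ENNReal.ofReal_ne_top, ENNReal.ofReal_mul hc.le, mul_comm
    (ENNReal.ofReal (N.servingFading ω))]

lemma condS_eq_integral_gammaTail (hp : p.Valid) (ξ : LinkType) (τ : ℝ) {g : ℝ} (hg : 0 < g) :
    N.condS ξ τ g
      = ∫ ω, gammaTail (p.m ξ) (N.fadingThreshold τ g ω) ∂(cond P (N.assoc ξ)) := by
  have hm : Measurable fun ω => gammaTail (p.m ξ) (N.fadingThreshold τ g ω) :=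
    (measurable_gammaTail (hp.m_pos ξ)).comp (N.measurable_fadingThreshold τ g)
  have h0 : ∀ ω, 0 ≤ gammaTail (p.m ξ) (N.fadingThreshold τ g ω) := fun ω => measureReal_nonneg
  have hE : (N.assoc ξ ∩ {ω | ENNReal.ofReal τ ≤ N.sinr g ω} : Set Ω) =ᵐ[P]
      (N.assoc ξ ∩ {ω | N.fadingThreshold τ g ω ≤ ENNReal.ofReal (N.servingFading ω)} : Set Ω) := by
    filter_upwards [N.ae_le_sinr_iff hp τ hg] with ω hω
    exact propext (and_congr_right fun _ => hω)
  rw [N.condS_eq, integral_cond, measureReal_def P, measureReal_def P, measure_congr hE,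
    N.measure_threshold_le_fading hp ξ τ g,
    integral_eq_lintegral_of_nonneg_ae (Eventually.of_forall fun ω => h0 ω)
      hm.aestronglyMeasurable]

/-- The analytic expression is the conditional mean of the Alzer expression of the threshold: it
arises by binomial expansion. -/
lemma integral_alzerTail (hp : p.Valid) (ξ : LinkType) {a τ g : ℝ} (ha : 0 ≤ a) (hτ : 0 ≤ τ)
    (hg : 0 < g) :
    ∫ ω, alzerTail (p.m ξ) a (N.fadingThreshold τ g ω) ∂(cond P (N.assoc ξ))
      = p.formula ξ a τ g := by
  have hT := N.measurable_mul_fadingThreshold a τ g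
  simp_rw [alzerTail, one_sub_one_sub_pow]
  rw [integral_finsetSum]
  · unfold Params.formula
    refine Finset.sum_congr rfl fun q _ => ?_
    rw [integral_const_mul, N.integral_cond_assoc hp ha hτ hg]
  · intro q _
    refine Integrable.const_mul (integrable_of_mem_unit (by fun_prop)
      (fun ω => pow_nonneg (expNeg_nonneg _) q)
      (fun ω => pow_le_one₀ (expNeg_nonneg _) (expNeg_le_one _))) _

lemma condS_le_formula (hp : p.Valid) (ξ : LinkType) {τ g : ℝ} (hτ : 0 ≤ τ) (hg : 0 < g) :
    N.condS ξ τ g ≤ p.formula ξ (alzerRate (p.m ξ)) τ g := by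
  rw [N.condS_eq_integral_gammaTail hp ξ τ hg,
    ← N.integral_alzerTail hp ξ (alzerRate_pos (hp.m_pos ξ)).le hτ hg]
  exact integral_mono (N.integrable_gammaTail hp ξ τ g) (N.integrable_alzerTail ξ _ τ g)
    fun ω => gammaTail_le_alzerTail (hp.m_pos ξ) _

lemma formula_le_condS (hp : p.Valid) (ξ : LinkType) {τ g : ℝ} (hτ : 0 ≤ τ) (hg : 0 < g) :
    p.formula ξ (p.m ξ) τ g ≤ N.condS ξ τ g := by
  rw [N.condS_eq_integral_gammaTail hp ξ τ hg,
    ← N.integral_alzerTail hp ξ (Nat.cast_nonneg _) hτ hg]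
  exact integral_mono (N.integrable_alzerTail ξ _ τ g) (N.integrable_gammaTail hp ξ τ g)
    fun ω => alzerTail_le_gammaTail (hp.m_pos ξ) _

/-- Decomposition of the backhaul probability according to the state of the serving link. -/
lemma S_eq (hp : p.Valid) (τ g : ℝ) :
    N.S τ g = p.A .los * N.condS .los τ g + p.A .nlos * N.condS .nlos τ g := by
  have h : ∀ ξ, p.A ξ * N.condS ξ τ g
      = P.real ({ω | ENNReal.ofReal τ ≤ N.sinr g ω} ∩ N.assoc ξ) := by
    intro ξ
    rw [← N.measureReal_assoc hp, N.condS_eq, inter_comm]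
    by_cases h0 : P.real (N.assoc ξ) = 0
    · have h1 : P.real ({ω | ENNReal.ofReal τ ≤ N.sinr g ω} ∩ N.assoc ξ) = 0 :=
        le_antisymm (h0 ▸ measureReal_mono inter_subset_right) measureReal_nonneg
      rw [h1, h0, zero_mul]
    · rw [mul_inv_cancel_left₀ h0]
  rw [h, h, N.assoc_nlos, ← sdiff_eq, measureReal_inter_add_sdiff (N.measurableSet_assoc .los)]
  rfl

end Network

/-! ### Steering errors -/

namespace Params

variable (p : Params)

/-- The signal-to-interference-and-noise ratio as a functional of the marked points. -/
def sinrOf (g : ℝ) (c : ℕ → MarkedPoint) : ℝ≥0∞ :=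
  ENNReal.ofReal (p.Pb * g * p.gainOf (c (p.server c))
      * fadingOf (p.stateOf (c (p.server c))) (c (p.server c)))
    / (ENNReal.ofReal p.sigmaSq + p.interferenceOf c)

lemma measurable_sinrOf (g : ℝ) : Measurable (p.sinrOf g) := by
  have h1 : Measurable fun c : ℕ → MarkedPoint => p.gainOf (c (p.server c)) :=
    p.measurable_gainOf.comp p.measurable_serverPoint
  have h2 : Measurable fun c : ℕ → MarkedPoint =>
      fadingOf (p.stateOf (c (p.server c))) (c (p.server c)) :=
    (p.measurable_state_dep measurable_fadingOf).comp p.measurable_serverPoint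
  have h3 := p.measurable_interferenceOf
  unfold sinrOf
  fun_prop

end Params

namespace Network

variable {p : Params} {Ω : Type*} [MeasurableSpace Ω] {P : Measure Ω} (N : Network p P)

lemma sinr_eq (g : ℝ) (ω : Ω) : N.sinr g ω = p.sinrOf g (N.config ω) := by
  rw [sinr, interference_eq, servingFading, fading_eq]; rfl

/-- The event of coverage depends on positions and marks only. -/
lemma exists_preimage_data (τ g : ℝ) : ∃ B, MeasurableSet B ∧
    {ω | ENNReal.ofReal τ ≤ N.sinr g ω} = N.data ⁻¹' B := by
  refine ⟨{q | ENNReal.ofReal τ ≤ p.sinrOf g (fun j => (q.1 j, q.2 j))}, ?_, ?_⟩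
  · refine measurableSet_le measurable_const ((p.measurable_sinrOf g).comp
      (measurable_pi_lambda _ fun j => ?_))
    fun_prop
  · ext ω
    change _ ≤ N.sinr g ω ↔ _
    rw [N.sinr_eq]
    rfl

end Network

section Steering

variable {Ω : Type*} [MeasurableSpace Ω] {P : Measure Ω} {εg εu : Ω → ℝ}

lemma measureReal_inter_preimage {β : Type*} [MeasurableSpace β] {Y : Ω → β}
    (h : IndepFun εg εu P) (hY : IndepFun (fun ω => (εg ω, εu ω)) Y P) {s t : Set ℝ} {B : Set β}
    (hs : MeasurableSet s) (ht : MeasurableSet t) (hB : MeasurableSet B) :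
    P.real (Y ⁻¹' B ∩ εg ⁻¹' s ∩ εu ⁻¹' t)
      = P.real (εg ⁻¹' s) * P.real (εu ⁻¹' t) * P.real (Y ⁻¹' B) := by
  have h1 := hY.measure_inter_preimage_eq_mul (s ×ˢ t) B (hs.prod ht) hB
  have h2 := h.measure_inter_preimage_eq_mul s t hs ht
  have h3 : (fun ω => (εg ω, εu ω)) ⁻¹' (s ×ˢ t) = εg ⁻¹' s ∩ εu ⁻¹' t := rfl
  rw [h3, h2] at h1
  rw [inter_assoc, inter_comm, measureReal_def, h1, ENNReal.toReal_mul, ENNReal.toReal_mul]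
  rfl

variable [IsProbabilityMeasure P]

lemma measurableSet_abs_le (c : ℝ) : MeasurableSet {x : ℝ | |x| ≤ c} :=
  measurableSet_le (by fun_prop) measurable_const

lemma measureReal_preimage_compl {ε : Ω → ℝ} (hε : Measurable ε) (c : ℝ) :
    P.real (ε ⁻¹' {x | |x| ≤ c}ᶜ) = 1 - P.real {ω | |ε ω| ≤ c} := by
  rw [preimage_compl, probReal_compl_eq_one_sub (hε (measurableSet_abs_le c))]
  rfl

/-- Mean of a function of the desired gain, which takes four values. -/
lemma integral_desiredGain (p : Params) (hg : Measurable εg) (hu : Measurable εu)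
    (h : IndepFun εg εu P) (F : ℝ → ℝ) :
    ∫ ω, F (desiredGain p (εg ω) (εu ω)) ∂P
      = P.real {ω | |εg ω| ≤ p.thG / 2} * P.real {ω | |εu ω| ≤ p.thU / 2} * F (p.GgMax * p.GuMax)
        + P.real {ω | |εg ω| ≤ p.thG / 2} * (1 - P.real {ω | |εu ω| ≤ p.thU / 2})
          * F (p.GgMax * p.GuMin)
        + (1 - P.real {ω | |εg ω| ≤ p.thG / 2}) * P.real {ω | |εu ω| ≤ p.thU / 2}
          * F (p.GgMin * p.GuMax)
        + (1 - P.real {ω | |εg ω| ≤ p.thG / 2}) * (1 - P.real {ω | |εu ω| ≤ p.thU / 2})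
          * F (p.GgMin * p.GuMin) := by
  classical
  set s : Set ℝ := {x | |x| ≤ p.thG / 2} with hs
  set t : Set ℝ := {x | |x| ≤ p.thU / 2} with ht
  have hsm : MeasurableSet s := measurableSet_abs_le _
  have htm : MeasurableSet t := measurableSet_abs_le _
  have hF : ∀ ω, F (desiredGain p (εg ω) (εu ω))
      = (εg ⁻¹' s ∩ εu ⁻¹' t).indicator (fun _ => F (p.GgMax * p.GuMax)) ω
        + (εg ⁻¹' s ∩ εu ⁻¹' tᶜ).indicator (fun _ => F (p.GgMax * p.GuMin)) ω
        + (εg ⁻¹' sᶜ ∩ εu ⁻¹' t).indicator (fun _ => F (p.GgMin * p.GuMax)) ω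
        + (εg ⁻¹' sᶜ ∩ εu ⁻¹' tᶜ).indicator (fun _ => F (p.GgMin * p.GuMin)) ω := by
    intro ω
    unfold desiredGain steeredGain
    by_cases h1 : |εg ω| ≤ p.thG / 2 <;> by_cases h2 : |εu ω| ≤ p.thU / 2 <;>
      simp [indicator, hs, ht, h1, h2]
  have hind : ∀ {s' t' : Set ℝ}, MeasurableSet s' → MeasurableSet t' →
      P.real (εg ⁻¹' s' ∩ εu ⁻¹' t') = P.real (εg ⁻¹' s') * P.real (εu ⁻¹' t') := by
    intro s' t' hs' ht'
    rw [measureReal_def, h.measure_inter_preimage_eq_mul s' t' hs' ht', ENNReal.toReal_mul]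
    rfl
  have hmeas : ∀ {s' t' : Set ℝ}, MeasurableSet s' → MeasurableSet t' →
      MeasurableSet (εg ⁻¹' s' ∩ εu ⁻¹' t') := fun hs' ht' => (hg hs').inter (hu ht')
  have hint : ∀ {s' t' : Set ℝ}, MeasurableSet s' → MeasurableSet t' → ∀ c : ℝ,
      Integrable (fun ω => (εg ⁻¹' s' ∩ εu ⁻¹' t').indicator (fun _ => c) ω) P :=
    fun hs' ht' c => (integrable_const c).indicator (hmeas hs' ht')
  have h1 := hint hsm htm (F (p.GgMax * p.GuMax))
  have h2 := hint hsm htm.compl (F (p.GgMax * p.GuMin))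
  have h3 := hint hsm.compl htm (F (p.GgMin * p.GuMax))
  have h4 := hint hsm.compl htm.compl (F (p.GgMin * p.GuMin))
  simp_rw [hF]
  rw [integral_add _ h4, integral_add _ h3, integral_add h1 h2,
    integral_indicator_const _ (hmeas hsm htm), integral_indicator_const _ (hmeas hsm htm.compl),
    integral_indicator_const _ (hmeas hsm.compl htm),
    integral_indicator_const _ (hmeas hsm.compl htm.compl), hind hsm htm, hind hsm htm.compl,
    hind hsm.compl htm, hind hsm.compl htm.compl, measureReal_preimage_compl hg,
    measureReal_preimage_compl hu]
  · rfl
  · exact h1.add h2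
  · exact (h1.add h2).add h3

/-- Backhaul probability under steering errors. -/
lemma Network.measureReal_steered {p : Params} (N : Network p P) (τ : ℝ) (hg : Measurable εg)
    (hu : Measurable εu) (h : IndepFun εg εu P)
    (hN : IndepFun (fun ω => (εg ω, εu ω)) N.data P) :
    P.real {ω | ENNReal.ofReal τ ≤ N.sinr (desiredGain p (εg ω) (εu ω)) ω}
      = P.real {ω | |εg ω| ≤ p.thG / 2} * P.real {ω | |εu ω| ≤ p.thU / 2}
          * N.S τ (p.GgMax * p.GuMax)
        + P.real {ω | |εg ω| ≤ p.thG / 2} * (1 - P.real {ω | |εu ω| ≤ p.thU / 2})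
          * N.S τ (p.GgMax * p.GuMin)
        + (1 - P.real {ω | |εg ω| ≤ p.thG / 2}) * P.real {ω | |εu ω| ≤ p.thU / 2}
          * N.S τ (p.GgMin * p.GuMax)
        + (1 - P.real {ω | |εg ω| ≤ p.thG / 2}) * (1 - P.real {ω | |εu ω| ≤ p.thU / 2})
          * N.S τ (p.GgMin * p.GuMin) := by
  set s : Set ℝ := {x | |x| ≤ p.thG / 2} with hs
  set t : Set ℝ := {x | |x| ≤ p.thU / 2} with ht
  have hsm : MeasurableSet s := measurableSet_abs_le _
  have htm : MeasurableSet t := measurableSet_abs_le _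
  set E : Set Ω := {ω | ENNReal.ofReal τ ≤ N.sinr (desiredGain p (εg ω) (εu ω)) ω} with hE
  have hcell : ∀ {s' t' : Set ℝ} (g : ℝ), MeasurableSet s' → MeasurableSet t' →
      (∀ x ∈ s', ∀ y ∈ t', desiredGain p x y = g) →
      P.real (E ∩ εg ⁻¹' s' ∩ εu ⁻¹' t')
        = P.real (εg ⁻¹' s') * P.real (εu ⁻¹' t') * N.S τ g := by
    intro s' t' g hs' ht' hgain
    obtain ⟨B, hB, hEB⟩ := N.exists_preimage_data τ g
    rw [Network.S, hEB, ← measureReal_inter_preimage h hN hs' ht' hB, ← hEB]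
    congr 1
    ext ω
    simp only [mem_inter_iff, mem_preimage, hE, mem_ofPred_eq, and_assoc]
    exact and_congr_left fun h1 => by rw [hgain _ h1.1 _ h1.2]
  rw [← measureReal_inter_add_sdiff (s := E) (hg hsm),
    ← measureReal_inter_add_sdiff (s := E ∩ εg ⁻¹' s) (hu htm),
    ← measureReal_inter_add_sdiff (s := E \ εg ⁻¹' s) (hu htm)]
  simp only [sdiff_eq, ← preimage_compl]
  rw [hcell (p.GgMax * p.GuMax) hsm htm, hcell (p.GgMax * p.GuMin) hsm htm.compl,
    hcell (p.GgMin * p.GuMax) hsm.compl htm, hcell (p.GgMin * p.GuMin) hsm.compl htm.compl,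
    measureReal_preimage_compl hg, measureReal_preimage_compl hu, ← add_assoc]
  · rfl
  all_goals
    intro x hx y hy
    simp only [hs, ht, mem_compl_iff, mem_ofPred_eq] at hx hy
    simp [desiredGain, steeredGain, hx, hy]

end Steering

end Backhaul

end

open Backhaul in
theorem theorem1 (p : Params) (hp : p.Valid) {Ω : Type*} [MeasurableSpace Ω] (P : Measure Ω)
    [IsProbabilityMeasure P] (N : Network p P) (τ : ℝ) (hτ : 0 < τ) :
    (∀ ξ, P.real (N.assoc ξ) = p.A ξ) ∧
    (∀ g : ℝ, 0 < g →
      N.S τ g = p.A .los * N.condS .los τ g + p.A .nlos * N.condS .nlos τ g ∧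
      ∀ ξ,
        N.condS ξ τ g
          = ∫ ω, gammaTail (p.m ξ) (N.fadingThreshold τ g ω) ∂(cond P (N.assoc ξ)) ∧
        ∫ ω, alzerTail (p.m ξ) (alzerRate (p.m ξ)) (N.fadingThreshold τ g ω)
            ∂(cond P (N.assoc ξ))
          = p.formula ξ (alzerRate (p.m ξ)) τ g ∧
        N.condS ξ τ g ≤ p.formula ξ (alzerRate (p.m ξ)) τ g ∧
        p.formula ξ (p.m ξ) τ g ≤ N.condS ξ τ g ∧
        (p.m ξ = 1 → N.condS ξ τ g = p.formula ξ (alzerRate (p.m ξ)) τ g)) ∧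
    (∀ εg εu : Ω → ℝ, Measurable εg → Measurable εu → IndepFun εg εu P →
      IndepFun (fun ω => (εg ω, εu ω)) N.data P →
      P.real {ω | ENNReal.ofReal τ ≤ N.sinr (desiredGain p (εg ω) (εu ω)) ω}
        = ∫ ω, N.S τ (desiredGain p (εg ω) (εu ω)) ∂P ∧
      P.real {ω | ENNReal.ofReal τ ≤ N.sinr (desiredGain p (εg ω) (εu ω)) ω}
        = P.real {ω | |εg ω| ≤ p.thG / 2} * P.real {ω | |εu ω| ≤ p.thU / 2}
            * N.S τ (p.GgMax * p.GuMax)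
          + P.real {ω | |εg ω| ≤ p.thG / 2} * (1 - P.real {ω | |εu ω| ≤ p.thU / 2})
            * N.S τ (p.GgMax * p.GuMin)
          + (1 - P.real {ω | |εg ω| ≤ p.thG / 2}) * P.real {ω | |εu ω| ≤ p.thU / 2}
            * N.S τ (p.GgMin * p.GuMax)
          + (1 - P.real {ω | |εg ω| ≤ p.thG / 2}) * (1 - P.real {ω | |εu ω| ≤ p.thU / 2})
            * N.S τ (p.GgMin * p.GuMin)) := by
  have hS := fun g (hg : 0 < g) ξ => N.condS_eq_integral_gammaTail hp ξ τ hg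
  refine ⟨N.measureReal_assoc hp, fun g hg => ⟨N.S_eq hp τ g, fun ξ => ⟨hS g hg ξ,
    N.integral_alzerTail hp ξ (alzerRate_pos (hp.m_pos ξ)).le hτ.le hg,
    N.condS_le_formula hp ξ hτ.le hg, N.formula_le_condS hp ξ hτ.le hg, fun hm => ?_⟩⟩,
    fun εg εu hg hu h hN => ?_⟩
  · refine le_antisymm (N.condS_le_formula hp ξ hτ.le hg) ?_
    -- for `m = 1` the two rate constants agree
    have hrate : alzerRate (p.m ξ) = p.m ξ := by rw [hm, alzerRate_one, Nat.cast_one]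
    rw [hrate]
    exact N.formula_le_condS hp ξ hτ.le hg
  · have hP := N.measureReal_steered τ hg hu h hN
    exact ⟨hP.trans (integral_desiredGain p hg hu h (N.S τ)).symm, hP⟩
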